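/- Notation. Let $\mathcal S_0$ be the space of Schwartz functions on $\mathbb R^3$ all of whose moments vanish; its dual is the space $\mathcal S'/\mathcal P$ of tempered distributions modulo polynomials. Fix a Littlewood–Paley decomposition $\sum_{k\in\mathbb Z}\Delta_k=\mathrm{Id}$ on $\mathcal S'/\mathcal P$, where $\Delta_k$ is the convolution with $2^{3k}h(2^k\cdot)$ for a radial Schwartz function $h$ with $\hat h$ supported in $\{\frac12\le|\xi|\le 2\}$ and $\sum_k\hat h(2^{-k}\xi)=1$ for $\xi\ne0$. For $T\in(0,\infty]$, $r,q\in[1,\infty]$ and $\sigma\in\mathbb R$ set $$\|u\|_{\widetilde L^r([0,T);\dot B^\sigma_{2,q})}=\Big\|\big(2^{k\sigma}\|\Delta_ku\|_{L^r([0,T);L^2(\mathbb R^3))}\big)_{k\in\mathbb Z}\Big\|_{\ell^q(\mathbb Z)}.$$ Let $P=(-\Delta)^{-1}\operatorname{curl}\operatorname{curl}$ be the Leray projector. Let $F$ and $G$ be measurable families, indexed by $t\in[0,T)$, of (real or complex) vector-valued tempered distributions modulo polynomials on $\mathbb R^3$ such that $\operatorname{div}F=0$ and such that $\varphi*(\nabla\times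 F(t))(x)$ and $\psi*G(t)(x)$ are colinear for all $t\in[0,T)$, $x\in\mathbb R^3$ and all radially symmetric $\varphi,\psi\in\mathcal S_0$. Define $$P(F\times G)=\sum_{j,k\in\mathbb Z}P(\Delta_jF\times\Delta_kG).$$ Let $a,a_1,a_2,c,c_1,c_2\in[1,\infty]$ with $\frac1a=\frac1{a_1}+\frac1{a_2}$. In each case below, whenever the norms on the right-hand side are finite, the series defining $P(F\times G)$ converges unconditionally in $\mathcal S'/\mathcal P$ for almost every $t\in[0,T)$, its sum coincides with the Leray projection of the pointwise product at almost every time at which both fields are square integrable, and the stated estimate holds with a constant that depends only on $s$, $\eta$ and $h$. 1. If $s<\frac32$, $\eta<\frac52$, $s+\eta>0$ and $\frac1c=\frac1{c_1}+\frac1{c_2}$, then $$\|P(F\times G)\|_{\widetilde L^a([0,T);\dot B^{s+\eta-3/2}_{2,c})}\lesssim\|F\|_{\widetilde L^{a_1}([0,T);\dot B^s_{2,c_1})}\|G\|_{\widetilde L^{a_2}([0,T);\dot B^\eta_{2,c_2})}.$$ 2. If $-\frac32<\eta<\frac52$ and $F$ is given by a measurable function in $L^{a_1}([0,T);L^\infty)$,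 then $$\|P(F\times G)\|_{\widetilde L^a([0,T);\dot B^{\eta}_{2,c})}\lesssim\Big(\|F\|_{L^{a_1}([0,T);L^\infty)}+\|F\|_{\widetilde L^{a_1}([0,T);\dot B^{3/2}_{2,\infty})}\Big)\|G\|_{\widetilde L^{a_2}([0,T);\dot B^\eta_{2,c})}.$$ Here $F$ is a bounded function, given exactly and not only modulo polynomials, at almost every time. Accordingly, in this case $P(F\times G)=\sum_{k}P(F\times\Delta_kG)$, and it coincides with the Leray projection of the pointwise product at almost every time at which $G$ is square integrable. 3. If $-\frac52<s<\frac32$, or if $s=\frac32$ and $c=1$, then $$\|P(F\times G)\|_{\widetilde L^a([0,T);\dot B^{s+1}_{2,c})}\lesssim\|F\|_{\widetilde L^{a_1}([0,T);\dot B^s_{2,c})}\|G\|_{\widetilde L^{a_2}([0,T);\dot B^{5/2}_{2,1})}.$$ -/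

import Mathlib

open MeasureTheory
open scoped SchwartzMap FourierTransform LineDeriv Laplacian ENNReal NNReal Matrix

noncomputable section

/-- Three-dimensional Euclidean space. -/
abbrev E3 := EuclideanSpace ℝ (Fin 3)

/-- Vector-valued tempered distributions on `ℝ³` (with values in `ℂ³`, hence in particular
in `ℝ³`), given by their components. -/
abbrev VecDist := Fin 3 → 𝓢'(E3, ℂ)

/-- Schwartz vector fields. -/
abbrev VecSchwartz := Fin 3 → 𝓢(E3, ℂ)

/-- The standard basis vectors of `ℝ³`. -/
def stdVec (i : Fin 3) : E3 := EuclideanSpace.single i (1 : ℝ)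

/-- The curl, for fields of Schwartz functions as well as of tempered distributions. -/
def curl {A : Type*} [LineDeriv E3 A A] [Sub A] (u : Fin 3 → A) : Fin 3 → A :=
  ![∂_{stdVec 1} (u 2) - ∂_{stdVec 2} (u 1),
    ∂_{stdVec 2} (u 0) - ∂_{stdVec 0} (u 2),
    ∂_{stdVec 0} (u 1) - ∂_{stdVec 1} (u 0)]

/-- The space `𝓢₀` of Schwartz functions all of whose moments vanish. The dual of `𝓢₀` is the
space `𝓢'/𝒫` of tempered distributions modulo polynomials: two tempered distributions differ
by a polynomial if and only if they agree on `𝓢₀`. All notions below see a tempered distribution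
only through its values on `𝓢₀`. -/
def IsS0 (φ : 𝓢(E3, ℂ)) : Prop :=
  ∀ α : Fin 3 → ℕ, ∫ x : E3, (∏ i, ((x i : ℝ) : ℂ) ^ α i) * φ x = 0

/-- Radially symmetric functions. -/
def IsRadial (φ : 𝓢(E3, ℂ)) : Prop :=
  ∀ x y : E3, ‖x‖ = ‖y‖ → φ x = φ y

/-- The Schwartz function `y ↦ φ (x - y)`. -/
def reflectAt (φ : 𝓢(E3, ℂ)) (x : E3) : 𝓢(E3, ℂ) :=
  SchwartzMap.compSubConstCLM ℂ x
    (SchwartzMap.compCLMOfContinuousLinearEquiv ℂ (ContinuousLinearEquiv.neg ℝ (M := E3)) φ)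

theorem reflectAt_apply (φ : 𝓢(E3, ℂ)) (x y : E3) : reflectAt φ x y = φ (x - y) := by
  change φ (-(y - x)) = φ (x - y)
  rw [neg_sub]

/-- The convolution `x ↦ ∫ φ (x - y) u(y) dy` of a vector-valued tempered distribution with a
Schwartz function; it is a function. -/
def conv (φ : 𝓢(E3, ℂ)) (u : VecDist) (x : E3) : Fin 3 → ℂ :=
  fun i => u i (reflectAt φ x)

/-- The `L¹`-normalized dilation `x ↦ 2^{3k} φ (2^k x)`. -/
def dilate (k : ℤ) (φ : 𝓢(E3, ℂ)) : 𝓢(E3, ℂ) :=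
  (((2 : ℝ) ^ (3 * k) : ℝ) : ℂ) •
    SchwartzMap.compCLMOfContinuousLinearEquiv ℂ
      (ContinuousLinearEquiv.smulLeft (M₁ := E3) (R₁ := ℝ)
        (Units.mk0 ((2 : ℝ) ^ k) (zpow_ne_zero k two_ne_zero))) φ

theorem dilate_apply (k : ℤ) (φ : 𝓢(E3, ℂ)) (x : E3) :
    dilate k φ x = (((2 : ℝ) ^ (3 * k) : ℝ) : ℂ) * φ (((2 : ℝ) ^ k) • x) := rfl

/-- A Littlewood--Paley decomposition: a radial Schwartz function whose Fourier transform
is supported in the annulus `1/2 ≤ |ξ| ≤ 2` and whose dyadic dilations form a partition of unity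
away from the origin. Mathlib's Fourier transform has kernel `exp (-2πi x·ξ)`, so that the
frequency variable of the convention `exp (-i x·ξ)` is `2πξ`. -/
structure LittlewoodPaley where
  kernel : 𝓢(E3, ℂ)
  radial : IsRadial kernel
  annulus : ∀ ξ : E3, 𝓕 kernel ξ ≠ 0 → 1 / 2 ≤ 2 * Real.pi * ‖ξ‖ ∧ 2 * Real.pi * ‖ξ‖ ≤ 2
  partition : ∀ ξ : E3, ξ ≠ 0 →
    HasSum (fun k : ℤ => 𝓕 kernel (((2 : ℝ) ^ (-k)) • ξ)) 1

/-- Littlewood--Paley decompositions exist. -/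
theorem LittlewoodPaley.nonempty : Nonempty LittlewoodPaley := by
  let χ : E3 → ℝ := fun x => Real.smoothTransition (2 - ‖x‖)
  have χ1 : ∀ x, ‖x‖ ≤ 1 → χ x = 1 := fun x hx =>
    Real.smoothTransition.one_of_one_le (by linarith)
  have χ0 : ∀ x, 2 ≤ ‖x‖ → χ x = 0 := fun x hx =>
    Real.smoothTransition.zero_of_nonpos (by linarith)
  have χs : ContDiff ℝ (⊤ : ℕ∞) χ := by
    rw [contDiff_iff_contDiffAt]
    intro x
    by_cases hx : x = 0
    · have : χ =ᶠ[nhds x] fun _ => 1 := by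
        subst hx
        filter_upwards [Metric.ball_mem_nhds (0 : E3) one_pos] with y hy
        exact χ1 y (by simpa using (mem_ball_zero_iff.mp hy).le)
      exact contDiffAt_const.congr_of_eventuallyEq this
    · exact Real.smoothTransition.contDiff.contDiffAt.comp x
        (contDiffAt_const.sub (contDiffAt_norm ℝ hx))
  let ψ : E3 → ℂ := fun x => ((χ ((2 * Real.pi) • x) - χ ((4 * Real.pi) • x) : ℝ) : ℂ)
  have nrm : ∀ (r : ℝ) (x : E3), 0 < r → ‖r • x‖ = r * ‖x‖ := fun r x hr => by
    rw [norm_smul, Real.norm_of_nonneg hr.le]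
  have hpi := Real.pi_pos
  have ψs : ContDiff ℝ (⊤ : ℕ∞) ψ := by
    apply Complex.ofRealCLM.contDiff.comp
    exact (χs.comp (contDiff_const_smul _)).sub (χs.comp (contDiff_const_smul _))
  have ψann : ∀ ξ, ψ ξ ≠ 0 → 1 / 2 ≤ 2 * Real.pi * ‖ξ‖ ∧ 2 * Real.pi * ‖ξ‖ ≤ 2 := by
    intro ξ h
    constructor
    · by_contra! hc
      apply h
      simp only [ψ]
      rw [χ1 _ (by rw [nrm _ _ (by positivity)]; linarith),
        χ1 _ (by rw [nrm _ _ (by positivity)]; linarith)]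
      simp
    · by_contra! hc
      apply h
      simp only [ψ]
      rw [χ0 _ (by rw [nrm _ _ (by positivity)]; linarith),
        χ0 _ (by rw [nrm _ _ (by positivity)]; linarith)]
      simp
  have ψc : HasCompactSupport ψ := by
    apply HasCompactSupport.of_support_subset_isCompact (isCompact_closedBall (0 : E3) 1)
    intro ξ h
    have := (ψann ξ h).2
    have h3 := Real.pi_gt_three
    simp only [Metric.mem_closedBall, dist_zero_right]
    nlinarith [norm_nonneg ξ]
  have ψrad : ∀ x y : E3, ‖x‖ = ‖y‖ → ψ x = ψ y := by
    intro x y h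
    simp only [ψ, χ, norm_smul, h]
  let Ψ : 𝓢(E3, ℂ) := ψc.toSchwartzMap ψs
  have hF : 𝓕 (𝓕⁻ Ψ) = Ψ := FourierTransform.fourier_fourierInv_eq Ψ
  have hv : ∀ ξ, 𝓕 (𝓕⁻ Ψ) ξ = ψ ξ := fun ξ => by rw [hF]; rfl
  refine ⟨⟨𝓕⁻ Ψ, ?_, fun ξ h => ψann ξ (by rwa [hv] at h), ?_⟩⟩
  · intro x y h
    obtain ⟨A, hA⟩ : ∃ A : E3 ≃ₗᵢ[ℝ] E3, A y = x :=
      ⟨(ℝ ∙ (y - x))ᗮ.reflection, Submodule.reflection_sub h.symm⟩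
    have hcomp : (Ψ : E3 → ℂ) ∘ A = Ψ := by
      funext z
      exact ψrad _ _ (A.norm_map z)
    have h1 := congrFun (SchwartzMap.fourierInv_coe Ψ) x
    have h2 := congrFun (SchwartzMap.fourierInv_coe Ψ) y
    rw [h1, h2, ← hA]
    have := Real.fourierInv_comp_linearIsometry A (Ψ : E3 → ℂ) y
    rw [hcomp] at this
    exact this.symm
  · intro ξ hξ
    simp only [hv]
    let g : ℤ → ℝ := fun k => χ ((2 ^ (-k) * (2 * Real.pi)) • ξ)
    have hterm : ∀ k : ℤ, ψ (((2 : ℝ) ^ (-k)) • ξ) = ((g k - g (k - 1) : ℝ) : ℂ) := by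
      intro k
      simp only [ψ, g, smul_smul]
      congr 4
      · ring
      · rw [show -(k - 1) = -k + 1 by ring, zpow_add₀ two_ne_zero]
        ring_nf
    have gmono : ∀ k : ℤ, ‖(2 ^ (-k) * (2 * Real.pi) : ℝ) • ξ‖ =
        2 ^ (-k) * (2 * Real.pi * ‖ξ‖) := fun k => by
      rw [nrm _ _ (by positivity), mul_assoc]
    have hr : 0 < 2 * Real.pi * ‖ξ‖ := by have := norm_pos_iff.mpr hξ; positivity
    set r := 2 * Real.pi * ‖ξ‖
    obtain ⟨n₁, hn₁⟩ := pow_unbounded_of_one_lt r one_lt_two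
    obtain ⟨n₂, hn₂⟩ := pow_unbounded_of_one_lt (2 / r) one_lt_two
    have g1 : ∀ k : ℤ, (n₁ : ℤ) ≤ k → g k = 1 := by
      intro k hk
      apply χ1
      rw [gmono, zpow_neg, inv_mul_le_one₀ (by positivity)]
      calc r ≤ (2 : ℝ) ^ (n₁ : ℤ) := by rw [zpow_natCast]; exact hn₁.le
        _ ≤ 2 ^ k := zpow_le_zpow_right₀ one_le_two hk
    have g0 : ∀ k : ℤ, k ≤ -(n₂ : ℤ) → g k = 0 := by
      intro k hk
      apply χ0
      rw [gmono, ← div_le_iff₀ hr]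
      calc 2 / r ≤ (2 : ℝ) ^ (n₂ : ℤ) := by rw [zpow_natCast]; exact hn₂.le
        _ ≤ 2 ^ (-k) := zpow_le_zpow_right₀ one_le_two (by omega)
    have tele : ∀ (b : ℤ) (n : ℕ),
        ∑ k ∈ Finset.Ioc b (b + n), (g k - g (k - 1)) = g (b + n) - g b := by
      intro b n
      induction n with
      | zero => simp
      | succ n ih =>
        have : Finset.Ioc b (b + ((n + 1 : ℕ) : ℤ)) =
            insert (b + n + 1) (Finset.Ioc b (b + n)) := by
          ext k
          simp only [Finset.mem_Ioc, Finset.mem_insert]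
          omega
        rw [this, Finset.sum_insert (by simp), ih]
        push_cast
        rw [← add_assoc, add_sub_cancel_right]
        ring
    have hsum := tele (-(n₂ : ℤ)) (n₂ + n₁)
    rw [g1 _ (by push_cast; omega), g0 _ le_rfl, sub_zero] at hsum
    have key : HasSum (fun k : ℤ => g k - g (k - 1)) 1 := by
      rw [← hsum]
      apply hasSum_sum_of_ne_finset_zero
      intro k hk
      simp only [Finset.mem_Ioc, not_and_or, not_lt, not_le] at hk
      push_cast at hk
      rcases hk with hk | hk
      · rw [g0 k hk, g0 (k - 1) (by omega), sub_zero]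
      · rw [g1 k (by omega), g1 (k - 1) (by omega), sub_self]
    simp only [hterm]
    have key' := Complex.hasSum_ofReal.mpr key
    rw [Complex.ofReal_one] at key'
    exact key'

/-- The frequency localization `Δ_k u`, a smooth function with frequencies in
`2^{k-1} ≤ |ξ| ≤ 2^{k+1}`. -/
def LittlewoodPaley.block (L : LittlewoodPaley) (k : ℤ) (u : VecDist) : E3 → Fin 3 → ℂ :=
  conv (dilate k L.kernel) u

/-- The time interval `[0,T)`, with `T = ∞` allowed. -/
def timeInterval (T : ℝ≥0∞) : Set ℝ := {t | 0 ≤ t ∧ ENNReal.ofReal t < T}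

/-- The norm of `L^p(ℝ³)`, with the Euclidean norm on `ℂ³`. -/
def spaceNorm (p : ℝ≥0∞) (v : E3 → Fin 3 → ℂ) : ℝ≥0∞ :=
  eLpNorm (fun x => (WithLp.toLp 2 (v x) : EuclideanSpace ℂ (Fin 3))) p volume

/-- The norm of `L^r([0,T); L^p(ℝ³))`. -/
def timeSpaceNorm (T r p : ℝ≥0∞) (v : ℝ → E3 → Fin 3 → ℂ) : ℝ≥0∞ :=
  eLpNorm (fun t => spaceNorm p (v t)) r (volume.restrict (timeInterval T))

/-- The homogeneous Chemin--Lerner norm of `L̃^r([0,T); Ḃ^s_{p,q}(ℝ³))`, that is, the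
`ℓ^q(ℤ)` norm of the sequence `2^{ks} ‖Δ_k u‖_{L^r([0,T); L^p)}`. -/
def cheminLernerNorm (L : LittlewoodPaley) (T r : ℝ≥0∞) (s : ℝ) (p q : ℝ≥0∞)
    (u : ℝ → VecDist) : ℝ≥0∞ :=
  eLpNorm (fun k : ℤ => (2 : ℝ≥0∞) ^ ((k : ℝ) * s) *
    timeSpaceNorm T r p (fun t => L.block k (u t))) q Measure.count

/-- A time-dependent field of tempered distributions modulo polynomials depends
measurably on time. -/
def WeaklyMeasurable (T : ℝ≥0∞) (u : ℝ → VecDist) : Prop :=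
  ∀ i (φ : 𝓢(E3, ℂ)), IsS0 φ →
    AEMeasurable (fun t => u t i φ) (volume.restrict (timeInterval T))

/-- The divergence vanishes (modulo polynomials). -/
def DivFree (u : VecDist) : Prop :=
  ∀ φ : 𝓢(E3, ℂ), IsS0 φ → (∑ i, ∂_{stdVec i} (u i)) φ = 0

/-- The localizations of `curl F` and of `G` by radial functions in `𝓢₀` are
colinear at every point. -/
def RadiallyColinear (F G : VecDist) : Prop :=
  ∀ φ ψ : 𝓢(E3, ℂ), IsS0 φ → IsS0 ψ → IsRadial φ → IsRadial ψ →
    ∀ x : E3, ¬ LinearIndependent ℂ ![conv φ (curl F) x, conv ψ G x]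

/-- The function `f` represents the distribution `u` modulo polynomials. -/
def Represents (f : E3 → Fin 3 → ℂ) (u : VecDist) : Prop :=
  ∀ i (φ : 𝓢(E3, ℂ)), IsS0 φ → u i φ = ∫ x, f x i * φ x

/-- `⟨curl curl (v × w), Φ⟩`, for functions `v`, `w` and a test field `Φ`. The curl
is symmetric and is moved to the test field. -/
def curlCurlCross (v w : E3 → Fin 3 → ℂ) (Φ : VecSchwartz) : ℂ :=
  ∫ x, (v x ⨯₃ w x) ⬝ᵥ (fun i => curl (curl Φ) i x)

/-- `⟨-Δ H, Φ⟩`. -/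
def negLaplacePair (H : VecDist) (Φ : VecSchwartz) : ℂ :=
  ∑ i, (-(Δ (H i))) (Φ i)

/-- `H = P (f × g)` for two functions, with `P = (-Δ)⁻¹ curl curl` the Leray projector: that
is, `-Δ H = curl curl (f × g)` modulo polynomials. This determines `H` modulo polynomials, because
`Δ` is a bijection of `𝓢₀`. -/
def IsLerayCrossFun (f g : E3 → Fin 3 → ℂ) (H : VecDist) : Prop :=
  ∀ Φ : VecSchwartz, (∀ i, IsS0 (Φ i)) → negLaplacePair H Φ = curlCurlCross f g Φ

/-- `H = P (F × G)` for tempered distributions modulo polynomials. The product is the one given by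
the Littlewood--Paley decompositions (Bony's decomposition),
`P (F × G) = ∑_{j,k} P (Δ_j F × Δ_k G)`, with unconditional convergence modulo polynomials.
If `F` and `G` are square integrable functions, `F × G` is moreover the pointwise product. -/
def IsLerayCross (L : LittlewoodPaley) (F G H : VecDist) : Prop :=
  (∀ Φ : VecSchwartz, (∀ i, IsS0 (Φ i)) →
    HasSum (fun jk : ℤ × ℤ => curlCurlCross (L.block jk.1 F) (L.block jk.2 G) Φ)
      (negLaplacePair H Φ)) ∧
  ∀ f g : E3 → Fin 3 → ℂ, MemLp f 2 → MemLp g 2 → Represents f F → Represents g G →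
    IsLerayCrossFun f g H

/-- `H = P (f × G)` when `f` is a bounded function (and not only a class modulo
polynomials): `P (f × G) = ∑_k P (f × Δ_k G)`, with unconditional convergence modulo polynomials.
If `G` is a square integrable function, `f × G` is moreover the pointwise product. -/
def IsLerayCrossBdd (L : LittlewoodPaley) (f : E3 → Fin 3 → ℂ) (G H : VecDist) : Prop :=
  (∀ Φ : VecSchwartz, (∀ i, IsS0 (Φ i)) →
    HasSum (fun k : ℤ => curlCurlCross f (L.block k G) Φ) (negLaplacePair H Φ)) ∧
  ∀ g : E3 → Fin 3 → ℂ, MemLp g 2 → Represents g G → IsLerayCrossFun f g H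

/-- The standing assumptions on the pair `F`, `G` of time-dependent fields. -/
structure Admissible (T : ℝ≥0∞) (F G : ℝ → VecDist) : Prop where
  measurable_left : WeaklyMeasurable T F
  measurable_right : WeaklyMeasurable T G
  divFree : ∀ t ∈ timeInterval T, DivFree (F t)
  colinear : ∀ t ∈ timeInterval T, RadiallyColinear (F t) (G t)

end

open Filter Topology

noncomputable section

/-! ### The Fourier transform of integrable and of square integrable functions -/

/-! Everything rests on one bound for the Leray projection of a product of two blocks, $v=\Delta_jF$
and $w=\Delta_kG$. On the annulus $2\pi|\xi|\sim 2^m$ its $L^2$ norm is at most a constant times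
`paraKer m j k` $\|v\|_2\|w\|_2$ (`annNorm_leraySym_crossConv_le`,
`LittlewoodPaley.annNorm_lerayFT_block_le`). Three regimes occur. If $j+4\le k$, only $m$ close to
$k$ contributes, and Bernstein's inequality gives $2^{3j/2}$. If $j$ and $k$ are comparable, only
$m\le\max(j,k)+3$ contributes, and the sup norm of the convolution times the square root of the
volume of the annulus gives $2^{3m/2}$. If $k+4\le j$, only $m$ close to $j$ contributes; Bernstein
alone gives $2^{3k/2}$, and the geometric hypotheses improve this by $2^{k-m}$.

The improvement is a cancellation. Since $\operatorname{div}v=0$, $\operatorname{curl}(v\times w)$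
is $(\operatorname{curl}v)\times w+\nabla(v\cdot w)$ plus terms in which the derivative falls on $w$
(`cross_cross_identity`). The first term vanishes by colinearity, because Littlewood–Paley kernels
are radial and lie in $\mathcal S_0$. The gradient is killed by the second curl of $P$. What remains
costs $2^k$ instead of $2^m$, hence the factor $2^{k-m}$ once $(-\Delta)^{-1}\operatorname{curl}$ is
applied (`norm_leraySym_le_of_cross`, `enorm_leraySym_crossConv_le`). This is why $\eta$ may go up
to $5/2$ rather than $3/2$.

Summation over blocks is then a matter of sequences. By translation covariance (`paraKer_add`) the
weighted sum is a bilinear convolution on $\mathbb Z$ with kernel `weightKer s η`, whose three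
regimes decay at the rates $3/2-s$, $s+\eta$ and $5/2-\eta$. If all are positive the kernel is
summable, and Minkowski and Hölder give the first case. At $\eta=5/2$ it is dominated by a summable
function of the index of $F$ alone, and the $\ell^1$ norm of $G$ absorbs the other sum. At $s=3/2$,
$\eta=5/2$ it is dominated by a sum of two summable functions of one index each, which suffices for
$\ell^1\times\ell^1\to\ell^1$.

For bounded $F$, the output at $m$ is estimated by Hölder if $|m-k|\le 7$. Otherwise it only sees
the frequencies of $F$ near $2^{\max(m,k)}$, so that $F$ may be replaced by nine of its blocks
(`LittlewoodPaley.fourierL2_mul_eq_sum`) and the bilinear bound applies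
(`LittlewoodPaley.annNorm_lerayFT_bdd_le`).

Two facts make this rigorous for distributions modulo polynomials. A block in $L^2$ is the inverse
Fourier transform of an $L^2$ function supported in its annulus
(`LittlewoodPaley.spectralRep_block`). Conversely, a family of Fourier transforms with controlled
dyadic norms defines a distribution, because transforms of functions in $\mathcal S_0$ decay rapidly
at $0$ and at infinity (`exists_hasSum_fourierInv`). -/

theorem integral_fourier_mul {f g : E3 → ℂ} (hf : Integrable f) (hg : Integrable g) :
    ∫ x, 𝓕 f x * g x = ∫ x, f x * 𝓕 g x :=
  VectorFourier.integral_fourierIntegral_smul_eq_flip (μ := volume) (ν := volume)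
    (L := innerₗ E3) (f := f) (g := g) Real.continuous_fourierChar continuous_inner hf hg |>.trans
    (by simp [flip_innerₗ]; rfl)

theorem integral_fourierInv_mul {f g : E3 → ℂ} (hf : Integrable f) (hg : Integrable g) :
    ∫ x, 𝓕⁻ f x * g x = ∫ x, f x * 𝓕⁻ g x := by
  rw [Real.fourierInv_eq_fourier_comp_neg, integral_fourier_mul hf.comp_neg hg,
    ← integral_neg_eq_self]
  simp only [neg_neg, Real.fourierInv_eq_fourier_neg]

theorem continuous_fourier_of_integrable {f : E3 → ℂ} (hf : Integrable f) : Continuous (𝓕 f) :=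
  VectorFourier.fourierIntegral_continuous (L := innerₗ E3) Real.continuous_fourierChar
    continuous_inner hf

theorem continuous_fourierInv_of_integrable {f : E3 → ℂ} (hf : Integrable f) :
    Continuous (𝓕⁻ f) := by
  rw [Real.fourierInv_eq_fourier_comp_neg]
  exact continuous_fourier_of_integrable hf.comp_neg

theorem norm_fourier_le_integral {f : E3 → ℂ} (x : E3) : ‖𝓕 f x‖ ≤ ∫ ξ, ‖f ξ‖ :=
  VectorFourier.norm_fourierIntegral_le_integral_norm _ _ _ _ _

theorem norm_fourierInv_le_integral {f : E3 → ℂ} (x : E3) : ‖𝓕⁻ f x‖ ≤ ∫ ξ, ‖f ξ‖ := by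
  rw [Real.fourierInv_eq_fourier_neg]
  exact norm_fourier_le_integral _

/-- A locally integrable function on an open set is determined by its integrals against
Schwartz functions. -/
theorem ae_eq_on_of_integral_mul_schwartz {U : Set E3} (hU : IsOpen U) {f g : E3 → ℂ}
    (hf : LocallyIntegrable f) (hg : LocallyIntegrable g)
    (h : ∀ φ : 𝓢(E3, ℂ), tsupport φ ⊆ U → HasCompactSupport φ →
      ∫ x, f x * φ x = ∫ x, g x * φ x) :
    ∀ᵐ x, x ∈ U → f x = g x := by
  have := hU.ae_eq_zero_of_integral_contDiff_smul_eq_zero (μ := volume) (f := fun x => f x - g x)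
    ((hf.sub hg).locallyIntegrableOn U) ?_
  · filter_upwards [this] with x hx hxU using sub_eq_zero.mp (hx hxU)
  intro φ hφ hc hs
  have hc' : HasCompactSupport (fun x => ((φ x : ℝ) : ℂ)) :=
    hc.comp_left (g := fun r : ℝ => (r : ℂ)) Complex.ofReal_zero
  have hs' : tsupport (fun x => ((φ x : ℝ) : ℂ)) ⊆ U :=
    (closure_mono (Function.support_comp_subset (g := fun r : ℝ => (r : ℂ))
      Complex.ofReal_zero φ)).trans hs
  have key := h (hc'.toSchwartzMap (Complex.ofRealCLM.contDiff.comp hφ)) hs' hc'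
  have e1 : Integrable (fun x => f x * ((φ x : ℝ) : ℂ)) := by
    simpa [mul_comm] using hf.integrable_smul_left_of_hasCompactSupport
      (g := fun x => ((φ x : ℝ) : ℂ)) (by fun_prop) hc'
  have e2 : Integrable (fun x => g x * ((φ x : ℝ) : ℂ)) := by
    simpa [mul_comm] using hg.integrable_smul_left_of_hasCompactSupport
      (g := fun x => ((φ x : ℝ) : ℂ)) (by fun_prop) hc'
  calc ∫ x, φ x • (f x - g x) = ∫ x, (f x * ((φ x : ℝ) : ℂ) - g x * ((φ x : ℝ) : ℂ)) := by
        congr 1; ext x; rw [Complex.real_smul]; ring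
    _ = 0 := by
        rw [integral_sub e1 e2, sub_eq_zero]
        exact key

theorem ae_eq_of_integral_mul_schwartz {f g : E3 → ℂ}
    (hf : LocallyIntegrable f) (hg : LocallyIntegrable g)
    (h : ∀ φ : 𝓢(E3, ℂ), ∫ x, f x * φ x = ∫ x, g x * φ x) : f =ᵐ[volume] g := by
  filter_upwards [ae_eq_on_of_integral_mul_schwartz isOpen_univ hf hg fun φ _ _ => h φ] with x hx
  exact hx trivial

theorem MeasureTheory.MemLp.locallyIntegrable_two {f : E3 → ℂ} (hf : MemLp f 2) :
    LocallyIntegrable f := hf.locallyIntegrable one_le_two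

/-- The Fourier transform of a square integrable function, and `0` for other functions. -/
def fourierL2 (f : E3 → ℂ) : E3 → ℂ :=
  open Classical in
  if h : MemLp f 2 then ((𝓕 (h.toLp f) : Lp ℂ 2 (volume : Measure E3)) : E3 → ℂ) else 0

theorem memLp_fourierL2 (f : E3 → ℂ) : MemLp (fourierL2 f) 2 := by
  unfold fourierL2
  split_ifs with h
  · exact Lp.memLp _
  · exact MemLp.zero'

theorem eLpNorm_fourierL2 {f : E3 → ℂ} (hf : MemLp f 2) :
    eLpNorm (fourierL2 f) 2 = eLpNorm f 2 := by
  have h := Lp.norm_fourier_eq (hf.toLp f)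
  rw [Lp.norm_def, Lp.norm_def, ENNReal.toReal_eq_toReal_iff' (Lp.eLpNorm_ne_top _)
    (Lp.eLpNorm_ne_top _), eLpNorm_congr_ae hf.coeFn_toLp] at h
  rw [← h, fourierL2, dif_pos hf]

/-- Both sides are continuous in $g\in L^2$, so density reduces the claim to Schwartz $g$. There it
says that the $L^2$ transform of $f$ agrees with its transform as a tempered distribution. -/
theorem integral_fourierLp_mul (f g : Lp ℂ 2 (volume : Measure E3)) :
    ∫ x, (𝓕 f : Lp ℂ 2 (volume : Measure E3)) x * g x = ∫ x, f x * (𝓕 g : Lp ℂ 2 (volume : Measure E3)) x := by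
  have hcont : ∀ f : Lp ℂ 2 (volume : Measure E3), Continuous fun g : Lp ℂ 2 (volume : Measure E3) =>
      ∫ x, f x * g x := by
    intro f
    have := (((ContinuousLinearMap.mul ℂ ℂ).lpPairing volume 2 2) f).continuous
    refine this.congr fun g => ?_
    rw [ContinuousLinearMap.lpPairing_eq_integral]
    rfl
  refine DenseRange.induction_on (p := fun g : Lp ℂ 2 (volume : Measure E3) =>
      ∫ x, (𝓕 f : Lp ℂ 2 (volume : Measure E3)) x * g x = ∫ x, f x * (𝓕 g : Lp ℂ 2 (volume : Measure E3)) x)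
    (SchwartzMap.denseRange_toLpCLM (p := 2) (μ := volume) ENNReal.ofNat_ne_top) g ?_ ?_
  · exact isClosed_eq (hcont _) ((hcont f).comp (Lp.fourierTransformₗᵢ E3 ℂ).continuous)
  · intro φ
    have h1 := DFunLike.congr_fun (Lp.fourier_toTemperedDistribution_eq f) φ
    rw [TemperedDistribution.fourier_apply, Lp.toTemperedDistribution_apply,
      Lp.toTemperedDistribution_apply] at h1
    have h2 : ((SchwartzMap.toLpCLM ℝ ℂ 2 volume) φ : Lp ℂ 2 (volume : Measure E3)) =
      φ.toLp 2 volume := rfl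
    rw [h2, SchwartzMap.toLp_fourier_eq]
    calc _ = ∫ x, φ x • (𝓕 f : Lp ℂ 2 (volume : Measure E3)) x := by
          refine integral_congr_ae ?_
          filter_upwards [φ.coeFn_toLp 2 volume] with x hx
          rw [hx, smul_eq_mul, mul_comm]
      _ = _ := h1.symm
      _ = _ := by
          refine integral_congr_ae ?_
          filter_upwards [(𝓕 φ).coeFn_toLp 2 volume] with x hx
          rw [hx, smul_eq_mul, mul_comm]

theorem integral_fourierL2_mul_fourierL2 {f g : E3 → ℂ} (hf : MemLp f 2) (hg : MemLp g 2) :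
    ∫ x, fourierL2 f x * g x = ∫ x, f x * fourierL2 g x := by
  have h := integral_fourierLp_mul (hf.toLp f) (hg.toLp g)
  unfold fourierL2
  rw [dif_pos hf, dif_pos hg]
  calc _ = _ := by
        refine integral_congr_ae ?_
        filter_upwards [hg.coeFn_toLp] with x hx
        rw [hx]
    _ = _ := h
    _ = _ := by
        refine integral_congr_ae ?_
        filter_upwards [hf.coeFn_toLp] with x hx
        rw [hx]

theorem fourierL2_schwartz (φ : 𝓢(E3, ℂ)) : fourierL2 φ =ᵐ[volume] (𝓕 φ : 𝓢(E3, ℂ)) := by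
  unfold fourierL2
  rw [dif_pos (φ.memLp 2 volume)]
  have : (φ.memLp 2 volume).toLp φ = φ.toLp 2 := rfl
  rw [this, SchwartzMap.toLp_fourier_eq]
  exact (𝓕 φ).coeFn_toLp 2 volume

theorem integral_fourierL2_mul_schwartz {f : E3 → ℂ} (hf : MemLp f 2) (φ : 𝓢(E3, ℂ)) :
    ∫ x, fourierL2 f x * φ x = ∫ x, f x * (𝓕 φ : 𝓢(E3, ℂ)) x := by
  rw [integral_fourierL2_mul_fourierL2 hf (φ.memLp 2 volume)]
  refine integral_congr_ae ?_
  filter_upwards [fourierL2_schwartz φ] with x hx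
  rw [hx]

/-- The Fourier transform of a square integrable function is characterized by duality. -/
theorem ae_eq_fourierL2 {f g : E3 → ℂ} (hf : MemLp f 2) (hg : LocallyIntegrable g)
    (h : ∀ φ : 𝓢(E3, ℂ), ∫ x, f x * (𝓕 φ : 𝓢(E3, ℂ)) x = ∫ x, g x * φ x) : g =ᵐ[volume] fourierL2 f :=
  ae_eq_of_integral_mul_schwartz hg (memLp_fourierL2 f).locallyIntegrable_two fun φ => by
    rw [integral_fourierL2_mul_schwartz hf, h]

/-- The transform given by the integral and the one extended from Plancherel's theorem satisfy the
same duality formula. -/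
theorem fourierL2_of_integrable {f : E3 → ℂ} (hf : MemLp f 2) (hf1 : Integrable f) :
    𝓕 f =ᵐ[volume] fourierL2 f :=
  ae_eq_fourierL2 hf (continuous_fourier_of_integrable hf1).locallyIntegrable fun φ => by
    rw [integral_fourier_mul hf1 φ.integrable]; rfl

theorem memLp_fourier {f : E3 → ℂ} (hf : MemLp f 2) (hf1 : Integrable f) : MemLp (𝓕 f) 2 :=
  (memLp_congr_ae (fourierL2_of_integrable hf hf1)).mpr (memLp_fourierL2 f)

theorem eLpNorm_fourier {f : E3 → ℂ} (hf : MemLp f 2) (hf1 : Integrable f) :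
    eLpNorm (𝓕 f) 2 = eLpNorm f 2 := by
  rw [eLpNorm_congr_ae (fourierL2_of_integrable hf hf1), eLpNorm_fourierL2 hf]

theorem memLp_comp_neg {f : E3 → ℂ} {p : ℝ≥0∞} (hf : MemLp f p) : MemLp (fun x => f (-x)) p :=
  hf.comp_measurePreserving (Measure.measurePreserving_neg volume)

theorem eLpNorm_comp_neg {f : E3 → ℂ} {p : ℝ≥0∞} (hf : AEStronglyMeasurable f) :
    eLpNorm (fun x => f (-x)) p = eLpNorm f p :=
  eLpNorm_comp_measurePreserving hf (Measure.measurePreserving_neg volume)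

theorem memLp_fourierInv {f : E3 → ℂ} (hf : MemLp f 2) (hf1 : Integrable f) :
    MemLp (𝓕⁻ f) 2 := by
  rw [Real.fourierInv_eq_fourier_comp_neg]
  exact memLp_fourier (memLp_comp_neg hf) hf1.comp_neg

theorem eLpNorm_fourierInv {f : E3 → ℂ} (hf : MemLp f 2) (hf1 : Integrable f) :
    eLpNorm (𝓕⁻ f) 2 = eLpNorm f 2 := by
  rw [Real.fourierInv_eq_fourier_comp_neg, eLpNorm_fourier (memLp_comp_neg hf) hf1.comp_neg,
    eLpNorm_comp_neg hf.1]

theorem integral_fourierL2_mul {f g : E3 → ℂ} (hf : MemLp f 2) (hg : MemLp g 2)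
    (hg1 : Integrable g) : ∫ x, fourierL2 f x * g x = ∫ x, f x * 𝓕 g x := by
  rw [integral_fourierL2_mul_fourierL2 hf hg]
  refine integral_congr_ae ?_
  filter_upwards [fourierL2_of_integrable hg hg1] with x hx
  rw [hx]

/-- The Fourier transform inverts the inverse Fourier transform. -/
theorem fourierL2_fourierInv {f : E3 → ℂ} (hf : MemLp f 2) (hf1 : Integrable f) :
    f =ᵐ[volume] fourierL2 (𝓕⁻ f) := by
  refine ae_eq_fourierL2 (memLp_fourierInv hf hf1) hf1.locallyIntegrable fun φ => ?_
  rw [integral_fourierInv_mul hf1 (𝓕 φ).integrable, ← SchwartzMap.fourierInv_coe,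
    FourierTransform.fourierInv_fourier_eq]


/-! ### Convolution of tempered distributions with Schwartz functions -/

/-- The shift $R$ of the weight leaves room for translations: it yields seminorm bounds that are
uniform over bounded sets of translates. -/
theorem SchwartzMap.exists_add_norm_pow_mul_le (φ : 𝓢(E3, ℂ)) (R : ℝ) (hR : 0 ≤ R) (k l : ℕ) :
    ∃ M, 0 ≤ M ∧ ∀ z, (‖z‖ + R) ^ k * ‖iteratedFDeriv ℝ l φ z‖ ≤ M := by
  refine ⟨(1 + R) ^ k * (2 ^ k *
    ((Finset.Iic (k, l)).sup fun m => SchwartzMap.seminorm ℝ m.1 m.2) φ), by positivity,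
    fun z => ?_⟩
  have h := SchwartzMap.one_add_le_sup_seminorm_apply (𝕜 := ℝ) (m := (k, l)) le_rfl le_rfl φ z
  calc (‖z‖ + R) ^ k * ‖iteratedFDeriv ℝ l φ z‖
      ≤ ((1 + R) * (1 + ‖z‖)) ^ k * ‖iteratedFDeriv ℝ l φ z‖ := by
        gcongr
        nlinarith [norm_nonneg z, mul_nonneg hR (norm_nonneg z)]
    _ = (1 + R) ^ k * ((1 + ‖z‖) ^ k * ‖iteratedFDeriv ℝ l φ z‖) := by rw [mul_pow]; ring
    _ ≤ _ := by gcongr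

theorem iteratedFDeriv_compSubConstCLM (φ : 𝓢(E3, ℂ)) (a x : E3) (l : ℕ) :
    iteratedFDeriv ℝ l (SchwartzMap.compSubConstCLM ℂ a φ) x = iteratedFDeriv ℝ l φ (x - a) :=
  iteratedFDeriv_comp_sub l a x

/-- Translation is continuous in the Schwartz space. -/
theorem continuous_compSubConstCLM (φ : 𝓢(E3, ℂ)) :
    Continuous fun a : E3 => SchwartzMap.compSubConstCLM ℂ a φ := by
  rw [continuous_iff_continuousAt]
  intro a
  rw [ContinuousAt, (schwartz_withSeminorms ℝ E3 ℂ).tendsto_nhds]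
  rintro ⟨k, l⟩ ε hε
  -- One more derivative is needed for the mean value inequality. For $\|b-a\|\le1$ the weight
  -- $\|z\|+\|a\|+1$ dominates $\|x\|$ at every $z$ on the segment from $x-a$ to $x-b$.
  obtain ⟨M, hM0, hM⟩ := φ.exists_add_norm_pow_mul_le (‖a‖ + 1) (by positivity) k (l + 1)
  have hball : ∀ᶠ b in 𝓝 a, ‖b - a‖ < min 1 (ε / (M + 1)) := by
    filter_upwards [Metric.ball_mem_nhds a (show 0 < min 1 (ε / (M + 1)) by positivity)] with b hb
    rwa [Metric.mem_ball, dist_eq_norm] at hb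
  filter_upwards [hball] with b hb
  have hb1 : ‖b - a‖ ≤ 1 := (hb.trans_le (min_le_left _ _)).le
  refine (SchwartzMap.seminorm_le_bound ℝ k l _ (by positivity : 0 ≤ M * ‖b - a‖) fun x => ?_).trans_lt ?_
  · have hsub : iteratedFDeriv ℝ l (SchwartzMap.compSubConstCLM ℂ b φ -
        SchwartzMap.compSubConstCLM ℂ a φ : 𝓢(E3, ℂ)) x =
        iteratedFDeriv ℝ l φ (x - b) - iteratedFDeriv ℝ l φ (x - a) := by
      have := iteratedFDeriv_sub_apply (𝕜 := ℝ) (i := l) (x := x)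
        (f := SchwartzMap.compSubConstCLM ℂ b φ) (g := SchwartzMap.compSubConstCLM ℂ a φ)
        ((SchwartzMap.smooth _ l).contDiffAt) ((SchwartzMap.smooth _ l).contDiffAt)
      rw [iteratedFDeriv_compSubConstCLM, iteratedFDeriv_compSubConstCLM] at this
      exact this
    rw [hsub]
    have hdiff : Differentiable ℝ (iteratedFDeriv ℝ l φ) :=
      (φ.smooth (l + 1)).differentiable_iteratedFDeriv (by exact_mod_cast Nat.lt_succ_self l)
    rcases eq_or_ne (‖x‖ ^ k) 0 with h0 | h0
    · rw [h0, zero_mul]; positivity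
    have hpos : 0 < ‖x‖ ^ k := lt_of_le_of_ne (by positivity) h0.symm
    have key := (convex_segment (x - a) (x - b)).norm_image_sub_le_of_norm_fderiv_le (𝕜 := ℝ)
      (f := iteratedFDeriv ℝ l φ) (C := M / ‖x‖ ^ k) (x := x - a) (y := x - b)
      (fun z _ => hdiff z) (fun z hz => ?_) (left_mem_segment _ _ _) (right_mem_segment _ _ _)
    · rw [show x - b - (x - a) = -(b - a) by abel, norm_neg] at key
      calc ‖x‖ ^ k * _ ≤ ‖x‖ ^ k * (M / ‖x‖ ^ k * ‖b - a‖) := by gcongr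
        _ = M * ‖b - a‖ := by field_simp
    · rw [le_div_iff₀ hpos, mul_comm, norm_fderiv_iteratedFDeriv]
      refine le_trans ?_ (hM z)
      gcongr
      have hz' : ‖z - (x - a)‖ ≤ 1 := by
        have := norm_sub_le_of_mem_segment hz
        rw [show x - b - (x - a) = -(b - a) by abel, norm_neg] at this
        exact this.trans hb1
      calc ‖x‖ = ‖z - (z - (x - a)) + a‖ := by congr 1; abel
        _ ≤ ‖z‖ + ‖z - (x - a)‖ + ‖a‖ := (norm_add_le _ _).trans (by gcongr; exact norm_sub_le _ _)
        _ ≤ ‖z‖ + (‖a‖ + 1) := by linarith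
  · calc M * ‖b - a‖ ≤ M * (ε / (M + 1)) := by gcongr; exact (hb.trans_le (min_le_right _ _)).le
      _ < ε := by rw [← mul_div_assoc, div_lt_iff₀ (by positivity)]; nlinarith

theorem continuous_reflectAt (φ : 𝓢(E3, ℂ)) : Continuous (reflectAt φ) :=
  continuous_compSubConstCLM _

theorem continuous_conv (φ : 𝓢(E3, ℂ)) (u : VecDist) : Continuous (conv φ u) :=
  continuous_pi fun i => (u i).continuous.comp (continuous_reflectAt φ)

theorem fourierInv_reflectAt (φ : 𝓢(E3, ℂ)) (x ξ : E3) :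
    𝓕⁻ (reflectAt φ x) ξ = (Real.fourierChar (inner ℝ x ξ) : ℂ) * 𝓕 φ ξ := by
  rw [SchwartzMap.fourierInv_coe, SchwartzMap.fourier_coe, Real.fourierInv_eq, Real.fourier_eq,
    ← integral_const_mul, ← integral_sub_left_eq_self (μ := volume) _ x]
  congr 1
  ext y
  rw [reflectAt_apply, sub_sub_cancel, inner_sub_left, sub_eq_add_neg, AddChar.map_add_eq_mul,
    Circle.smul_def, Circle.smul_def, Circle.coe_mul]
  simp [mul_assoc]

theorem lineDeriv_reflectAt (φ : 𝓢(E3, ℂ)) (x v : E3) :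
    ∂_{v} (reflectAt φ x) = -reflectAt (∂_{v} φ) x := by
  ext y
  have h : HasFDerivAt (fun y => φ (x - y)) (-fderiv ℝ φ (x - y)) y := by
    have := (φ.hasFDerivAt (x - y)).comp y ((hasFDerivAt_id y).const_sub x)
    rwa [ContinuousLinearMap.comp_neg, ContinuousLinearMap.comp_id] at this
  rw [neg_apply, reflectAt_apply, SchwartzMap.lineDerivOp_apply_eq_fderiv,
    SchwartzMap.lineDerivOp_apply_eq_fderiv,
    show ((reflectAt φ x : 𝓢(E3, ℂ)) : E3 → ℂ) = fun y => φ (x - y) from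
      funext (reflectAt_apply φ x), h.fderiv]
  rfl

theorem iteratedLineDeriv_reflectAt {l : ℕ} (m : Fin l → E3) (φ : 𝓢(E3, ℂ)) (x : E3) :
    ∂^{m} (reflectAt φ x) = (-1 : ℂ) ^ l • reflectAt (∂^{m} φ) x := by
  induction l with
  | zero => simp
  | succ l ih =>
    rw [LineDeriv.iteratedLineDerivOp_succ_left, ih, LineDeriv.iteratedLineDerivOp_succ_left,
      LineDeriv.lineDerivOp_smul, lineDeriv_reflectAt, pow_succ]
    simp

theorem fourier_lineDeriv_apply (φ : 𝓢(E3, ℂ)) (v ξ : E3) :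
    𝓕 (∂_{v} φ) ξ = (2 * Real.pi * Complex.I * (inner ℝ ξ v : ℝ)) * 𝓕 φ ξ := by
  rw [SchwartzMap.fourier_lineDerivOp_eq, smul_apply,
    SchwartzMap.smulLeftCLM_apply_apply (by fun_prop)]
  simp [mul_assoc]

theorem fourierInv_lineDeriv_apply (φ : 𝓢(E3, ℂ)) (v ξ : E3) :
    𝓕⁻ (∂_{v} φ) ξ = -(2 * Real.pi * Complex.I * (inner ℝ ξ v : ℝ)) * 𝓕⁻ φ ξ := by
  rw [SchwartzMap.fourierInv_lineDerivOp_eq, smul_apply,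
    SchwartzMap.smulLeftCLM_apply_apply (by fun_prop)]
  simp [mul_assoc]

theorem schwartz_convolution_formula {h κ θ : 𝓢(E3, ℂ)} (hθ : ∀ ξ, 𝓕 θ ξ = 𝓕 h ξ * 𝓕 κ ξ)
    (x : E3) : θ x = ∫ y, h y * κ (x - y) := by
  have : θ = SchwartzMap.convolution (ContinuousLinearMap.mul ℂ ℂ) h κ := by
    have inj : Function.LeftInverse (fun φ : 𝓢(E3, ℂ) => (𝓕⁻ φ : 𝓢(E3, ℂ)))
      (fun φ : 𝓢(E3, ℂ) => (𝓕 φ : 𝓢(E3, ℂ))) := FourierTransform.fourierInv_fourier_eq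
    apply inj.injective
    ext ξ
    change 𝓕 θ ξ = 𝓕 (SchwartzMap.convolution (ContinuousLinearMap.mul ℂ ℂ) h κ) ξ
    rw [hθ, SchwartzMap.fourier_convolution, SchwartzMap.pairing_apply_apply]
    rfl
  rw [this, SchwartzMap.convolution_apply]
  rfl

theorem fourier_iteratedLineDeriv_mul {h κ θ : 𝓢(E3, ℂ)} (hθ : ∀ ξ, 𝓕 θ ξ = 𝓕 h ξ * 𝓕 κ ξ)
    {l : ℕ} (m : Fin l → E3) (ξ : E3) : 𝓕 (∂^{m} θ) ξ = 𝓕 (∂^{m} h) ξ * 𝓕 κ ξ := by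
  induction l with
  | zero => simpa using hθ ξ
  | succ l ih =>
    rw [LineDeriv.iteratedLineDerivOp_succ_left, LineDeriv.iteratedLineDerivOp_succ_left,
      fourier_lineDeriv_apply, fourier_lineDeriv_apply, ih]
    ring


/-- Linear functionals dominated by the norm of an injective linear map into a normed space factor
through it. -/
theorem exists_strongDual_comp_eq {X B : Type*} [AddCommGroup X] [Module ℂ X]
    [NormedAddCommGroup B] [NormedSpace ℂ B] (J : X →ₗ[ℂ] B) (hJ : Function.Injective J)
    (u : X →ₗ[ℂ] ℂ) (C : ℝ) (hu : ∀ x, ‖u x‖ ≤ C * ‖J x‖) :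
    ∃ U : StrongDual ℂ B, ∀ x, U (J x) = u x := by
  let e := LinearEquiv.ofInjective J hJ
  let f : StrongDual ℂ (LinearMap.range J) :=
    (u ∘ₗ e.symm.toLinearMap).mkContinuous C fun y => by
      obtain ⟨x, rfl⟩ := e.surjective y
      have h : (e x : B) = J x := rfl
      simpa [h] using hu x
  obtain ⟨U, hU, -⟩ := exists_extension_norm_eq _ f
  refine ⟨U, fun x => ?_⟩
  have := hU (e x)
  simpa [f, e] using this

/-- The points at which a Schwartz function and its weighted derivatives are evaluated. -/
abbrev SchwartzSample (s : Finset (ℕ × ℕ)) := Σ p : s, E3 × (Fin p.1.2 → E3)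

/-- The normalized value of a weighted derivative of a Schwartz function. -/
def schwartzSampleValue {s : Finset (ℕ × ℕ)} (φ : 𝓢(E3, ℂ)) (q : SchwartzSample s) : ℂ :=
  ((‖q.2.1‖ ^ q.1.1.1 / ∏ i, ‖q.2.2 i‖ : ℝ) : ℂ) * (∂^{q.2.2} φ) q.2.1

theorem norm_schwartzSampleValue_le {s : Finset (ℕ × ℕ)} (φ : 𝓢(E3, ℂ)) (q : SchwartzSample s)
    {M : ℝ} (hM : ‖q.2.1‖ ^ q.1.1.1 * ‖iteratedFDeriv ℝ q.1.1.2 φ q.2.1‖ ≤ M) :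
    ‖schwartzSampleValue φ q‖ ≤ M := by
  have hM0 : 0 ≤ M := le_trans (by positivity) hM
  rw [schwartzSampleValue, norm_mul, Complex.norm_real, Real.norm_of_nonneg (by positivity),
    SchwartzMap.iteratedLineDerivOp_eq_iteratedFDeriv]
  rcases eq_or_ne (∏ i, ‖q.2.2 i‖) 0 with h | h
  · rw [h]; simpa using hM0
  have := (iteratedFDeriv ℝ q.1.1.2 φ q.2.1).le_opNorm q.2.2
  calc _ ≤ ‖q.2.1‖ ^ q.1.1.1 / (∏ i, ‖q.2.2 i‖) *
        (‖iteratedFDeriv ℝ q.1.1.2 φ q.2.1‖ * ∏ i, ‖q.2.2 i‖) := by gcongr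
    _ = ‖q.2.1‖ ^ q.1.1.1 * ‖iteratedFDeriv ℝ q.1.1.2 φ q.2.1‖ := by field_simp
    _ ≤ M := hM

theorem norm_schwartzSampleValue_le_sup {s : Finset (ℕ × ℕ)} (φ : 𝓢(E3, ℂ))
    (q : SchwartzSample s) :
    ‖schwartzSampleValue φ q‖ ≤ s.sup (schwartzSeminormFamily ℂ E3 ℂ) φ := by
  refine norm_schwartzSampleValue_le φ q
    ((SchwartzMap.le_seminorm ℂ q.1.1.1 q.1.1.2 φ q.2.1).trans ?_)
  exact Finset.le_sup (f := schwartzSeminormFamily ℂ E3 ℂ) q.1.2 φ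

/-- A map from the Schwartz space to a Banach space, whose norm induces finitely many of the
Schwartz seminorms. -/
def schwartzSampleCLM (s : Finset (ℕ × ℕ)) :
    𝓢(E3, ℂ) →L[ℂ] lp (fun _ : SchwartzSample s => ℂ) ∞ :=
  SchwartzMap.mkCLMtoNormedSpace
    (fun φ => ⟨schwartzSampleValue φ, memℓp_infty ⟨_, by
      rintro _ ⟨q, rfl⟩; exact norm_schwartzSampleValue_le_sup φ q⟩⟩)
    (fun f g => by
      ext q
      change schwartzSampleValue _ q = schwartzSampleValue f q + schwartzSampleValue g q
      simp [schwartzSampleValue, LineDeriv.iteratedLineDerivOp_add, mul_add])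
    (fun a f => by
      ext q
      change schwartzSampleValue _ q = a * schwartzSampleValue f q
      simp [schwartzSampleValue, LineDeriv.iteratedLineDerivOp_smul]
      ring)
    ⟨s, 1, zero_le_one, fun f => lp.norm_le_of_forall_le (by positivity) fun q => by
      rw [one_mul]; exact norm_schwartzSampleValue_le_sup f q⟩

theorem schwartzSampleCLM_apply (s : Finset (ℕ × ℕ)) (φ : 𝓢(E3, ℂ)) (q : SchwartzSample s) :
    schwartzSampleCLM s φ q = schwartzSampleValue φ q := rfl

theorem seminorm_le_norm_schwartzSampleCLM {s : Finset (ℕ × ℕ)} {k l : ℕ} (hp : (k, l) ∈ s)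
    (φ : 𝓢(E3, ℂ)) : SchwartzMap.seminorm ℂ k l φ ≤ ‖schwartzSampleCLM s φ‖ := by
  refine SchwartzMap.seminorm_le_bound ℂ _ _ _ (norm_nonneg _) fun x => ?_
  rcases eq_or_ne (‖x‖ ^ k) 0 with h0 | h0
  · rw [h0, zero_mul]; positivity
  have hpos : 0 < ‖x‖ ^ k := lt_of_le_of_ne (by positivity) h0.symm
  rw [mul_comm, ← le_div_iff₀ hpos]
  refine ContinuousMultilinearMap.opNorm_le_bound (by positivity) fun m => ?_
  have h : ‖schwartzSampleValue φ (⟨⟨(k, l), hp⟩, x, m⟩ : SchwartzSample s)‖ ≤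
      ‖schwartzSampleCLM s φ‖ :=
    lp.norm_apply_le_norm ENNReal.top_ne_zero (schwartzSampleCLM s φ) ⟨⟨(k, l), hp⟩, x, m⟩
  generalize ‖schwartzSampleCLM s φ‖ = N at h
  unfold schwartzSampleValue at h
  dsimp only at h
  rw [norm_mul, Complex.norm_real, Real.norm_of_nonneg (by positivity),
    SchwartzMap.iteratedLineDerivOp_eq_iteratedFDeriv] at h
  have hN : 0 ≤ N := le_trans (by positivity) h
  rcases eq_or_ne (∏ i, ‖m i‖) 0 with hm | hm
  · obtain ⟨i, -, hi⟩ := Finset.prod_eq_zero_iff.mp hm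
    rw [(iteratedFDeriv ℝ l φ x).map_coord_zero i (norm_eq_zero.mp hi), norm_zero, hm, mul_zero]
  have hmpos : 0 < ∏ i, ‖m i‖ :=
    lt_of_le_of_ne (Finset.prod_nonneg fun i _ => norm_nonneg _) hm.symm
  rw [div_mul_eq_mul_div, div_le_iff₀ hmpos] at h
  rw [div_mul_eq_mul_div, le_div_iff₀ hpos, mul_comm]
  exact h

theorem schwartzSampleCLM_injective {s : Finset (ℕ × ℕ)} (hs : (0, 0) ∈ s) :
    Function.Injective (schwartzSampleCLM s) := by
  rw [injective_iff_map_eq_zero]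
  intro φ hφ
  ext x
  have h := (SchwartzMap.norm_le_seminorm ℂ φ x).trans (seminorm_le_norm_schwartzSampleCLM hs φ)
  rw [hφ, norm_zero] at h
  simpa using h

/-- Translates grow at most polynomially in every finite set of seminorms. This makes the
Banach-valued convolution integral below absolutely convergent. -/
theorem exists_norm_schwartzSampleCLM_reflectAt_le (s : Finset (ℕ × ℕ)) (h : 𝓢(E3, ℂ)) :
    ∃ (C : ℝ) (n : ℕ), ∀ y, ‖schwartzSampleCLM s (reflectAt h y)‖ ≤ C * (1 + ‖y‖) ^ n := by
  choose M hM0 hM using fun p : ℕ × ℕ => h.exists_add_norm_pow_mul_le 1 zero_le_one p.1 p.2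
  refine ⟨∑ p ∈ s, M p, s.sup Prod.fst, fun y => ?_⟩
  have hS : 0 ≤ ∑ p ∈ s, M p := Finset.sum_nonneg fun p _ => hM0 p
  refine lp.norm_le_of_forall_le (by positivity) fun q => ?_
  rw [schwartzSampleCLM_apply]
  refine norm_schwartzSampleValue_le _ _ ?_
  obtain ⟨⟨⟨k, l⟩, hp⟩, x, m⟩ := q
  dsimp only
  have hnorm : ‖iteratedFDeriv ℝ l (reflectAt h y) x‖ ≤ ‖iteratedFDeriv ℝ l h (y - x)‖ := by
    refine ContinuousMultilinearMap.opNorm_le_bound (norm_nonneg _) fun m => ?_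
    rw [← SchwartzMap.iteratedLineDerivOp_eq_iteratedFDeriv, iteratedLineDeriv_reflectAt,
      smul_apply, norm_smul, reflectAt_apply, SchwartzMap.iteratedLineDerivOp_eq_iteratedFDeriv]
    simpa using (iteratedFDeriv ℝ l h (y - x)).le_opNorm m
  have hx : ‖x‖ ≤ (‖y - x‖ + 1) * (1 + ‖y‖) := by
    have : ‖x‖ ≤ ‖y‖ + ‖y - x‖ := by
      calc ‖x‖ = ‖y - (y - x)‖ := by congr 1; abel
        _ ≤ _ := norm_sub_le _ _
    nlinarith [norm_nonneg y, norm_nonneg (y - x), mul_nonneg (norm_nonneg y) (norm_nonneg (y - x))]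
  calc ‖x‖ ^ k * ‖iteratedFDeriv ℝ l (reflectAt h y) x‖
      ≤ ((‖y - x‖ + 1) * (1 + ‖y‖)) ^ k * ‖iteratedFDeriv ℝ l h (y - x)‖ := by gcongr
    _ = ((‖y - x‖ + 1) ^ k * ‖iteratedFDeriv ℝ l h (y - x)‖) * (1 + ‖y‖) ^ k := by
        rw [mul_pow]; ring
    _ ≤ (∑ p ∈ s, M p) * (1 + ‖y‖) ^ s.sup Prod.fst := by
        gcongr
        · exact (hM (k, l) _).trans (Finset.single_le_sum (fun p _ => hM0 p) hp)
        · linarith [norm_nonneg y]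
        · exact Finset.le_sup (f := Prod.fst) hp

theorem SchwartzMap.integrable_one_add_norm_pow_mul (φ : 𝓢(E3, ℂ)) (n : ℕ) :
    Integrable fun y => (1 + ‖y‖) ^ n * ‖φ y‖ := by
  have h1 := (φ.integrable (μ := volume)).norm.const_mul (2 ^ (n - 1) : ℝ)
  have h2 := (φ.integrable_pow_mul volume n).const_mul (2 ^ (n - 1) : ℝ)
  refine (h1.add h2).mono' (by fun_prop) (Eventually.of_forall fun y => ?_)
  rw [Real.norm_of_nonneg (by positivity)]
  have := add_pow_le zero_le_one (norm_nonneg y) n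
  simp only [one_pow] at this
  calc (1 + ‖y‖) ^ n * ‖φ y‖ ≤ (2 ^ (n - 1) * (1 + ‖y‖ ^ n)) * ‖φ y‖ := by gcongr
    _ = _ := by simp; ring

/-- The convolution with a product of Fourier multipliers is an iterated convolution. -/
theorem apply_reflectAt_eq_integral (u : 𝓢'(E3, ℂ)) {h κ θ : 𝓢(E3, ℂ)}
    (hθ : ∀ ξ, 𝓕 θ ξ = 𝓕 h ξ * 𝓕 κ ξ) (x : E3) :
    u (reflectAt θ x) = ∫ y, u (reflectAt h y) * κ (x - y) := by
  obtain ⟨s₀, C, -, hC⟩ := Seminorm.bound_of_continuous (schwartz_withSeminorms ℂ E3 ℂ)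
    ((normSeminorm ℂ ℂ).comp (u.toLinearMap)) (continuous_norm.comp u.continuous)
  -- A distribution is bounded by finitely many seminorms, so it factors through a Banach space,
  -- where Bochner integrals commute with functionals. The index $(0,0)$ is added to make the
  -- embedding injective.
  set s := insert (0, 0) s₀
  set J := schwartzSampleCLM s
  obtain ⟨U, hU⟩ := exists_strongDual_comp_eq J.toLinearMap
    (schwartzSampleCLM_injective (Finset.mem_insert_self _ _)) u.toLinearMap C fun φ => by
      refine (hC φ).trans ?_
      rw [smul_apply, NNReal.smul_def, smul_eq_mul]
      change C * _ ≤ C * ‖J φ‖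
      gcongr
      refine Seminorm.finset_sup_apply_le (norm_nonneg _) fun p hp => ?_
      exact seminorm_le_norm_schwartzSampleCLM (Finset.mem_insert_of_mem hp) φ
  replace hU : ∀ φ, U (J φ) = u φ := hU
  have hcont : Continuous fun y => κ (x - y) • J (reflectAt h y) :=
    (κ.continuous.comp (continuous_const.sub continuous_id)).smul
      (J.continuous.comp (continuous_reflectAt h))
  have hint : Integrable fun y => κ (x - y) • J (reflectAt h y) := by
    obtain ⟨C', n, hb⟩ := exists_norm_schwartzSampleCLM_reflectAt_le s h
    have := ((reflectAt κ x).integrable_one_add_norm_pow_mul n).const_mul C'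
    refine this.mono' hcont.aestronglyMeasurable (Eventually.of_forall fun y => ?_)
    rw [norm_smul, reflectAt_apply]
    calc ‖κ (x - y)‖ * ‖J (reflectAt h y)‖ ≤ ‖κ (x - y)‖ * (C' * (1 + ‖y‖) ^ n) := by
          gcongr; exact hb y
      _ = _ := by ring
  -- An identity in the sample space is checked at each sample, where it is the classical
  -- convolution formula for a derivative of `θ`.
  have hJ : J (reflectAt θ x) = ∫ y, κ (x - y) • J (reflectAt h y) := by
    ext q
    have hev := (lp.evalCLM ℂ (fun _ : SchwartzSample s => ℂ) ∞ q).integral_comp_comm hint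
    change _ = (lp.evalCLM ℂ (fun _ : SchwartzSample s => ℂ) ∞ q) (∫ y, κ (x - y) • J (reflectAt h y))
    rw [← hev]
    change schwartzSampleValue _ q = ∫ y, κ (x - y) • schwartzSampleValue (reflectAt h y) q
    simp only [schwartzSampleValue, iteratedLineDeriv_reflectAt, smul_apply, reflectAt_apply]
    rw [schwartz_convolution_formula (fourier_iteratedLineDeriv_mul hθ q.2.2), ← integral_smul,
      ← integral_const_mul, ← integral_sub_right_eq_self _ q.2.1]
    congr 1
    ext y
    rw [sub_sub_sub_cancel_right]
    simp only [smul_eq_mul]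
    ring
  rw [← hU, hJ, ← ContinuousLinearMap.integral_comp_comm U hint]
  congr 1
  ext y
  rw [map_smul, hU, smul_eq_mul, mul_comm]


/-! ### Schwartz functions with vanishing moments -/

theorem multiIndex_induction {P : (Fin 3 → ℕ) → Prop} (h0 : P 0)
    (hs : ∀ β i, P β → P (β + Pi.single i 1)) (α : Fin 3 → ℕ) : P α := by
  induction hn : ∑ i, α i generalizing α with
  | zero =>
    have : α = 0 := by
      funext i
      exact (Finset.sum_eq_zero_iff.mp hn) i (Finset.mem_univ i)
    rwa [this]
  | succ n ih =>
    obtain ⟨i, hi⟩ : ∃ i, α i ≠ 0 := by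
      by_contra! h
      simp [h] at hn
    have hα : α = (α - Pi.single i 1) + Pi.single i 1 := by
      funext j
      by_cases hj : j = i
      · subst hj; simp; omega
      · simp [hj]
    rw [hα]
    refine hs _ _ (ih _ ?_)
    have h1 : ∑ j, α j = ∑ j, (α - Pi.single i 1 : Fin 3 → ℕ) j + ∑ j, (Pi.single i 1 : Fin 3 → ℕ) j := by
      rw [← Finset.sum_add_distrib]
      exact Finset.sum_congr rfl fun j _ => congrFun hα j
    rw [hn] at h1
    simp only [Finset.sum_pi_single', Finset.mem_univ, if_true] at h1
    omega

/-- Multiplication of a Schwartz function by the linear form `x ↦ ⟨x, v⟩`. -/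
def mulInner (v : E3) (φ : 𝓢(E3, ℂ)) : 𝓢(E3, ℂ) :=
  SchwartzMap.smulLeftCLM ℂ (fun x : E3 => inner ℝ x v) φ

theorem mulInner_apply (v : E3) (φ : 𝓢(E3, ℂ)) (x : E3) :
    mulInner v φ x = ((inner ℝ x v : ℝ) : ℂ) * φ x := by
  rw [mulInner, SchwartzMap.smulLeftCLM_apply_apply (by fun_prop), Complex.real_smul]

theorem inner_stdVec (x : E3) (i : Fin 3) : inner ℝ x (stdVec i) = x i := by
  simp [stdVec, EuclideanSpace.inner_single_right]

theorem monomial_add_single (β : Fin 3 → ℕ) (i : Fin 3) (x : E3) :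
    ∏ j, ((x j : ℝ) : ℂ) ^ (β + Pi.single i 1 : Fin 3 → ℕ) j = (∏ j, ((x j : ℝ) : ℂ) ^ β j) * (x i : ℂ) := by
  simp only [Pi.add_apply, pow_add, Finset.prod_mul_distrib]
  congr 1
  rw [Finset.prod_eq_single i]
  · simp
  · intro j _ hj; simp [hj]
  · simp

theorem integrable_monomial_mul (α : Fin 3 → ℕ) (φ : 𝓢(E3, ℂ)) :
    Integrable fun x : E3 => (∏ i, ((x i : ℝ) : ℂ) ^ α i) * φ x := by
  induction α using multiIndex_induction generalizing φ with
  | h0 => simpa using φ.integrable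
  | hs β i ih =>
    refine (ih (mulInner (stdVec i) φ)).congr (Eventually.of_forall fun x => ?_)
    simp only [mulInner_apply, inner_stdVec, monomial_add_single]
    ring

theorem fourier_mulInner (v : E3) (φ : 𝓢(E3, ℂ)) :
    𝓕 (mulInner v φ) = -(2 * Real.pi * Complex.I)⁻¹ • ∂_{v} (𝓕 φ) := by
  rw [SchwartzMap.lineDerivOp_fourier_eq]
  change _ = -(2 * (Real.pi : ℂ) * Complex.I)⁻¹ • 𝓕 (-(2 * Real.pi * Complex.I) • mulInner v φ)
  rw [FourierTransform.fourier_smul, smul_smul, neg_mul_neg, inv_mul_cancel₀, one_smul]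
  simp [Real.pi_ne_zero]

theorem fourier_mulInner_eventually {φ : 𝓢(E3, ℂ)} (h : ∀ᶠ ξ in 𝓝 0, 𝓕 φ ξ = 0) (v : E3) :
    ∀ᶠ ξ in 𝓝 0, 𝓕 (mulInner v φ) ξ = 0 := by
  filter_upwards [h.eventually_nhds] with ξ hξ
  have : ⇑(𝓕 φ : 𝓢(E3, ℂ)) =ᶠ[𝓝 ξ] fun _ => 0 := hξ
  rw [fourier_mulInner, smul_apply, SchwartzMap.lineDerivOp_apply_eq_fderiv, this.fderiv_eq]
  simp

theorem integral_eq_fourier_zero (φ : 𝓢(E3, ℂ)) : ∫ x, φ x = 𝓕 φ 0 := by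
  rw [SchwartzMap.fourier_coe, Real.fourier_eq]
  simp

/-- Schwartz functions whose Fourier transform vanishes near the origin have vanishing moments. -/
theorem isS0_of_fourier_eventually_eq_zero {φ : 𝓢(E3, ℂ)} (h : ∀ᶠ ξ in 𝓝 0, 𝓕 φ ξ = 0) :
    IsS0 φ := by
  intro α
  induction α using multiIndex_induction generalizing φ with
  | h0 => simpa [integral_eq_fourier_zero] using h.self_of_nhds
  | hs β i ih =>
    rw [← ih (fourier_mulInner_eventually h (stdVec i))]
    simp only [mulInner_apply, inner_stdVec, monomial_add_single]
    congr 1; ext x; ring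

theorem IsS0.add {φ ψ : 𝓢(E3, ℂ)} (hφ : IsS0 φ) (hψ : IsS0 ψ) : IsS0 (φ + ψ) := by
  intro α
  simp only [add_apply, mul_add]
  rw [integral_add (integrable_monomial_mul α φ) (integrable_monomial_mul α ψ), hφ, hψ, add_zero]

theorem IsS0.smul {φ : 𝓢(E3, ℂ)} (hφ : IsS0 φ) (c : ℂ) : IsS0 (c • φ) := by
  intro α
  simp only [smul_apply, smul_eq_mul, mul_left_comm _ c]
  rw [integral_const_mul, hφ, mul_zero]

theorem isS0_zero : IsS0 0 := by intro α; simp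

theorem IsS0.neg {φ : 𝓢(E3, ℂ)} (hφ : IsS0 φ) : IsS0 (-φ) := by
  simpa using hφ.smul (-1)

theorem IsS0.sum {ι : Type*} {s : Finset ι} {φ : ι → 𝓢(E3, ℂ)} (h : ∀ i ∈ s, IsS0 (φ i)) :
    IsS0 (∑ i ∈ s, φ i) := by
  classical
  induction s using Finset.induction_on with
  | empty => simpa using isS0_zero
  | insert a s ha ih =>
    rw [Finset.sum_insert ha]
    exact (h a (by simp)).add (ih fun i hi => h i (by simp [hi]))

theorem IsS0.mulInner_stdVec {φ : 𝓢(E3, ℂ)} (hφ : IsS0 φ) (i : Fin 3) :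
    IsS0 (mulInner (stdVec i) φ) := by
  intro α
  rw [← hφ (α + Pi.single i 1)]
  simp only [mulInner_apply, inner_stdVec, monomial_add_single]
  congr 1; ext x; ring

theorem IsS0.mulInner {φ : 𝓢(E3, ℂ)} (hφ : IsS0 φ) (v : E3) : IsS0 (mulInner v φ) := by
  have : _root_.mulInner v φ = ∑ i, ((v i : ℝ) : ℂ) • _root_.mulInner (stdVec i) φ := by
    ext x
    have hx : inner ℝ x v = ∑ i, v i * x i := by
      simp [PiLp.inner_apply]
    simp only [sum_apply, smul_apply, mulInner_apply, inner_stdVec, smul_eq_mul, hx,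
      Complex.ofReal_sum, Finset.sum_mul, Complex.ofReal_mul, mul_assoc]
  rw [this]
  exact IsS0.sum fun i _ => (hφ.mulInner_stdVec i).smul _

theorem mulInner_lineDeriv (v w : E3) (φ : 𝓢(E3, ℂ)) :
    mulInner v (∂_{w} φ) = ∂_{w} (mulInner v φ) - ((inner ℝ w v : ℝ) : ℂ) • φ := by
  ext x
  have h : HasFDerivAt (mulInner v φ) (((inner ℝ x v : ℝ) : ℂ) • fderiv ℝ φ x +
      (φ x) • (Complex.ofRealCLM.comp (innerSL ℝ v))) x := by
    have h1 : HasFDerivAt (fun x : E3 => ((inner ℝ x v : ℝ) : ℂ))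
        (Complex.ofRealCLM.comp (innerSL ℝ v)) x :=
      (Complex.ofRealCLM.comp (innerSL ℝ v)).hasFDerivAt.congr_of_eventuallyEq
        (Eventually.of_forall fun y => by simp [real_inner_comm])
    exact (h1.mul (φ.hasFDerivAt x)).congr_of_eventuallyEq
      (Eventually.of_forall fun y => mulInner_apply v φ y)
  rw [sub_apply, smul_apply, mulInner_apply, SchwartzMap.lineDerivOp_apply_eq_fderiv,
    SchwartzMap.lineDerivOp_apply_eq_fderiv, h.fderiv]
  simp [real_inner_comm]
  ring

/-- By induction on the multi-index: moving a coordinate factor past the derivative costs a multiple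
of `φ` itself, whose moments vanish. -/
theorem IsS0.lineDeriv {φ : 𝓢(E3, ℂ)} (hφ : IsS0 φ) (v : E3) : IsS0 (∂_{v} φ) := by
  intro α
  induction α using multiIndex_induction generalizing φ with
  | h0 => simp [integral_eq_fourier_zero, fourier_lineDeriv_apply]
  | hs β i ih =>
    have h1 := ih (hφ.mulInner (stdVec i))
    have h2 := hφ β
    have h3 : ∀ x : E3, (∏ j, ((x j : ℝ) : ℂ) ^ (β + Pi.single i 1 : Fin 3 → ℕ) j) * (∂_{v} φ) x =
        (∏ j, ((x j : ℝ) : ℂ) ^ β j) * (∂_{v} (_root_.mulInner (stdVec i) φ)) x -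
        ((inner ℝ v (stdVec i) : ℝ) : ℂ) * ((∏ j, ((x j : ℝ) : ℂ) ^ β j) * φ x) := by
      intro x
      have := DFunLike.congr_fun (mulInner_lineDeriv (stdVec i) v φ) x
      rw [mulInner_apply, inner_stdVec, sub_apply, smul_apply, smul_eq_mul] at this
      rw [monomial_add_single, mul_assoc, this]
      ring
    simp only [h3]
    rw [integral_sub (integrable_monomial_mul β _) ((integrable_monomial_mul β _).const_mul _), h1,
      integral_const_mul, h2, mul_zero, sub_zero]

theorem IsS0.laplacian {φ : 𝓢(E3, ℂ)} (hφ : IsS0 φ) : IsS0 (Δ φ) := by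
  rw [SchwartzMap.laplacian_eq_sum (EuclideanSpace.basisFun (Fin 3) ℝ)]
  exact IsS0.sum fun i _ => (hφ.lineDeriv _).lineDeriv _

theorem IsS0.integral_inner_pow {φ : 𝓢(E3, ℂ)} (hφ : IsS0 φ) (v : E3) (n : ℕ) :
    ∫ x, ((inner ℝ x v : ℝ) : ℂ) ^ n * φ x = 0 := by
  induction n generalizing φ with
  | zero => simpa using hφ 0
  | succ n ih =>
    rw [← ih (hφ.mulInner v)]
    simp only [mulInner_apply]
    congr 1; ext x; ring

/-- For $|y|\le1$ this is the usual Taylor remainder. For $|y|\ge1$ the exponential and the $N$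
Taylor terms are each at most $|y|^N$. The constant $N+2$ covers both cases. -/
theorem norm_exp_sub_sum_le (N : ℕ) (y : ℝ) :
    ‖Complex.exp (y * Complex.I) - ∑ n ∈ Finset.range N, (y * Complex.I) ^ n / n.factorial‖ ≤
      (N + 2) * |y| ^ N := by
  have hy : ‖(y : ℂ) * Complex.I‖ = |y| := by simp
  rcases Nat.eq_zero_or_pos N with rfl | hN
  · simp [Complex.norm_exp_ofReal_mul_I]
  rcases le_total |y| 1 with h | h
  · have := Complex.exp_bound (x := y * Complex.I) (by rwa [hy]) hN
    rw [hy] at this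
    refine this.trans ?_
    rw [mul_comm]
    gcongr
    rw [← div_eq_mul_inv, div_le_iff₀ (by positivity)]
    have h1 : (1 : ℝ) ≤ N.factorial := by exact_mod_cast Nat.one_le_iff_ne_zero.mpr (Nat.factorial_ne_zero N)
    have h2 : (1 : ℝ) ≤ N := by exact_mod_cast hN
    push_cast
    nlinarith [mul_le_mul h1 h2 zero_le_one (by linarith)]
  · refine (norm_sub_le _ _).trans ?_
    rw [Complex.norm_exp_ofReal_mul_I]
    have h1 : ‖∑ n ∈ Finset.range N, ((y : ℂ) * Complex.I) ^ n / n.factorial‖ ≤ N * |y| ^ N := by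
      refine (norm_sum_le _ _).trans ?_
      rw [← nsmul_eq_mul, ← Finset.card_range N, ← Finset.sum_const, Finset.card_range]
      refine Finset.sum_le_sum fun n hn => ?_
      rw [norm_div, norm_pow, hy, Complex.norm_natCast]
      refine (div_le_self (by positivity) ?_).trans
        (pow_le_pow_right₀ h (Finset.mem_range.mp hn).le)
      exact_mod_cast Nat.one_le_iff_ne_zero.mpr (Nat.factorial_ne_zero n)
    have h2 : (1 : ℝ) ≤ |y| ^ N := one_le_pow₀ h
    linarith

theorem fourierInv_apply_eq_exp (φ : 𝓢(E3, ℂ)) (ξ : E3) :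
    𝓕⁻ φ ξ = ∫ x, Complex.exp ((2 * Real.pi * inner ℝ x ξ : ℝ) * Complex.I) * φ x := by
  rw [SchwartzMap.fourierInv_coe, Real.fourierInv_eq]
  simp only [Circle.smul_def, Real.fourierChar_apply, smul_eq_mul]

/-- The Fourier transform of a function with vanishing moments is flat at the origin. -/
theorem IsS0.norm_fourierInv_le {φ : 𝓢(E3, ℂ)} (hφ : IsS0 φ) (N : ℕ) (ξ : E3) :
    ‖𝓕⁻ φ ξ‖ ≤ (N + 2) * (2 * Real.pi) ^ N * (∫ x, ‖x‖ ^ N * ‖φ x‖) * ‖ξ‖ ^ N := by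
  have hmon : ∀ n : ℕ, Integrable fun x : E3 => ((inner ℝ x ξ : ℝ) : ℂ) ^ n * φ x := by
    intro n
    induction n generalizing φ with
    | zero => simpa using φ.integrable
    | succ n ih =>
      refine (ih (hφ.mulInner ξ)).congr (Eventually.of_forall fun x => ?_)
      simp only [mulInner_apply]; ring
  have hterm : ∀ (n : ℕ) (x : E3), (((2 * Real.pi * inner ℝ x ξ : ℝ) : ℂ) * Complex.I) ^ n /
      n.factorial * φ x = ((2 * Real.pi * Complex.I) ^ n / n.factorial) *
        (((inner ℝ x ξ : ℝ) : ℂ) ^ n * φ x) := by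
    intro n x; push_cast; ring
  -- The Taylor polynomial of the character integrates to a combination of moments of `φ`, hence to
  -- zero. It can be subtracted freely, and only the remainder of order $|\xi|^N$ is left.
  have hsum : ∫ x, (∑ n ∈ Finset.range N, (((2 * Real.pi * inner ℝ x ξ : ℝ) : ℂ) * Complex.I) ^ n /
      n.factorial) * φ x = 0 := by
    simp only [Finset.sum_mul, hterm]
    rw [integral_finsetSum _ fun n _ => (hmon n).const_mul _]
    refine Finset.sum_eq_zero fun n _ => ?_
    rw [integral_const_mul, hφ.integral_inner_pow, mul_zero]
  have hint1 : Integrable fun x : E3 =>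
      Complex.exp ((2 * Real.pi * inner ℝ x ξ : ℝ) * Complex.I) * φ x := by
    refine φ.integrable.bdd_mul (c := 1) (by fun_prop) (Eventually.of_forall fun x => ?_)
    rw [Complex.norm_exp_ofReal_mul_I]
  have hint2 : Integrable fun x : E3 => (∑ n ∈ Finset.range N,
      (((2 * Real.pi * inner ℝ x ξ : ℝ) : ℂ) * Complex.I) ^ n / n.factorial) * φ x := by
    simp only [Finset.sum_mul, hterm]
    exact integrable_finsetSum _ fun n _ => (hmon n).const_mul _
  rw [fourierInv_apply_eq_exp]
  calc _ = ‖∫ x, (Complex.exp ((2 * Real.pi * inner ℝ x ξ : ℝ) * Complex.I) -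
        ∑ n ∈ Finset.range N, (((2 * Real.pi * inner ℝ x ξ : ℝ) : ℂ) * Complex.I) ^ n /
          n.factorial) * φ x‖ := by
        simp only [sub_mul]
        rw [integral_sub hint1 hint2, hsum, sub_zero]
    _ ≤ ∫ x, (N + 2) * (2 * Real.pi) ^ N * ‖ξ‖ ^ N * (‖x‖ ^ N * ‖φ x‖) := by
        refine norm_integral_le_of_norm_le ((φ.integrable_pow_mul volume N).const_mul _)
          (Eventually.of_forall fun x => ?_)
        rw [norm_mul]
        calc _ ≤ ((N + 2) * |2 * Real.pi * inner ℝ x ξ| ^ N) * ‖φ x‖ := by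
              gcongr; exact norm_exp_sub_sum_le N _
          _ ≤ ((N + 2) * (2 * Real.pi * (‖x‖ * ‖ξ‖)) ^ N) * ‖φ x‖ := by
              gcongr
              rw [abs_mul, abs_of_pos Real.two_pi_pos]
              gcongr
              exact abs_real_inner_le_norm x ξ
          _ = _ := by rw [mul_pow, mul_pow]; ring
    _ = _ := by rw [integral_const_mul]; ring

/-- Fourier transforms of functions with vanishing moments decay rapidly at the origin and at
infinity, with bounds that are continuous in the Schwartz topology. -/
theorem exists_seminorm_fourierInv_le (N : ℕ) : ∃ q : Seminorm ℂ 𝓢(E3, ℂ), Continuous q ∧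
    ∀ φ, IsS0 φ → ∀ ξ, ‖𝓕⁻ φ ξ‖ ≤ q φ * ‖ξ‖ ^ N ∧ ‖ξ‖ ^ N * ‖𝓕⁻ φ ξ‖ ≤ q φ := by
  set l := (volume : Measure E3).integrablePower
  set D : ℝ := (N + 2) * (2 * Real.pi) ^ N * (2 ^ l * ∫ x : E3, (1 + ‖x‖) ^ (-(l : ℝ)))
  have hD : 0 ≤ D := by
    have : 0 ≤ ∫ x : E3, (1 + ‖x‖) ^ (-(l : ℝ)) := integral_nonneg fun x => by positivity
    positivity
  -- `q₁` controls the flatness at the origin through the weighted integral of `φ`, and `q₂` the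
  -- decay at infinity through a seminorm of the transform.
  let q₁ : Seminorm ℂ 𝓢(E3, ℂ) := D.toNNReal •
    ((SchwartzMap.seminorm ℂ 0 0 : Seminorm ℂ 𝓢(E3, ℂ)) +
    SchwartzMap.seminorm ℂ (N + l) 0)
  let q₂ : Seminorm ℂ 𝓢(E3, ℂ) := (SchwartzMap.seminorm ℂ N 0 : Seminorm ℂ 𝓢(E3, ℂ)).comp
    (FourierTransform.fourierInvCLM ℂ 𝓢(E3, ℂ)).toLinearMap
  have hs : ∀ k n, Continuous (SchwartzMap.seminorm ℂ k n : Seminorm ℂ 𝓢(E3, ℂ)) := fun k n =>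
    (schwartz_withSeminorms ℂ E3 ℂ).continuous_seminorm (k, n)
  refine ⟨q₁ + q₂, ?_, fun φ hφ ξ => ⟨?_, ?_⟩⟩
  · refine Continuous.add ?_ ((hs N 0).comp (FourierTransform.fourierInvCLM ℂ 𝓢(E3, ℂ)).continuous)
    exact ((hs 0 0).add (hs (N + l) 0)).const_smul D.toNNReal
  · have h1 := hφ.norm_fourierInv_le N ξ
    have h2 := SchwartzMap.integral_pow_mul_iteratedFDeriv_le ℂ (volume : Measure E3) φ N 0
    simp only [norm_iteratedFDeriv_zero] at h2
    have h3 : q₁ φ = D * (SchwartzMap.seminorm ℂ 0 0 φ + SchwartzMap.seminorm ℂ (N + l) 0 φ) := by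
      rw [← Real.coe_toNNReal D hD]; rfl
    have h4 : 0 ≤ q₂ φ := apply_nonneg _ _
    refine h1.trans ?_
    gcongr
    calc _ ≤ (N + 2) * (2 * Real.pi) ^ N * (2 ^ l * (∫ x : E3, (1 + ‖x‖) ^ (-(l : ℝ))) *
          (SchwartzMap.seminorm ℂ 0 0 φ + SchwartzMap.seminorm ℂ (N + l) 0 φ)) := by gcongr
      _ = q₁ φ := by rw [h3]; ring
      _ ≤ q₁ φ + q₂ φ := by linarith
  · have h4 : 0 ≤ q₁ φ := apply_nonneg _ _
    have h5 : ‖ξ‖ ^ N * ‖𝓕⁻ φ ξ‖ ≤ q₂ φ := SchwartzMap.norm_pow_mul_le_seminorm ℂ (𝓕⁻ φ) N ξ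
    change _ ≤ q₁ φ + q₂ φ
    linarith


/-! ### Dyadic annuli and Littlewood--Paley multipliers -/

/-- The dyadic annulus `2^{m-1} ≤ 2π|ξ| ≤ 2^{m+1}`. -/
def dyadicAnnulus (m : ℤ) : Set E3 :=
  {ξ | (2 : ℝ) ^ (m - 1) ≤ 2 * Real.pi * ‖ξ‖ ∧ 2 * Real.pi * ‖ξ‖ ≤ (2 : ℝ) ^ (m + 1)}

theorem isClosed_dyadicAnnulus (m : ℤ) : IsClosed (dyadicAnnulus m) :=
  (isClosed_le (f := fun _ : E3 => (2 : ℝ) ^ (m - 1)) (g := fun ξ => 2 * Real.pi * ‖ξ‖)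
    (by fun_prop) (by fun_prop)).inter
  (isClosed_le (f := fun ξ : E3 => 2 * Real.pi * ‖ξ‖) (g := fun _ => (2 : ℝ) ^ (m + 1))
    (by fun_prop) (by fun_prop))

theorem measurableSet_dyadicAnnulus (m : ℤ) : MeasurableSet (dyadicAnnulus m) :=
  (isClosed_dyadicAnnulus m).measurableSet

theorem ne_zero_of_mem_dyadicAnnulus {m : ℤ} {ξ : E3} (h : ξ ∈ dyadicAnnulus m) : ξ ≠ 0 := by
  rintro rfl
  have : (0 : ℝ) < 2 ^ (m - 1) := by positivity
  have := h.1
  simp at this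
  linarith

/-- The constant in the bound for the volume of dyadic annuli. -/
def annulusConst : ℝ≥0 := (8 * (volume (Metric.closedBall (0 : E3) 1)).toNNReal) ^ (1 / 2 : ℝ)

theorem two_rpow_intCast (m : ℤ) : (2 : ℝ≥0∞) ^ (m : ℝ) = ENNReal.ofReal ((2 : ℝ) ^ m) := by
  rw [← Real.rpow_intCast, ← ENNReal.ofReal_rpow_of_pos two_pos]
  simp

theorem two_rpow_ne_top (y : ℝ) : (2 : ℝ≥0∞) ^ y ≠ ∞ := by
  simp [ENNReal.rpow_eq_top_iff]

/-- Since $2\pi\ge1$, the annulus lies in the ball of radius $2^{m+1}$, whence the factor 8. The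
square root is the form in which volumes enter Bernstein's inequality. -/
theorem volume_dyadicAnnulus_rpow_le (m : ℤ) :
    volume (dyadicAnnulus m) ^ (1 / 2 : ℝ) ≤ annulusConst * (2 : ℝ≥0∞) ^ ((3 / 2 : ℝ) * m) := by
  have hsub : dyadicAnnulus m ⊆ Metric.closedBall (0 : E3) ((2 : ℝ) ^ (m + 1)) := by
    intro ξ hξ
    have := hξ.2
    have h3 := Real.pi_gt_three
    rw [mem_closedBall_zero_iff]
    nlinarith [norm_nonneg ξ]
  have hfin : volume (Metric.closedBall (0 : E3) 1) ≠ ∞ := measure_closedBall_lt_top.ne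
  have h1 : volume (dyadicAnnulus m) ≤
      (8 * (volume (Metric.closedBall (0 : E3) 1))) * (2 : ℝ≥0∞) ^ ((3 : ℝ) * m) := by
    refine (measure_mono hsub).trans_eq ?_
    rw [Measure.addHaar_closedBall' _ _ (by positivity)]
    have : (2 : ℝ≥0∞) ^ ((3 : ℝ) * m) = ENNReal.ofReal (((2 : ℝ) ^ m) ^ 3) := by
      rw [mul_comm, ENNReal.rpow_mul, two_rpow_intCast, ENNReal.ofReal_pow (by positivity)]
      norm_cast
    rw [this, mul_right_comm]
    congr 1
    rw [finrank_euclideanSpace_fin, zpow_add₀ two_ne_zero, mul_pow, mul_comm,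
      ENNReal.ofReal_mul (by positivity)]
    norm_num
  calc _ ≤ ((8 * (volume (Metric.closedBall (0 : E3) 1))) *
        (2 : ℝ≥0∞) ^ ((3 : ℝ) * m)) ^ (1 / 2 : ℝ) := by gcongr
    _ = _ := by
      rw [ENNReal.mul_rpow_of_nonneg _ _ (by norm_num), ← ENNReal.rpow_mul]
      congr 1
      · rw [annulusConst, ENNReal.coe_rpow_of_nonneg _ (by norm_num)]
        push_cast
        rw [ENNReal.coe_toNNReal hfin]
      · congr 1; ring

theorem volume_dyadicAnnulus_lt_top (m : ℤ) : volume (dyadicAnnulus m) < ∞ := by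
  have h := volume_dyadicAnnulus_rpow_le m
  by_contra! htop
  rw [top_le_iff.mp htop, ENNReal.top_rpow_of_pos (by norm_num)] at h
  exact (ENNReal.mul_lt_top ENNReal.coe_lt_top (two_rpow_ne_top _).lt_top).not_ge h

theorem integral_comp_two_zpow_smul (k : ℤ) (f : E3 → ℂ) :
    ∫ x, f (((2 : ℝ) ^ k) • x) = (((2 : ℝ) ^ (-(3 * k)) : ℝ) : ℂ) * ∫ x, f x := by
  rw [Measure.integral_comp_smul, finrank_euclideanSpace_fin, abs_of_pos (by positivity),
    Complex.real_smul]
  congr 2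
  rw [← zpow_natCast, ← zpow_mul, ← zpow_neg]
  congr 1
  push_cast; ring

theorem fourier_dilate (k : ℤ) (φ : 𝓢(E3, ℂ)) (ξ : E3) :
    𝓕 (dilate k φ) ξ = 𝓕 φ (((2 : ℝ) ^ (-k)) • ξ) := by
  rw [SchwartzMap.fourier_coe, SchwartzMap.fourier_coe, Real.fourier_eq, Real.fourier_eq]
  have h := integral_comp_two_zpow_smul k fun x =>
    Real.fourierChar (-inner ℝ x (((2 : ℝ) ^ (-k)) • ξ)) • φ x
  have hne : (((2 : ℝ) ^ (3 * k) : ℝ) : ℂ) * (((2 : ℝ) ^ (-(3 * k)) : ℝ) : ℂ) = 1 := by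
    rw [← Complex.ofReal_mul, ← zpow_add₀ two_ne_zero]; simp
  rw [← one_mul (∫ v, Real.fourierChar (-inner ℝ v (((2 : ℝ) ^ (-k)) • ξ)) • φ v), ← hne, mul_assoc,
    ← h, ← integral_const_mul]
  congr 1
  ext x
  rw [dilate_apply, inner_smul_left, inner_smul_right, ← mul_assoc, zpow_neg]
  simp only [conj_trivial]
  rw [mul_inv_cancel₀ (zpow_ne_zero k two_ne_zero), one_mul, Circle.smul_def, Circle.smul_def,
    smul_eq_mul, smul_eq_mul]
  ring

theorem isRadial_dilate {φ : 𝓢(E3, ℂ)} (h : IsRadial φ) (k : ℤ) : IsRadial (dilate k φ) := by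
  intro x y hxy
  rw [dilate_apply, dilate_apply, h]
  rw [norm_smul, norm_smul, hxy]

namespace LittlewoodPaley

variable (L : LittlewoodPaley)

/-- The kernel of `Δ_k`. -/
def ker (k : ℤ) : 𝓢(E3, ℂ) := dilate k L.kernel

theorem block_apply (k : ℤ) (u : VecDist) (x : E3) (i : Fin 3) :
    L.block k u x i = u i (reflectAt (L.ker k) x) := rfl

theorem mem_dyadicAnnulus_of_fourier_ker_ne_zero {k : ℤ} {ξ : E3} (h : 𝓕 (L.ker k) ξ ≠ 0) :
    ξ ∈ dyadicAnnulus k := by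
  rw [ker, fourier_dilate] at h
  obtain ⟨h1, h2⟩ := L.annulus _ h
  rw [norm_smul, Real.norm_of_nonneg (by positivity), zpow_neg] at h1 h2
  have hk : (0 : ℝ) < 2 ^ k := by positivity
  constructor
  · rw [zpow_sub_one₀ two_ne_zero]
    calc (2 : ℝ) ^ k * 2⁻¹ ≤ 2 ^ k * (2 * Real.pi * (((2 : ℝ) ^ k)⁻¹ * ‖ξ‖)) := by
          gcongr; linarith
      _ = _ := by field_simp
  · rw [zpow_add_one₀ two_ne_zero]
    calc _ = (2 : ℝ) ^ k * (2 * Real.pi * (((2 : ℝ) ^ k)⁻¹ * ‖ξ‖)) := by field_simp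
      _ ≤ _ := by gcongr

theorem fourier_ker_eq_zero {k : ℤ} {ξ : E3} (h : ξ ∉ dyadicAnnulus k) : 𝓕 (L.ker k) ξ = 0 := by
  by_contra h'
  exact h (L.mem_dyadicAnnulus_of_fourier_ker_ne_zero h')

theorem hasSum_fourier_ker {ξ : E3} (h : ξ ≠ 0) : HasSum (fun k => 𝓕 (L.ker k) ξ) 1 := by
  simpa only [ker, fourier_dilate] using L.partition ξ h

/-- A bound for the Littlewood--Paley multipliers. -/
def multBound : ℝ≥0 := ‖(𝓕 L.kernel : 𝓢(E3, ℂ)).toBoundedContinuousFunction‖₊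

theorem norm_fourier_ker_le (k : ℤ) (ξ : E3) : ‖𝓕 (L.ker k) ξ‖ ≤ L.multBound := by
  rw [ker, fourier_dilate]
  exact (𝓕 L.kernel : 𝓢(E3, ℂ)).toBoundedContinuousFunction.norm_coe_le_norm _

/-- Finitely many Littlewood--Paley multipliers form a partition of unity on an annulus. -/
theorem sum_fourier_ker_eq_one {a b : ℤ} {ξ : E3} (ha : (2 : ℝ) ^ a ≤ 2 * Real.pi * ‖ξ‖)
    (hb : 2 * Real.pi * ‖ξ‖ ≤ (2 : ℝ) ^ b) :
    ∑ j ∈ Finset.Icc (a - 1) (b + 1), 𝓕 (L.ker j) ξ = 1 := by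
  have hξ : ξ ≠ 0 := by
    rintro rfl
    have : (0 : ℝ) < 2 ^ a := by positivity
    simp at ha
    linarith
  refine HasSum.unique ?_ (L.hasSum_fourier_ker hξ)
  apply hasSum_sum_of_ne_finset_zero
  intro j hj
  apply L.fourier_ker_eq_zero
  rintro ⟨h1, h2⟩
  apply hj
  rw [Finset.mem_Icc]
  have e1 := (zpow_le_zpow_iff_right₀ (one_lt_two (α := ℝ))).mp (h1.trans hb)
  have e2 := (zpow_le_zpow_iff_right₀ (one_lt_two (α := ℝ))).mp (ha.trans h2)
  constructor <;> omega

theorem sum_fourier_ker_eq_one_of_mem {k : ℤ} {ξ : E3} (h : ξ ∈ dyadicAnnulus k) :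
    𝓕 (∑ j ∈ Finset.Icc (k - 2) (k + 2), L.ker j) ξ = 1 := by
  have := L.sum_fourier_ker_eq_one h.1 h.2
  rw [show k - 1 - 1 = k - 2 by ring, show k + 1 + 1 = k + 2 by ring] at this
  rw [← this, FourierTransform.fourier_sum, sum_apply]

theorem fourier_eventually_eq_zero {θ : 𝓢(E3, ℂ)} {k : ℤ}
    (h : ∀ ξ, ξ ∉ dyadicAnnulus k → 𝓕 θ ξ = 0) (x : E3) :
    ∀ᶠ ξ in 𝓝 0, 𝓕 (reflectAt θ x) ξ = 0 := by
  have hopen : (dyadicAnnulus k)ᶜ ∈ 𝓝 (0 : E3) :=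
    (isClosed_dyadicAnnulus k).isOpen_compl.mem_nhds fun h => ne_zero_of_mem_dyadicAnnulus h rfl
  filter_upwards [hopen] with ξ hξ
  have e : 𝓕 (reflectAt θ x) ξ = 𝓕⁻ (reflectAt θ x) (-ξ) := by
    rw [SchwartzMap.fourier_coe, SchwartzMap.fourierInv_coe, Real.fourierInv_eq_fourier_neg, neg_neg]
  rw [e, fourierInv_reflectAt, h, mul_zero]
  simpa [dyadicAnnulus] using hξ

theorem isS0_reflectAt {θ : 𝓢(E3, ℂ)} {k : ℤ}
    (h : ∀ ξ, ξ ∉ dyadicAnnulus k → 𝓕 θ ξ = 0) (x : E3) : IsS0 (reflectAt θ x) :=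
  isS0_of_fourier_eventually_eq_zero (fourier_eventually_eq_zero h x)

theorem isS0_reflectAt_ker (k : ℤ) (x : E3) : IsS0 (reflectAt (L.ker k) x) :=
  isS0_reflectAt (fun _ => L.fourier_ker_eq_zero) x

theorem isS0_ker (k : ℤ) : IsS0 (L.ker k) := by
  refine isS0_of_fourier_eventually_eq_zero ?_
  filter_upwards [(isClosed_dyadicAnnulus k).isOpen_compl.mem_nhds
    fun h => ne_zero_of_mem_dyadicAnnulus (ξ := 0) h rfl] with ξ hξ
  exact L.fourier_ker_eq_zero hξ

theorem isRadial_ker (k : ℤ) : IsRadial (L.ker k) := isRadial_dilate L.radial k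

/-! ### The spectral representation of frequency localized distributions -/

/-- The left side is the convolution of the block with `κ`, which Plancherel duality turns into a
product of transforms. The freedom in `κ` gives access to derivatives and to tests of the support.
-/
theorem apply_reflectAt_eq_fourierInv (k : ℤ) (u : 𝓢'(E3, ℂ))
    (hu : MemLp (fun x => u (reflectAt (L.ker k) x)) 2) {κ θ : 𝓢(E3, ℂ)}
    (hθ : ∀ ξ, 𝓕 θ ξ = 𝓕 (L.ker k) ξ * 𝓕 κ ξ) (x : E3) :
    u (reflectAt θ x) =
      𝓕⁻ (fun ξ => fourierL2 (fun x => u (reflectAt (L.ker k) x)) ξ * 𝓕 κ ξ) x := by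
  rw [apply_reflectAt_eq_integral u hθ x, Real.fourierInv_eq]
  have h := integral_fourierL2_mul_schwartz hu (𝓕⁻ (reflectAt κ x))
  rw [FourierTransform.fourier_fourierInv_eq] at h
  simp only [reflectAt_apply] at h
  rw [← h]
  congr 1
  ext ξ
  rw [fourierInv_reflectAt, Circle.smul_def, real_inner_comm, smul_eq_mul]
  ring

/-- The Fourier transform of a function with frequencies in a dyadic annulus. -/
def annulusFT (k : ℤ) (v : E3 → ℂ) : E3 → ℂ := (dyadicAnnulus k).indicator (fourierL2 v)

theorem memLp_annulusFT (k : ℤ) (v : E3 → ℂ) : MemLp (annulusFT k v) 2 :=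
  (memLp_fourierL2 v).indicator (measurableSet_dyadicAnnulus k)

/-- A test function supported off the annulus is annihilated by the multiplier of $\Delta_k$. The
preceding representation with `θ = 0` then shows that the transform of the block integrates to zero
against it. -/
theorem annulusFT_ae_eq (k : ℤ) (u : 𝓢'(E3, ℂ))
    (hu : MemLp (fun x => u (reflectAt (L.ker k) x)) 2) :
    annulusFT k (fun x => u (reflectAt (L.ker k) x)) =ᵐ[volume]
      fourierL2 (fun x => u (reflectAt (L.ker k) x)) := by
  have h := ae_eq_on_of_integral_mul_schwartz (isClosed_dyadicAnnulus k).isOpen_compl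
    (memLp_fourierL2 (fun x => u (reflectAt (L.ker k) x))).locallyIntegrable_two
    (integrable_zero E3 ℂ volume).locallyIntegrable fun φ hφ _ => ?_
  · filter_upwards [h] with ξ hξ
    by_cases hm : ξ ∈ dyadicAnnulus k
    · simp [annulusFT, hm]
    · simp [annulusFT, hm, hξ hm]
  · have h0 := L.apply_reflectAt_eq_fourierInv k u hu (κ := 𝓕⁻ φ) (θ := 0) (fun ξ => ?_) 0
    · have : reflectAt 0 0 = 0 := by ext y; simp [reflectAt_apply]
      rw [this, map_zero, Real.fourierInv_eq] at h0
      simpa [FourierTransform.fourier_fourierInv_eq] using h0.symm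
    · rw [FourierTransform.fourier_zero, FourierTransform.fourier_fourierInv_eq]
      by_cases hm : ξ ∈ dyadicAnnulus k
      · have : φ ξ = 0 := by
          by_contra hne
          exact hφ (subset_tsupport _ hne) hm
        simp [this]
      · simp [L.fourier_ker_eq_zero hm]

theorem eq_fourierInv_annulusFT_mul (k : ℤ) (u : 𝓢'(E3, ℂ))
    (hu : MemLp (fun x => u (reflectAt (L.ker k) x)) 2) {κ θ : 𝓢(E3, ℂ)}
    (hθ : ∀ ξ, 𝓕 θ ξ = 𝓕 (L.ker k) ξ * 𝓕 κ ξ) (x : E3) :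
    u (reflectAt θ x) =
      𝓕⁻ (fun ξ => annulusFT k (fun x => u (reflectAt (L.ker k) x)) ξ * 𝓕 κ ξ) x := by
  rw [L.apply_reflectAt_eq_fourierInv k u hu hθ]
  refine Real.fourierInv_congr_ae ?_ x
  filter_upwards [L.annulusFT_ae_eq k u hu] with ξ hξ
  rw [hξ]

end LittlewoodPaley


/-! ### Vector fields with frequencies in a dyadic annulus -/

theorem norm_apply_le_norm_toLp (v : Fin 3 → ℂ) (i : Fin 3) :
    ‖v i‖ ≤ ‖(WithLp.toLp 2 v : EuclideanSpace ℂ (Fin 3))‖ :=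
  PiLp.norm_apply_le (WithLp.toLp 2 v : EuclideanSpace ℂ (Fin 3)) i

theorem eLpNorm_apply_le_spaceNorm (p : ℝ≥0∞) (v : E3 → Fin 3 → ℂ) (i : Fin 3) :
    eLpNorm (fun x => v x i) p ≤ spaceNorm p v :=
  eLpNorm_mono fun x => norm_apply_le_norm_toLp (v x) i

theorem norm_toLp_le_sum (v : Fin 3 → ℂ) :
    ‖(WithLp.toLp 2 v : EuclideanSpace ℂ (Fin 3))‖ ≤ ∑ i, ‖v i‖ := by
  rw [EuclideanSpace.norm_eq]
  refine Real.sqrt_le_iff.mpr ⟨by positivity, ?_⟩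
  exact Finset.sum_sq_le_sq_sum_of_nonneg fun i _ => norm_nonneg (v i)

theorem spaceNorm_le_sum {v : E3 → Fin 3 → ℂ}
    (hv : ∀ i, AEStronglyMeasurable (fun x => v x i)) {p : ℝ≥0∞} (hp : 1 ≤ p) :
    spaceNorm p v ≤ ∑ i, eLpNorm (fun x => v x i) p := by
  have h1 : spaceNorm p v ≤ eLpNorm (fun x => ∑ i, ‖v x i‖) p :=
    eLpNorm_mono_real fun x => norm_toLp_le_sum (v x)
  have h2 := eLpNorm_sum_le (s := Finset.univ) (f := fun (i : Fin 3) (x : E3) => ‖v x i‖)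
    (fun i _ => (hv i).norm) hp
  simp only [eLpNorm_norm] at h2
  refine (h1.trans_eq ?_).trans h2
  congr 1 with x

/-- `V` is the Fourier transform of the field `v`, whose frequencies lie in a dyadic annulus. -/
structure SpectralRep (k : ℤ) (v V : E3 → Fin 3 → ℂ) : Prop where
  memLp : ∀ i, MemLp (fun ξ => V ξ i) 2
  supp : ∀ ξ, ξ ∉ dyadicAnnulus k → V ξ = 0
  eq : ∀ i, (fun x => v x i) = 𝓕⁻ (fun ξ => V ξ i)
  norm_le : ∀ i, eLpNorm (fun ξ => V ξ i) 2 ≤ spaceNorm 2 v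

theorem integrable_of_memLp_of_support {k : ℤ} {f : E3 → ℂ} (hf : MemLp f 2)
    (hs : ∀ ξ, ξ ∉ dyadicAnnulus k → f ξ = 0) : Integrable f := by
  have : f = (dyadicAnnulus k).indicator f := by
    ext ξ
    by_cases h : ξ ∈ dyadicAnnulus k
    · simp [h]
    · simp [h, hs ξ h]
  rw [this, integrable_indicator_iff (measurableSet_dyadicAnnulus k)]
  have : IsFiniteMeasure (volume.restrict (dyadicAnnulus k)) :=
    ⟨by simpa using volume_dyadicAnnulus_lt_top k⟩
  exact (hf.restrict _).integrable one_le_two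

namespace SpectralRep

variable {k : ℤ} {v V : E3 → Fin 3 → ℂ}

theorem integrable (h : SpectralRep k v V) (i : Fin 3) : Integrable fun ξ => V ξ i :=
  integrable_of_memLp_of_support (h.memLp i) fun ξ hξ => by rw [h.supp ξ hξ]; rfl

theorem apply (h : SpectralRep k v V) (x : E3) (i : Fin 3) :
    v x i = 𝓕⁻ (fun ξ => V ξ i) x := congrFun (h.eq i) x

theorem memLp_left (h : SpectralRep k v V) (i : Fin 3) : MemLp (fun x => v x i) 2 := by
  rw [h.eq i]
  exact memLp_fourierInv (h.memLp i) (h.integrable i)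

end SpectralRep

/-- A frequency as a complex vector. -/
def freqVec (ξ : E3) : Fin 3 → ℂ := fun i => (ξ i : ℂ)

namespace LittlewoodPaley

variable (L : LittlewoodPaley)

/-- The Fourier transform of `Δ_k u`. -/
def blockFT (k : ℤ) (u : VecDist) (ξ : E3) (i : Fin 3) : ℂ :=
  annulusFT k (fun x => L.block k u x i) ξ

variable {L}

theorem memLp_block {k : ℤ} {u : VecDist} (h : spaceNorm 2 (L.block k u) < ∞) (i : Fin 3) :
    MemLp (fun x => L.block k u x i) 2 :=
  ⟨((continuous_apply i).comp (continuous_conv (L.ker k) u)).aestronglyMeasurable,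
    (eLpNorm_apply_le_spaceNorm 2 _ i).trans_lt h⟩

theorem spectralRep_block {k : ℤ} {u : VecDist} (h : spaceNorm 2 (L.block k u) < ∞) :
    SpectralRep k (L.block k u) (L.blockFT k u) where
  memLp i := memLp_annulusFT k _
  supp ξ hξ := by
    funext i
    simp [blockFT, annulusFT, hξ]
  eq i := by
    funext x
    -- The five neighbouring multipliers sum to one on the annulus, so convolving $\Delta_ku$ with
    -- the sum of their kernels reproduces it.
    have := L.eq_fourierInv_annulusFT_mul k (u i) (memLp_block h i)
      (κ := ∑ j ∈ Finset.Icc (k - 2) (k + 2), L.ker j) (θ := L.ker k) (fun ξ => ?_) x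
    · refine this.trans (Real.fourierInv_congr_ae (Eventually.of_forall fun ξ => ?_) x)
      by_cases hξ : ξ ∈ dyadicAnnulus k
      · rw [L.sum_fourier_ker_eq_one_of_mem hξ, mul_one]; rfl
      · simp [annulusFT, blockFT, hξ]
    · by_cases hξ : ξ ∈ dyadicAnnulus k
      · rw [L.sum_fourier_ker_eq_one_of_mem hξ, mul_one]
      · simp [L.fourier_ker_eq_zero hξ]
  norm_le i := by
    have h1 := eLpNorm_congr_ae (p := 2) (L.annulusFT_ae_eq k (u i) (memLp_block h i))
    refine h1.le.trans ?_
    rw [show (fun x => (u i) (reflectAt (L.ker k) x)) = fun x => L.block k u x i from rfl,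
      eLpNorm_fourierL2 (memLp_block h i)]
    exact eLpNorm_apply_le_spaceNorm 2 _ i

/-- The Fourier transform of a frequency localized divergence free field is orthogonal to the
frequency. -/
theorem blockFT_orthogonal {k : ℤ} {u : VecDist} (h : spaceNorm 2 (L.block k u) < ∞)
    (hdiv : DivFree u) : ∀ᵐ ξ, freqVec ξ ⬝ᵥ L.blockFT k u ξ = 0 := by
  have hrep := spectralRep_block h
  have hmem : ∀ i, MemLp (fun ξ : E3 => (ξ i : ℂ) * L.blockFT k u ξ i) 2 := by
    intro i
    refine MemLp.of_le_mul (c := 2 ^ (k + 1)) (hrep.memLp i) ?_ (Eventually.of_forall fun ξ => ?_)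
    · exact AEStronglyMeasurable.mul (by fun_prop) (hrep.memLp i).1
    · by_cases hξ : ξ ∈ dyadicAnnulus k
      · rw [norm_mul, Complex.norm_real]
        gcongr
        have h1 : ‖ξ i‖ ≤ ‖ξ‖ := PiLp.norm_apply_le ξ i
        have h2 := hξ.2
        have h3 := Real.pi_gt_three
        nlinarith [norm_nonneg ξ]
      · rw [hrep.supp ξ hξ]; simp
  have hint : ∀ i, Integrable (fun ξ : E3 => (ξ i : ℂ) * L.blockFT k u ξ i) := fun i =>
    integrable_of_memLp_of_support (hmem i) fun ξ hξ => by rw [hrep.supp ξ hξ]; simp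
  refine ae_eq_of_integral_mul_schwartz (f := fun ξ => freqVec ξ ⬝ᵥ L.blockFT k u ξ) (g := 0)
    (integrable_finsetSum _ fun i _ => hint i).locallyIntegrable
    (integrable_zero E3 ℂ volume).locallyIntegrable fun φ => ?_
  -- The multiplier of $\Delta_k$ cuts the arbitrary test function `φ` down to the annulus, which
  -- places the kernel in $\mathcal S_0$, where the divergence is known to vanish.
  set θ : 𝓢(E3, ℂ) := SchwartzMap.convolution (ContinuousLinearMap.mul ℂ ℂ) (L.ker k) (𝓕⁻ φ)
  have hθ : ∀ ξ, 𝓕 θ ξ = 𝓕 (L.ker k) ξ * φ ξ := by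
    intro ξ
    rw [SchwartzMap.fourier_convolution, SchwartzMap.pairing_apply_apply,
      FourierTransform.fourier_fourierInv_eq]
    rfl
  have hS : IsS0 (reflectAt θ 0) :=
    isS0_reflectAt (fun ξ hξ => by rw [hθ, L.fourier_ker_eq_zero hξ, zero_mul]) 0
  have hzero := hdiv _ hS
  rw [sum_apply] at hzero
  have hterm : ∀ i, (∂_{stdVec i} (u i)) (reflectAt θ 0) =
      ∫ ξ, 2 * Real.pi * Complex.I * ((ξ i : ℂ) * L.blockFT k u ξ i * φ ξ) := by
    intro i
    rw [TemperedDistribution.lineDerivOp_apply_apply, lineDeriv_reflectAt, neg_neg,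
      L.eq_fourierInv_annulusFT_mul k (u i) (memLp_block h i) (κ := ∂_{stdVec i} (𝓕⁻ φ))
        (θ := ∂_{stdVec i} θ) (fun ξ => ?_) 0, Real.fourierInv_eq]
    · congr 1
      ext ξ
      rw [fourier_lineDeriv_apply, inner_stdVec, FourierTransform.fourier_fourierInv_eq]
      simp only [inner_zero_right, AddChar.map_zero_eq_one, one_smul, blockFT, block_apply]
      ring
    · rw [fourier_lineDeriv_apply, fourier_lineDeriv_apply, hθ,
        FourierTransform.fourier_fourierInv_eq]
      ring
  simp only [hterm, integral_const_mul, ← Finset.mul_sum] at hzero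
  have h2 : ∑ i, ∫ ξ, (ξ i : ℂ) * L.blockFT k u ξ i * φ ξ = 0 := by
    refine (mul_eq_zero.mp hzero).resolve_left ?_
    simp [Real.pi_ne_zero]
  have hint' : ∀ i, Integrable (fun ξ : E3 => (ξ i : ℂ) * L.blockFT k u ξ i * φ ξ) := by
    intro i
    exact (hint i).mul_bdd (c := ‖φ.toBoundedContinuousFunction‖) φ.continuous.aestronglyMeasurable
      (Eventually.of_forall fun ξ => φ.toBoundedContinuousFunction.norm_coe_le_norm ξ)
  rw [← integral_finsetSum _ fun i _ => hint' i] at h2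
  simp only [Pi.zero_apply, zero_mul, integral_zero]
  rw [← h2]
  congr 1
  ext ξ
  rw [dotProduct, Finset.sum_mul]
  rfl

/-- The localized curl of a distribution on the Fourier side. -/
theorem conv_ker_curl {k : ℤ} {u : VecDist} (h : spaceNorm 2 (L.block k u) < ∞) (x : E3)
    (i : Fin 3) : conv (L.ker k) (curl u) x i =
      𝓕⁻ (fun ξ => 2 * Real.pi * Complex.I * (freqVec ξ ⨯₃ L.blockFT k u ξ) i) x := by
  have hrep := spectralRep_block h
  have hd : ∀ a b : Fin 3, (∂_{stdVec a} (u b)) (reflectAt (L.ker k) x) =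
      𝓕⁻ (fun ξ => L.blockFT k u ξ b * (2 * Real.pi * Complex.I * (ξ a : ℂ))) x := by
    intro a b
    rw [TemperedDistribution.lineDerivOp_apply_apply, lineDeriv_reflectAt, neg_neg,
      L.eq_fourierInv_annulusFT_mul k (u b) (memLp_block h b)
        (κ := ∂_{stdVec a} (∑ j ∈ Finset.Icc (k - 2) (k + 2), L.ker j))
        (θ := ∂_{stdVec a} (L.ker k)) (fun ξ => ?_) x]
    · refine Real.fourierInv_congr_ae (Eventually.of_forall fun ξ => ?_) x
      dsimp only
      rw [fourier_lineDeriv_apply, inner_stdVec]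
      by_cases hξ : ξ ∈ dyadicAnnulus k
      · rw [L.sum_fourier_ker_eq_one_of_mem hξ, mul_one]; rfl
      · simp [annulusFT, blockFT, hξ]
    · rw [fourier_lineDeriv_apply, fourier_lineDeriv_apply]
      by_cases hξ : ξ ∈ dyadicAnnulus k
      · rw [L.sum_fourier_ker_eq_one_of_mem hξ]; ring
      · simp [L.fourier_ker_eq_zero hξ]
  have hint : ∀ a b : Fin 3, Integrable fun ξ : E3 =>
      L.blockFT k u ξ b * (2 * Real.pi * Complex.I * (ξ a : ℂ)) := by
    intro a b
    refine integrable_of_memLp_of_support (k := k) ?_ fun ξ hξ => by rw [hrep.supp ξ hξ]; simp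
    refine MemLp.of_le_mul (c := 2 ^ (k + 1)) (hrep.memLp b) ?_ (Eventually.of_forall fun ξ => ?_)
    · exact AEStronglyMeasurable.mul (hrep.memLp b).1 (by fun_prop)
    · by_cases hξ : ξ ∈ dyadicAnnulus k
      · rw [norm_mul, mul_comm]
        gcongr
        have h1 : ‖ξ a‖ ≤ ‖ξ‖ := PiLp.norm_apply_le ξ a
        have h2 := hξ.2
        have h3 := Real.pi_pos
        simp only [norm_mul, Complex.norm_real, Complex.norm_I, mul_one, Complex.norm_ofNat]
        rw [Real.norm_of_nonneg h3.le]
        exact le_trans (by gcongr) h2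
      · rw [hrep.supp ξ hξ]; simp
  have hsub : ∀ f g : E3 → ℂ, Integrable f → Integrable g →
      𝓕⁻ f x - 𝓕⁻ g x = 𝓕⁻ (fun ξ => f ξ - g ξ) x := by
    intro f g hf hg
    simp only [Real.fourierInv_eq_fourier_neg, Real.fourier_eq]
    rw [← integral_sub ((Real.fourierIntegral_convergent_iff (-x)).mpr hf)
      ((Real.fourierIntegral_convergent_iff (-x)).mpr hg)]
    simp only [smul_sub]
  fin_cases i
  · change (∂_{stdVec 1} (u 2)) _ - (∂_{stdVec 2} (u 1)) _ = _
    rw [hd, hd, hsub _ _ (hint _ _) (hint _ _)]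
    refine Real.fourierInv_congr_ae (Eventually.of_forall fun ξ => ?_) x
    simp [cross_apply, freqVec]
    ring
  · change (∂_{stdVec 2} (u 0)) _ - (∂_{stdVec 0} (u 2)) _ = _
    rw [hd, hd, hsub _ _ (hint _ _) (hint _ _)]
    refine Real.fourierInv_congr_ae (Eventually.of_forall fun ξ => ?_) x
    simp [cross_apply, freqVec]
    ring
  · change (∂_{stdVec 0} (u 1)) _ - (∂_{stdVec 1} (u 0)) _ = _
    rw [hd, hd, hsub _ _ (hint _ _) (hint _ _)]
    refine Real.fourierInv_congr_ae (Eventually.of_forall fun ξ => ?_) x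
    simp [cross_apply, freqVec]
    ring

theorem cross_eq_zero_of_radiallyColinear {F G : VecDist} (h : RadiallyColinear F G) (j k : ℤ)
    (x : E3) : conv (L.ker j) (curl F) x ⨯₃ L.block k G x = 0 := by
  by_contra hne
  exact h _ _ (L.isS0_ker j) (L.isS0_ker k) (L.isRadial_ker j) (L.isRadial_ker k) x
    (crossProduct_ne_zero_iff_linearIndependent.mp hne)

end LittlewoodPaley


/-! ### Convolutions of square integrable functions -/

theorem memLp_mul_sub {a b : E3 → ℂ} (ha : MemLp a 2) (hb : MemLp b 2) (ξ : E3) :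
    Integrable fun ζ => a ζ * b (ξ - ζ) := by
  have h : MemLp (fun ζ => b (ξ - ζ)) 2 :=
    hb.comp_measurePreserving (Measure.measurePreserving_sub_left volume ξ)
  exact ha.integrable_mul h

/-- The convolution of nonnegative functions. -/
def lconv (A B : E3 → ℝ≥0∞) (ξ : E3) : ℝ≥0∞ := ∫⁻ ζ, A ζ * B (ξ - ζ)

theorem lconv_comm (A B : E3 → ℝ≥0∞) (ξ : E3) : lconv A B ξ = lconv B A ξ := by
  unfold lconv
  rw [← lintegral_sub_left_eq_self (μ := volume) _ ξ]
  simp only [sub_sub_cancel, mul_comm]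

theorem aemeasurable_comp_sub {B : E3 → ℝ≥0∞} (hB : AEMeasurable B) (ξ : E3) :
    AEMeasurable fun ζ => B (ξ - ζ) :=
  hB.comp_quasiMeasurePreserving
    (Measure.measurePreserving_sub_left volume ξ).quasiMeasurePreserving

theorem aemeasurable_lconv_integrand {A B : E3 → ℝ≥0∞} (hA : AEMeasurable A)
    (hB : AEMeasurable B) :
    AEMeasurable (fun p : E3 × E3 => A p.2 * B (p.1 - p.2)) (volume.prod volume) :=
  (hA.comp_quasiMeasurePreserving Measure.quasiMeasurePreserving_snd).mul
    (hB.comp_quasiMeasurePreserving (quasiMeasurePreserving_sub volume volume))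

theorem aemeasurable_lconv {A B : E3 → ℝ≥0∞} (hA : AEMeasurable A) (hB : AEMeasurable B) :
    AEMeasurable (lconv A B) :=
  (aemeasurable_lconv_integrand hA hB).lintegral_prod_right'

theorem eLpNorm_two_eq (B : E3 → ℝ≥0∞) :
    eLpNorm B 2 volume = (∫⁻ x, B x ^ (2 : ℝ)) ^ (1 / 2 : ℝ) := by
  rw [eLpNorm_eq_lintegral_rpow_enorm_toReal (by simp) (by simp)]
  simp only [enorm_eq_self, ENNReal.toReal_ofNat]

theorem lconv_le {A B : E3 → ℝ≥0∞} (hA : AEMeasurable A) (hB : AEMeasurable B) (ξ : E3) :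
    lconv A B ξ ≤ eLpNorm A 2 * eLpNorm B 2 := by
  have h := ENNReal.lintegral_mul_le_Lp_mul_Lq volume Real.HolderConjugate.two_two hA
    (aemeasurable_comp_sub hB ξ)
  rw [lintegral_sub_left_eq_self (fun x => B x ^ (2 : ℝ)) ξ] at h
  rw [eLpNorm_two_eq, eLpNorm_two_eq]
  exact h

/-- Cauchy–Schwarz after splitting $A=A^{1/2}A^{1/2}$: one half is integrated alone, the other is
kept with $B$. -/
theorem lconv_sq_le {A B : E3 → ℝ≥0∞} (hA : AEMeasurable A) (hB : AEMeasurable B) (ξ : E3) :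
    lconv A B ξ ^ (2 : ℝ) ≤ (∫⁻ ζ, A ζ) * lconv A (fun η => B η ^ (2 : ℝ)) ξ := by
  have h := ENNReal.lintegral_mul_le_Lp_mul_Lq volume Real.HolderConjugate.two_two
    (hA.pow_const (1 / 2 : ℝ)) ((hA.pow_const (1 / 2 : ℝ)).mul (aemeasurable_comp_sub hB ξ))
  have e1 : ∀ x : ℝ≥0∞, x ^ (1 / 2 : ℝ) * x ^ (1 / 2 : ℝ) = x := fun x => by
    rw [← ENNReal.rpow_add_of_nonneg _ _ (by norm_num) (by norm_num)]; norm_num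
  have e2 : ∀ x : ℝ≥0∞, (x ^ (1 / 2 : ℝ)) ^ (2 : ℝ) = x := fun x => by
    rw [← ENNReal.rpow_mul]; norm_num
  simp only [Pi.mul_apply, ← mul_assoc, e1, e2, ENNReal.mul_rpow_of_nonneg _ _ zero_le_two] at h
  calc lconv A B ξ ^ (2 : ℝ) ≤ ((∫⁻ ζ, A ζ) ^ (1 / 2 : ℝ) *
        (∫⁻ ζ, A ζ * B (ξ - ζ) ^ (2 : ℝ)) ^ (1 / 2 : ℝ)) ^ (2 : ℝ) := by
        unfold lconv; gcongr
    _ = _ := by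
      rw [ENNReal.mul_rpow_of_nonneg _ _ zero_le_two, e2, e2]
      rfl

/-- Young's inequality $L^1*L^2\subset L^2$, by integrating the preceding pointwise bound with
Tonelli's theorem. -/
theorem eLpNorm_lconv_le {A B : E3 → ℝ≥0∞} (hA : AEMeasurable A) (hB : AEMeasurable B) :
    eLpNorm (lconv A B) 2 volume ≤ (∫⁻ ζ, A ζ) * eLpNorm B 2 := by
  have hT : ∫⁻ ξ, lconv A (fun η => B η ^ (2 : ℝ)) ξ = (∫⁻ ζ, A ζ) * ∫⁻ x, B x ^ (2 : ℝ) := by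
    unfold lconv
    rw [lintegral_lintegral_swap (aemeasurable_lconv_integrand hA (hB.pow_const (2 : ℝ)))]
    have : ∀ ζ, ∫⁻ ξ, A ζ * B (ξ - ζ) ^ (2 : ℝ) = A ζ * ∫⁻ x, B x ^ (2 : ℝ) := fun ζ => by
      have hm : AEMeasurable fun ξ => B (ξ - ζ) ^ (2 : ℝ) := (hB.comp_quasiMeasurePreserving
        (measurePreserving_sub_right volume ζ).quasiMeasurePreserving).pow_const (2 : ℝ)
      rw [lintegral_const_mul'' _ hm, lintegral_sub_right_eq_self (fun x => B x ^ (2 : ℝ)) ζ]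
    simp only [this]
    rw [lintegral_mul_const'' _ hA]
  rw [eLpNorm_two_eq, eLpNorm_two_eq]
  calc (∫⁻ ξ, lconv A B ξ ^ (2 : ℝ)) ^ (1 / 2 : ℝ)
      ≤ (∫⁻ ξ, (∫⁻ ζ, A ζ) * lconv A (fun η => B η ^ (2 : ℝ)) ξ) ^ (1 / 2 : ℝ) := by
        gcongr with ξ; exact lconv_sq_le hA hB ξ
    _ = (((∫⁻ ζ, A ζ) ^ (2 : ℝ)) * ∫⁻ x, B x ^ (2 : ℝ)) ^ (1 / 2 : ℝ) := by
        rw [lintegral_const_mul'' _ (aemeasurable_lconv hA (hB.pow_const (2 : ℝ))), hT, ← mul_assoc]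
        norm_cast
        rw [sq]
    _ = _ := by
        rw [ENNReal.mul_rpow_of_nonneg _ _ (by norm_num), ← ENNReal.rpow_mul]
        norm_num

/-- Bernstein's inequality on the Fourier side: Cauchy–Schwarz on the annulus, the integral of the
transform taking the place of the sup norm of the field. -/
theorem lintegral_le_of_support {k : ℤ} {A : E3 → ℝ≥0∞} (hA : AEMeasurable A)
    (hs : ∀ ξ, ξ ∉ dyadicAnnulus k → A ξ = 0) :
    ∫⁻ ξ, A ξ ≤ annulusConst * (2 : ℝ≥0∞) ^ ((3 / 2 : ℝ) * k) * eLpNorm A 2 := by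
  have e : A = fun ξ => (dyadicAnnulus k).indicator 1 ξ * A ξ := by
    ext ξ
    by_cases h : ξ ∈ dyadicAnnulus k
    · simp [h]
    · simp [h, hs ξ h]
  have h := ENNReal.lintegral_mul_le_Lp_mul_Lq volume Real.HolderConjugate.two_two
    ((measurable_one.indicator (measurableSet_dyadicAnnulus k)).aemeasurable) hA
  have e3 : ∀ ξ, ((dyadicAnnulus k).indicator 1 ξ : ℝ≥0∞) ^ (2 : ℝ) =
      (dyadicAnnulus k).indicator 1 ξ := fun ξ => by
    by_cases h : ξ ∈ dyadicAnnulus k <;> simp [h]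
  simp only [e3, lintegral_indicator_one (measurableSet_dyadicAnnulus k)] at h
  calc ∫⁻ ξ, A ξ = ∫⁻ ξ, (dyadicAnnulus k).indicator 1 ξ * A ξ := lintegral_congr (congrFun e)
    _ ≤ _ := h
    _ ≤ _ := by
      rw [eLpNorm_two_eq]
      gcongr
      exact volume_dyadicAnnulus_rpow_le k

theorem eLpNorm_indicator_le_of_bound {m : ℤ} {Z : E3 → Fin 3 → ℂ} {c : ℝ≥0∞}
    (h : ∀ᵐ ξ, ξ ∈ dyadicAnnulus m → ‖Z ξ‖ₑ ≤ c) :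
    eLpNorm ((dyadicAnnulus m).indicator Z) 2 ≤
      annulusConst * (2 : ℝ≥0∞) ^ ((3 / 2 : ℝ) * m) * c := by
  have h1 : eLpNorm ((dyadicAnnulus m).indicator Z) 2 ≤
      eLpNorm ((dyadicAnnulus m).indicator fun _ => c) 2 volume := by
    refine eLpNorm_mono_enorm_ae ?_
    filter_upwards [h] with ξ hξ
    by_cases hm : ξ ∈ dyadicAnnulus m
    · simpa [hm] using hξ hm
    · simp [hm]
  refine h1.trans ?_
  rw [eLpNorm_two_eq]
  have e3 : ∀ ξ, ((dyadicAnnulus m).indicator (fun _ => c) ξ : ℝ≥0∞) ^ (2 : ℝ) =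
      (dyadicAnnulus m).indicator (fun _ => c ^ (2 : ℝ)) ξ := fun ξ => by
    by_cases h : ξ ∈ dyadicAnnulus m <;> simp [h]
  simp only [e3]
  rw [lintegral_indicator_const (measurableSet_dyadicAnnulus m),
    ENNReal.mul_rpow_of_nonneg _ _ (by norm_num), mul_comm, ← ENNReal.rpow_mul]
  norm_num
  gcongr
  simpa using volume_dyadicAnnulus_rpow_le m

/-! ### The Fourier transform of a product -/

theorem fourierInv_convolution {a b : E3 → ℂ} (ha : Integrable a) (hb : Integrable b) (x : E3) :
    𝓕⁻ (convolution a b (ContinuousLinearMap.mul ℂ ℂ) volume) x = 𝓕⁻ a x * 𝓕⁻ b x := by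
  simp only [Real.fourierInv_eq_fourier_neg]
  exact Real.fourier_mul_convolution_eq ha hb (-x)

theorem memLp_fourierInv_mul {a b : E3 → ℂ} (ha1 : Integrable a)
    (hb : MemLp b 2) (hb1 : Integrable b) : MemLp (fun x => 𝓕⁻ a x * 𝓕⁻ b x) 2 := by
  refine MemLp.of_le_mul (c := ∫ ξ, ‖a ξ‖) (memLp_fourierInv hb hb1)
    ((continuous_fourierInv_of_integrable ha1).mul
      (continuous_fourierInv_of_integrable hb1)).aestronglyMeasurable
    (Eventually.of_forall fun x => ?_)
  rw [norm_mul]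
  gcongr
  exact norm_fourierInv_le_integral x

theorem fourierL2_fourierInv_mul {a b : E3 → ℂ} (ha1 : Integrable a)
    (hb : MemLp b 2) (hb1 : Integrable b) :
    (fun ξ => ∫ ζ, a ζ * b (ξ - ζ)) =ᵐ[volume] fourierL2 (fun x => 𝓕⁻ a x * 𝓕⁻ b x) := by
  have hX := ha1.integrable_convolution (ContinuousLinearMap.mul ℂ ℂ) hb1
  refine ae_eq_fourierL2 (memLp_fourierInv_mul ha1 hb hb1) hX.locallyIntegrable fun φ => ?_
  have h := integral_fourierInv_mul hX (𝓕 φ).integrable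
  rw [← SchwartzMap.fourierInv_coe, FourierTransform.fourierInv_fourier_eq] at h
  simp only [fourierInv_convolution ha1 hb1] at h
  exact h

theorem fourierL2_sub {f g : E3 → ℂ} (hf : MemLp f 2) (hg : MemLp g 2) :
    fourierL2 (fun x => f x - g x) =ᵐ[volume] fun ξ => fourierL2 f ξ - fourierL2 g ξ := by
  have hfg : MemLp (fun x => f x - g x) 2 := hf.sub hg
  have hF : MemLp (fun x => fourierL2 f x - fourierL2 g x) 2 :=
    (memLp_fourierL2 f).sub (memLp_fourierL2 g)
  refine (ae_eq_fourierL2 hfg hF.locallyIntegrable_two fun φ => ?_).symm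
  have hφ : ∀ (f : E3 → ℂ), MemLp f 2 → ∀ φ : 𝓢(E3, ℂ), Integrable fun x => f x * φ x :=
    fun f hf φ => hf.integrable_mul (φ.memLp 2 volume)
  simp only [sub_mul]
  rw [integral_sub (hφ f hf (𝓕 φ)) (hφ g hg (𝓕 φ)),
    integral_sub (hφ _ (memLp_fourierL2 f) φ) (hφ _ (memLp_fourierL2 g) φ),
    integral_fourierL2_mul_schwartz hf, integral_fourierL2_mul_schwartz hg]

/-- The Fourier transform of a vector field. -/
def fourierVec (y : E3 → Fin 3 → ℂ) (ξ : E3) : Fin 3 → ℂ :=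
  fun i => fourierL2 (fun x => y x i) ξ

/-- The convolution of vector fields with respect to the cross product. -/
def crossConv (V W : E3 → Fin 3 → ℂ) (ξ : E3) : Fin 3 → ℂ :=
  fun i => ∫ ζ, (V ζ ⨯₃ W (ξ - ζ)) i

theorem integrable_cross {V W : E3 → Fin 3 → ℂ} (hV : ∀ i, MemLp (fun ξ => V ξ i) 2)
    (hW : ∀ i, MemLp (fun ξ => W ξ i) 2) (ξ : E3) (i : Fin 3) :
    Integrable fun ζ => (V ζ ⨯₃ W (ξ - ζ)) i := by
  have h := fun a b => memLp_mul_sub (hV a) (hW b) ξ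
  fin_cases i
  · exact (h 1 2).sub (h 2 1)
  · exact (h 2 0).sub (h 0 2)
  · exact (h 0 1).sub (h 1 0)

theorem memLp_cross {v w : E3 → Fin 3 → ℂ} (h : ∀ a b, MemLp (fun x => v x a * w x b) 2)
    (i : Fin 3) : MemLp (fun x => (v x ⨯₃ w x) i) 2 := by
  fin_cases i
  · exact (h 1 2).sub (h 2 1)
  · exact (h 2 0).sub (h 0 2)
  · exact (h 0 1).sub (h 1 0)

theorem fourierVec_cross {v w V W : E3 → Fin 3 → ℂ} (hV : ∀ i, MemLp (fun ξ => V ξ i) 2)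
    (hV1 : ∀ i, Integrable (fun ξ => V ξ i)) (hW : ∀ i, MemLp (fun ξ => W ξ i) 2)
    (hW1 : ∀ i, Integrable (fun ξ => W ξ i)) (hv : ∀ i x, v x i = 𝓕⁻ (fun ξ => V ξ i) x)
    (hw : ∀ i x, w x i = 𝓕⁻ (fun ξ => W ξ i) x) :
    fourierVec (fun x => v x ⨯₃ w x) =ᵐ[volume] crossConv V W := by
  have h : ∀ a b c d, (fun ξ => (∫ ζ, V ζ a * W (ξ - ζ) b) - ∫ ζ, V ζ c * W (ξ - ζ) d) =ᵐ[volume]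
      fourierL2 (fun x => v x a * w x b - v x c * w x d) := by
    intro a b c d
    simp only [hv, hw]
    filter_upwards [fourierL2_sub (memLp_fourierInv_mul (hV1 a) (hW b) (hW1 b))
      (memLp_fourierInv_mul (hV1 c) (hW d) (hW1 d)),
      fourierL2_fourierInv_mul (hV1 a) (hW b) (hW1 b),
      fourierL2_fourierInv_mul (hV1 c) (hW d) (hW1 d)] with ξ h1 h2 h3
    rw [h1, ← h2, ← h3]
  filter_upwards [h 1 2 2 1, h 2 0 0 2, h 0 1 1 0] with ξ h0 h1 h2
  have hm := fun a b => memLp_mul_sub (hV a) (hW b) ξ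
  funext i
  fin_cases i
  · simp only [fourierVec, crossConv, cross_apply]
    simp only [Fin.zero_eta, Matrix.cons_val_zero]
    rw [← h0, integral_sub (hm _ _) (hm _ _)]
  · simp only [fourierVec, crossConv, cross_apply]
    simp only [Fin.mk_one, Matrix.cons_val_one, Matrix.cons_val_zero]
    rw [← h1, integral_sub (hm _ _) (hm _ _)]
  · simp only [fourierVec, crossConv, cross_apply]
    simp only [Fin.reduceFinMk, Matrix.cons_val]
    rw [← h2, integral_sub (hm _ _) (hm _ _)]


/-! ### The Leray symbol -/

theorem norm_cross_le (a b : Fin 3 → ℂ) : ‖a ⨯₃ b‖ ≤ 2 * ‖a‖ * ‖b‖ := by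
  have h : ∀ i j k l : Fin 3, ‖a i * b j - a k * b l‖ ≤ 2 * ‖a‖ * ‖b‖ := by
    intro i j k l
    calc _ ≤ ‖a i * b j‖ + ‖a k * b l‖ := norm_sub_le _ _
      _ ≤ ‖a‖ * ‖b‖ + ‖a‖ * ‖b‖ := by
        rw [norm_mul, norm_mul]
        gcongr <;> apply norm_le_pi_norm
      _ = _ := by ring
  refine (pi_norm_le_iff_of_nonneg (by positivity)).mpr fun i => ?_
  fin_cases i <;> exact h _ _ _ _

theorem norm_freqVec_le (ξ : E3) : ‖freqVec ξ‖ ≤ ‖ξ‖ := by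
  refine (pi_norm_le_iff_of_nonneg (by positivity)).mpr fun i => ?_
  rw [freqVec, Complex.norm_real]
  exact PiLp.norm_apply_le ξ i

/-- The symbol of the Leray projector. -/
def leraySym (ξ : E3) (X : Fin 3 → ℂ) : Fin 3 → ℂ :=
  -((((‖ξ‖ ^ 2)⁻¹ : ℝ) : ℂ) • (freqVec ξ ⨯₃ (freqVec ξ ⨯₃ X)))

theorem norm_leraySym (ξ : E3) (X : Fin 3 → ℂ) :
    ‖leraySym ξ X‖ = (‖ξ‖ ^ 2)⁻¹ * ‖freqVec ξ ⨯₃ (freqVec ξ ⨯₃ X)‖ := by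
  rw [leraySym, norm_neg, norm_smul, Complex.norm_real, Real.norm_of_nonneg (by positivity)]

theorem norm_leraySym_le (ξ : E3) (X : Fin 3 → ℂ) : ‖leraySym ξ X‖ ≤ 4 * ‖X‖ := by
  rw [norm_leraySym]
  rcases eq_or_ne ξ 0 with rfl | h
  · simp
  have hp := norm_pos_iff.mpr h
  rw [inv_mul_le_iff₀ (by positivity)]
  calc _ ≤ 2 * ‖ξ‖ * (2 * ‖ξ‖ * ‖X‖) := by
        refine (norm_cross_le _ _).trans ?_
        gcongr
        · exact norm_freqVec_le ξ
        · refine (norm_cross_le _ _).trans ?_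
          gcongr
          exact norm_freqVec_le ξ
    _ = _ := by ring

/-- The Leray symbol sees a vector only modulo multiples of the frequency, after a
multiplication by the frequency. -/
theorem norm_leraySym_le_of_cross {ξ : E3} (hξ : ξ ≠ 0) {X R : Fin 3 → ℂ} {c : ℂ}
    (h : freqVec ξ ⨯₃ X = c • freqVec ξ + R) : ‖leraySym ξ X‖ ≤ 2 * ‖ξ‖⁻¹ * ‖R‖ := by
  have hp := norm_pos_iff.mpr hξ
  rw [norm_leraySym, h, map_add, map_smul, cross_self, smul_zero, zero_add,
    inv_mul_le_iff₀ (by positivity)]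
  calc _ ≤ 2 * ‖ξ‖ * ‖R‖ := by
        refine (norm_cross_le _ _).trans ?_
        gcongr
        exact norm_freqVec_le ξ
    _ = _ := by field_simp

/-- The Fourier transform of the Leray projection of a vector field. -/
def lerayFT (y : E3 → Fin 3 → ℂ) (ξ : E3) : Fin 3 → ℂ := leraySym ξ (fourierVec y ξ)

/-- The `L²` norm on a dyadic annulus. -/
def annNorm (m : ℤ) (Z : E3 → Fin 3 → ℂ) : ℝ≥0∞ := eLpNorm ((dyadicAnnulus m).indicator Z) 2

theorem annNorm_mono_ae {m : ℤ} {Z : E3 → Fin 3 → ℂ} {B : E3 → ℝ≥0∞} {c : ℝ≥0}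
    (h : ∀ᵐ ξ, ξ ∈ dyadicAnnulus m → ‖Z ξ‖ₑ ≤ c * B ξ) : annNorm m Z ≤ c * eLpNorm B 2 volume := by
  have : annNorm m Z ≤ eLpNorm (fun ξ => c * B ξ) 2 volume := by
    refine eLpNorm_mono_enorm_ae ?_
    filter_upwards [h] with ξ hξ
    by_cases hm : ξ ∈ dyadicAnnulus m
    · simpa [hm] using hξ hm
    · simp [hm]
  refine this.trans ?_
  rw [eLpNorm_two_eq, eLpNorm_two_eq]
  simp only [ENNReal.mul_rpow_of_nonneg _ _ zero_le_two]
  rw [lintegral_const_mul' _ _ (by simp), ENNReal.mul_rpow_of_nonneg _ _ (by norm_num),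
    ← ENNReal.rpow_mul]
  norm_num

theorem annNorm_eq_zero {m : ℤ} {Z : E3 → Fin 3 → ℂ}
    (h : ∀ᵐ ξ, ξ ∈ dyadicAnnulus m → Z ξ = 0) : annNorm m Z = 0 := by
  have := annNorm_mono_ae (m := m) (Z := Z) (B := 0) (c := 0) (by
    filter_upwards [h] with ξ hξ hm
    simp [hξ hm])
  simpa using this

/-! ### The bilinear estimate for frequency localized fields -/

theorem lconv_eq_zero {j k : ℤ} {A B : E3 → ℝ≥0∞} (hA : ∀ ζ, ζ ∉ dyadicAnnulus j → A ζ = 0)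
    (hB : ∀ ζ, ζ ∉ dyadicAnnulus k → B ζ = 0) {ξ : E3}
    (h : ∀ ζ, ζ ∈ dyadicAnnulus j → ξ - ζ ∈ dyadicAnnulus k → False) : lconv A B ξ = 0 := by
  have : ∀ ζ, A ζ * B (ξ - ζ) = 0 := by
    intro ζ
    by_cases h1 : ζ ∈ dyadicAnnulus j
    · by_cases h2 : ξ - ζ ∈ dyadicAnnulus k
      · exact (h ζ h1 h2).elim
      · rw [hB _ h2, mul_zero]
    · rw [hA _ h1, zero_mul]
  simp [lconv, this]

theorem le_max_add_three {m j k : ℤ} {ξ ζ : E3} (hξ : ξ ∈ dyadicAnnulus m)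
    (hζ : ζ ∈ dyadicAnnulus j) (hη : ξ - ζ ∈ dyadicAnnulus k) : m ≤ max j k + 3 := by
  have h1 : ‖ξ‖ ≤ ‖ζ‖ + ‖ξ - ζ‖ := by
    simpa using norm_add_le ζ (ξ - ζ)
  have hj : (2 : ℝ) ^ (j + 1) ≤ 2 ^ (max j k + 1) :=
    zpow_le_zpow_right₀ one_le_two (by have := le_max_left j k; omega)
  have hk : (2 : ℝ) ^ (k + 1) ≤ 2 ^ (max j k + 1) :=
    zpow_le_zpow_right₀ one_le_two (by have := le_max_right j k; omega)
  have h2 : (2 : ℝ) ^ (m - 1) ≤ 2 ^ (max j k + 2) := by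
    have e : (2 : ℝ) ^ (max j k + 2) = 2 ^ (max j k + 1) * 2 := by
      rw [← zpow_add_one₀ two_ne_zero]; ring_nf
    have := Real.pi_pos
    rw [e]
    nlinarith [hξ.1, hζ.2, hη.2]
  have := (zpow_le_zpow_iff_right₀ (one_lt_two (α := ℝ))).mp h2
  omega

/-- A gap of four octaves makes $2\pi|\zeta|\le 2^{k-3}$, a quarter of the lower bound $2^{k-1}$ for
$2\pi|\xi-\zeta|$. Adding $\zeta$ therefore does not change the order of magnitude. -/
theorem abs_sub_le_of_low {m j k : ℤ} (hjk : j + 4 ≤ k) {ξ ζ : E3} (hξ : ξ ∈ dyadicAnnulus m)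
    (hζ : ζ ∈ dyadicAnnulus j) (hη : ξ - ζ ∈ dyadicAnnulus k) : |m - k| ≤ 3 := by
  have h1 : ‖ξ‖ ≤ ‖ζ‖ + ‖ξ - ζ‖ := by
    simpa using norm_add_le ζ (ξ - ζ)
  have h2 : ‖ξ - ζ‖ ≤ ‖ξ‖ + ‖ζ‖ := norm_sub_le _ _
  have hj : (2 : ℝ) ^ (j + 1) ≤ 2 ^ (k - 3) := zpow_le_zpow_right₀ one_le_two (by omega)
  have e : ∀ n : ℤ, (2 : ℝ) ^ n = 2 ^ (k - 3) * 2 ^ (n - k + 3) := fun n => by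
    rw [← zpow_add₀ two_ne_zero]; congr 1; ring
  have hpos : (0 : ℝ) < 2 ^ (k - 3) := by positivity
  have h3 : (2 : ℝ) ^ (m - 1) < 2 ^ (k + 2) := by
    have e1 := e (k + 1)
    have e2 := e (k + 2)
    have := Real.pi_pos
    norm_num [show k + 1 - k + 3 = 4 by ring, show k + 2 - k + 3 = 5 by ring] at e1 e2
    nlinarith [hξ.1, hζ.2, hη.2]
  have h4 : (2 : ℝ) ^ (k - 2) ≤ 2 ^ (m + 1) := by
    have e1 := e (k - 1)
    have e2 := e (k - 2)
    have := Real.pi_pos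
    norm_num [show k - 1 - k + 3 = 2 by ring, show k - 2 - k + 3 = 1 by ring] at e1 e2
    nlinarith [hξ.2, hζ.2, hη.1]
  have h5 := (zpow_lt_zpow_iff_right₀ (one_lt_two (α := ℝ))).mp h3
  have h6 := (zpow_le_zpow_iff_right₀ (one_lt_two (α := ℝ))).mp h4
  rw [abs_le]
  constructor <;> omega

/-- The kernel of the bilinear estimate. -/
def paraKer (m j k : ℤ) : ℝ≥0∞ :=
  if j + 4 ≤ k then (if |m - k| ≤ 3 then (2 : ℝ≥0∞) ^ ((3 / 2 : ℝ) * j) else 0)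
  else if k + 4 ≤ j then
    (if |m - j| ≤ 3 then (2 : ℝ≥0∞) ^ ((5 / 2 : ℝ) * k - m) else 0)
  else (if m ≤ max j k + 3 then (2 : ℝ≥0∞) ^ ((3 / 2 : ℝ) * m) else 0)

theorem enorm_pi_le {x : Fin 3 → ℂ} {c : ℝ≥0∞} (h : ∀ i, ‖x i‖ₑ ≤ c) : ‖x‖ₑ ≤ c := by
  induction c with
  | top => exact le_top
  | coe c =>
    simp only [enorm_eq_nnnorm, ENNReal.coe_le_coe] at h ⊢
    exact pi_nnnorm_le_iff.mpr h

theorem enorm_integral_pi_le {S : E3 → Fin 3 → ℂ} {B : E3 → ℝ≥0∞} (h : ∀ᵐ ζ, ‖S ζ‖ₑ ≤ B ζ) :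
    ‖(fun i => ∫ ζ, S ζ i : Fin 3 → ℂ)‖ₑ ≤ ∫⁻ ζ, B ζ := by
  refine enorm_pi_le fun i => (enorm_integral_le_lintegral_enorm _).trans
    (lintegral_mono_ae (h.mono fun ζ hζ => le_trans ?_ hζ))
  simp only [enorm_eq_nnnorm, ENNReal.coe_le_coe]
  exact nnnorm_le_pi_nnnorm _ i

theorem enorm_le_mul_mul {x a b : Fin 3 → ℂ} {c : ℝ≥0} (h : ‖x‖ ≤ c * (‖a‖ * ‖b‖)) :
    ‖x‖ₑ ≤ c * (‖a‖ₑ * ‖b‖ₑ) := by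
  simp only [enorm_eq_nnnorm]
  exact_mod_cast h

theorem enorm_crossConv_le (V W : E3 → Fin 3 → ℂ) (ξ : E3) :
    ‖crossConv V W ξ‖ₑ ≤ 2 * lconv (fun ζ => ‖V ζ‖ₑ) (fun ζ => ‖W ζ‖ₑ) ξ := by
  have h := enorm_integral_pi_le (S := fun ζ => V ζ ⨯₃ W (ξ - ζ))
    (B := fun ζ => (2 : ℝ≥0) * (‖V ζ‖ₑ * ‖W (ξ - ζ)‖ₑ))
    (Eventually.of_forall fun ζ => enorm_le_mul_mul (by
      have := norm_cross_le (V ζ) (W (ξ - ζ))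
      push_cast; linarith))
  rwa [lintegral_const_mul' _ _ (by simp)] at h

theorem cross_integral {X : E3 → Fin 3 → ℂ} (hX : ∀ i, Integrable fun ζ => X ζ i)
    (a : Fin 3 → ℂ) (i : Fin 3) :
    (a ⨯₃ (fun i => ∫ ζ, X ζ i)) i = ∫ ζ, (a ⨯₃ X ζ) i := by
  have h : ∀ p q r s : Fin 3, a p * (∫ ζ, X ζ q) - a r * ∫ ζ, X ζ s =
      ∫ ζ, (a p * X ζ q - a r * X ζ s) := fun p q r s => by
    rw [integral_sub ((hX q).const_mul _) ((hX s).const_mul _), integral_const_mul,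
      integral_const_mul]
  fin_cases i <;> exact h _ _ _ _

theorem integrable_cross_const {X : E3 → Fin 3 → ℂ} (hX : ∀ i, Integrable fun ζ => X ζ i)
    (a : Fin 3 → ℂ) (i : Fin 3) : Integrable fun ζ => (a ⨯₃ X ζ) i := by
  have h : ∀ p q r s : Fin 3, Integrable fun ζ => (a p * X ζ q - a r * X ζ s) := fun p q r s =>
    ((hX q).const_mul _).sub ((hX s).const_mul _)
  fin_cases i <;> exact h _ _ _ _

theorem norm_dotProduct_le (a b : Fin 3 → ℂ) : ‖a ⬝ᵥ b‖ ≤ 3 * ‖a‖ * ‖b‖ := by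
  calc _ ≤ ∑ i, ‖a i * b i‖ := norm_sum_le _ _
    _ ≤ ∑ _i : Fin 3, ‖a‖ * ‖b‖ := by
      gcongr with i
      rw [norm_mul]
      gcongr <;> apply norm_le_pi_norm
    _ = _ := by simp; ring

/-- The symbol of the identity for $\operatorname{curl}(v\times w)-(\operatorname{curl}v)\times
w-\nabla(v\cdot w)$, with `z` the frequency of $v$ and `e` that of $w$. The only remaining term
containing `z` is $(z\cdot v)w$, which is the divergence of $v$; all others carry `e`. -/
theorem cross_cross_identity {z e v w : Fin 3 → ℂ} (hzv : z ⬝ᵥ v = 0) :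
    (z + e) ⨯₃ (v ⨯₃ w) - (z ⨯₃ v) ⨯₃ w - (v ⬝ᵥ w) • (z + e) =
      -((v ⬝ᵥ w) • e) + (e ⬝ᵥ w) • v - (e ⬝ᵥ v) • w := by
  have h : (z + e) ⨯₃ (v ⨯₃ w) - (z ⨯₃ v) ⨯₃ w - (v ⬝ᵥ w) • (z + e) =
      -((v ⬝ᵥ w) • e) + (e ⬝ᵥ w) • v - (e ⬝ᵥ v) • w - (z ⬝ᵥ v) • w := by
    funext i
    fin_cases i <;> simp [cross_apply, dotProduct, Fin.sum_univ_three] <;> ring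
  rw [h, hzv, zero_smul, sub_zero]

/-- The cancellation for divergence free `v` with `curl v` and `w` colinear: up to gradients,
the curl of `v × w` loses no derivative of `v`. -/
theorem enorm_leraySym_crossConv_le {V W : E3 → Fin 3 → ℂ} {k m : ℤ}
    (hV : ∀ i, MemLp (fun ξ => V ξ i) 2)
    (hW : ∀ i, MemLp (fun ξ => W ξ i) 2) (hWs : ∀ ξ, ξ ∉ dyadicAnnulus k → W ξ = 0)
    (hdiv : ∀ᵐ ζ, freqVec ζ ⬝ᵥ V ζ = 0)
    (hU : ∀ i, MemLp (fun ζ => (freqVec ζ ⨯₃ V ζ) i) 2)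
    {ξ : E3} (hcol : crossConv (fun ζ => freqVec ζ ⨯₃ V ζ) W ξ = 0) (hξ : ξ ∈ dyadicAnnulus m) :
    ‖leraySym ξ (crossConv V W ξ)‖ₑ ≤ (576 * 2 ^ (k - m) : ℝ≥0) *
      lconv (fun ζ => ‖V ζ‖ₑ) (fun ζ => ‖W ζ‖ₑ) ξ := by
  have hξ0 := ne_zero_of_mem_dyadicAnnulus hξ
  have hadd : ∀ ζ, freqVec ξ = freqVec ζ + freqVec (ξ - ζ) := fun ζ => by
    funext i; simp [freqVec]
  let S : E3 → Fin 3 → ℂ := fun ζ => freqVec ξ ⨯₃ (V ζ ⨯₃ W (ξ - ζ)) -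
    (freqVec ζ ⨯₃ V ζ) ⨯₃ W (ξ - ζ) - (V ζ ⬝ᵥ W (ξ - ζ)) • freqVec ξ
  have hi1 := integrable_cross_const (integrable_cross hV hW ξ) (freqVec ξ)
  have hi2 := integrable_cross hU hW ξ
  have hi3 : Integrable fun ζ => V ζ ⬝ᵥ W (ξ - ζ) :=
    integrable_finsetSum _ fun i _ => memLp_mul_sub (hV i) (hW i) ξ
  -- After integration over $\zeta$, the term with the curl vanishes by `hcol`, and the gradient
  -- becomes a multiple of the frequency, invisible to the Leray symbol.
  have hR : freqVec ξ ⨯₃ crossConv V W ξ =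
      (∫ ζ, V ζ ⬝ᵥ W (ξ - ζ)) • freqVec ξ + fun i => ∫ ζ, S ζ i := by
    funext i
    have e1 := cross_integral (integrable_cross hV hW ξ) (freqVec ξ) i
    have e2 : ∫ ζ, ((freqVec ζ ⨯₃ V ζ) ⨯₃ W (ξ - ζ)) i = 0 := congrFun hcol i
    have e3 : ∫ ζ, S ζ i = (∫ ζ, (freqVec ξ ⨯₃ (V ζ ⨯₃ W (ξ - ζ))) i) -
        (∫ ζ, ((freqVec ζ ⨯₃ V ζ) ⨯₃ W (ξ - ζ)) i) -
        (∫ ζ, V ζ ⬝ᵥ W (ξ - ζ)) * freqVec ξ i := by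
      have hi12 : Integrable fun ζ => (freqVec ξ ⨯₃ (V ζ ⨯₃ W (ξ - ζ))) i -
        ((freqVec ζ ⨯₃ V ζ) ⨯₃ W (ξ - ζ)) i := (hi1 i).sub (hi2 i)
      rw [← integral_mul_const, ← integral_sub (hi1 i) (hi2 i),
        ← integral_sub hi12 (hi3.mul_const _)]
      rfl
    change _ = (∫ ζ, V ζ ⬝ᵥ W (ξ - ζ)) * freqVec ξ i + ∫ ζ, S ζ i
    rw [e3, e2, sub_zero, add_sub_cancel]
    exact e1
  -- Three terms remain, each with a dot product (constant 3) and a frequency of $W$ of size at most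
  -- $2\cdot2^k$, hence 18.
  have hS : ∀ᵐ ζ, ‖S ζ‖ₑ ≤ (18 * 2 ^ k : ℝ≥0) * (‖V ζ‖ₑ * ‖W (ξ - ζ)‖ₑ) := by
    filter_upwards [hdiv] with ζ hζ
    refine enorm_le_mul_mul ?_
    by_cases hη : ξ - ζ ∈ dyadicAnnulus k
    · have e := cross_cross_identity (e := freqVec (ξ - ζ)) (w := W (ξ - ζ)) hζ
      rw [← hadd] at e
      change S ζ = _ at e
      have hn : ‖freqVec (ξ - ζ)‖ ≤ 2 * 2 ^ k := by
        refine (norm_freqVec_le _).trans ?_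
        have h2 := hη.2
        rw [zpow_add_one₀ two_ne_zero] at h2
        have := Real.pi_gt_three
        nlinarith [norm_nonneg (ξ - ζ)]
      rw [e]
      calc _ ≤ ‖(V ζ ⬝ᵥ W (ξ - ζ)) • freqVec (ξ - ζ)‖ +
            ‖(freqVec (ξ - ζ) ⬝ᵥ W (ξ - ζ)) • V ζ‖ + ‖(freqVec (ξ - ζ) ⬝ᵥ V ζ) • W (ξ - ζ)‖ := by
            refine (norm_sub_le _ _).trans (add_le_add_left ((norm_add_le _ _).trans ?_) _)
            rw [norm_neg]
        _ ≤ 3 * ‖V ζ‖ * ‖W (ξ - ζ)‖ * (2 * 2 ^ k) + 3 * (2 * 2 ^ k) * ‖W (ξ - ζ)‖ * ‖V ζ‖ +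
            3 * (2 * 2 ^ k) * ‖V ζ‖ * ‖W (ξ - ζ)‖ := by
            simp only [norm_smul]
            gcongr
            · exact norm_dotProduct_le _ _
            · refine (norm_dotProduct_le _ _).trans ?_
              gcongr
            · refine (norm_dotProduct_le _ _).trans ?_
              gcongr
        _ = _ := by push_cast; ring
    · simp [S, hWs _ hη]
  have h1 := norm_leraySym_le_of_cross hξ0 hR
  have h2 := enorm_integral_pi_le hS
  rw [lintegral_const_mul' _ _ ENNReal.coe_ne_top] at h2
  -- From $2\pi|\xi|\ge2^{m-1}$ and $\pi\le4$ one gets $2|\xi|^{-1}\le32\cdot2^{-m}$. The final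
  -- constant is $576=32\cdot18$.
  have h3 : ‖leraySym ξ (crossConv V W ξ)‖ₑ ≤
      (32 * 2 ^ (-m) : ℝ≥0) * ‖(fun i => ∫ ζ, S ζ i : Fin 3 → ℂ)‖ₑ := by
    simp only [enorm_eq_nnnorm]
    norm_cast
    rw [← NNReal.coe_le_coe]
    push_cast
    refine h1.trans ?_
    gcongr ?_ * _
    have hp := norm_pos_iff.mpr hξ0
    have h4 := hξ.1
    rw [zpow_sub_one₀ two_ne_zero] at h4
    rw [← div_eq_mul_inv, div_le_iff₀ hp, zpow_neg]
    have := Real.pi_le_four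
    have hm : (0 : ℝ) < 2 ^ m := by positivity
    field_simp
    nlinarith
  refine h3.trans ((mul_le_mul_right h2 _).trans_eq ?_)
  rw [← mul_assoc, lconv]
  congr 1
  norm_cast
  rw [sub_eq_add_neg, zpow_add₀ two_ne_zero]
  ring

/-- The constant in the bilinear estimate. -/
def bilinConst : ℝ≥0 := 6000 * annulusConst

theorem eLpNorm_enorm_pi_le {V : E3 → Fin 3 → ℂ} (hV : ∀ i, MemLp (fun ξ => V ξ i) 2) {c : ℝ≥0∞}
    (h : ∀ i, eLpNorm (fun ξ => V ξ i) 2 ≤ c) : eLpNorm (fun ξ => ‖V ξ‖ₑ) 2 volume ≤ 3 * c := by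
  have h2 := eLpNorm_sum_le (s := Finset.univ) (f := fun (i : Fin 3) (x : E3) => ‖V x i‖)
    (fun i _ => (hV i).1.norm) (one_le_two (α := ℝ≥0∞))
  simp only [eLpNorm_norm] at h2
  have h3 : eLpNorm (fun ξ => ‖V ξ‖ₑ) 2 volume ≤ eLpNorm (fun x => ∑ i, ‖V x i‖) 2 := by
    refine eLpNorm_mono_enorm fun x => enorm_pi_le fun i => ?_
    rw [enorm_le_iff_norm_le, Real.norm_of_nonneg (by positivity)]
    exact Finset.single_le_sum (f := fun i => ‖V x i‖) (fun _ _ => norm_nonneg _)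
      (Finset.mem_univ i)
  refine (h3.trans_eq ?_).trans (h2.trans ?_)
  · congr 1 with x
  · calc _ ≤ ∑ _i : Fin 3, c := by gcongr; exact h _
      _ = _ := by simp

/-- The bilinear estimate on the Fourier side. -/
theorem annNorm_leraySym_crossConv_le {V W : E3 → Fin 3 → ℂ} {j k : ℤ} {α β : ℝ≥0∞}
    (hV : ∀ i, MemLp (fun ξ => V ξ i) 2) (hVs : ∀ ξ, ξ ∉ dyadicAnnulus j → V ξ = 0)
    (hW : ∀ i, MemLp (fun ξ => W ξ i) 2) (hWs : ∀ ξ, ξ ∉ dyadicAnnulus k → W ξ = 0)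
    (hVα : ∀ i, eLpNorm (fun ξ => V ξ i) 2 ≤ α) (hWβ : ∀ i, eLpNorm (fun ξ => W ξ i) 2 ≤ β)
    (hdiv : ∀ᵐ ζ, freqVec ζ ⬝ᵥ V ζ = 0)
    (hU : ∀ i, MemLp (fun ζ => (freqVec ζ ⨯₃ V ζ) i) 2)
    (hcol : crossConv (fun ζ => freqVec ζ ⨯₃ V ζ) W =ᵐ[volume] 0) (m : ℤ) :
    annNorm m (fun ξ => leraySym ξ (crossConv V W ξ)) ≤ bilinConst * paraKer m j k * (α * β) := by
  set A : E3 → ℝ≥0∞ := fun ζ => ‖V ζ‖ₑ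
  set B : E3 → ℝ≥0∞ := fun ζ => ‖W ζ‖ₑ
  have hA : AEMeasurable A := (aemeasurable_pi_iff.mpr fun i => (hV i).1.aemeasurable).enorm
  have hB : AEMeasurable B := (aemeasurable_pi_iff.mpr fun i => (hW i).1.aemeasurable).enorm
  have hAs : ∀ ξ, ξ ∉ dyadicAnnulus j → A ξ = 0 := fun ξ h => by simp [A, hVs ξ h]
  have hBs : ∀ ξ, ξ ∉ dyadicAnnulus k → B ξ = 0 := fun ξ h => by simp [B, hWs ξ h]
  have hA2 : eLpNorm A 2 volume ≤ 3 * α := eLpNorm_enorm_pi_le hV hVα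
  have hB2 : eLpNorm B 2 volume ≤ 3 * β := eLpNorm_enorm_pi_le hW hWβ
  -- The factor 8 is 4 for the Leray symbol times 2 for the cross product. This bound uses no
  -- cancellation.
  have hsym : ∀ ξ, ‖leraySym ξ (crossConv V W ξ)‖ₑ ≤ (8 : ℝ≥0) * lconv A B ξ := by
    intro ξ
    have h1 : ‖leraySym ξ (crossConv V W ξ)‖ₑ ≤ (4 : ℝ≥0) * ‖crossConv V W ξ‖ₑ := by
      simp only [enorm_eq_nnnorm]
      exact_mod_cast norm_leraySym_le ξ (crossConv V W ξ)
    refine h1.trans ((mul_le_mul_right (enorm_crossConv_le V W ξ) _).trans_eq ?_)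
    rw [← mul_assoc]
    norm_num
    rfl
  have hzero : ∀ ξ, lconv A B ξ = 0 → leraySym ξ (crossConv V W ξ) = 0 := fun ξ h => by
    simpa [h] using hsym ξ
  unfold paraKer
  split_ifs with h1 h2 h3 h4 h5
  -- Low frequencies of $F$: Young's inequality with Bernstein on the factor of $F$. No derivative
  -- needs to be saved.
  · refine (annNorm_mono_ae (Eventually.of_forall fun ξ _ => hsym ξ)).trans ?_
    calc _ ≤ ((8 : ℝ≥0) : ℝ≥0∞) *
          ((annulusConst * (2 : ℝ≥0∞) ^ ((3 / 2 : ℝ) * j) * (3 * α)) * (3 * β)) := by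
          gcongr
          refine (eLpNorm_lconv_le hA hB).trans ?_
          gcongr
          refine (lintegral_le_of_support hA hAs).trans ?_
          gcongr
      _ = (72 * annulusConst : ℝ≥0) * (2 : ℝ≥0∞) ^ ((3 / 2 : ℝ) * j) * (α * β) := by
          push_cast; ring
      _ ≤ _ := by
          gcongr
          unfold bilinConst
          gcongr
          norm_num
  · refine (annNorm_eq_zero (Eventually.of_forall fun ξ hξ => hzero ξ
      (lconv_eq_zero hAs hBs fun ζ h3 h4 => h2 ?_))).le.trans zero_le
    exact abs_sub_le_of_low h1 hξ h3 h4
  -- Low frequencies of $G$: Bernstein now falls on $G$, and the cancellation supplies the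
  -- additional factor $2^{k-m}$.
  · have hae : ∀ᵐ ξ, ξ ∈ dyadicAnnulus m → ‖leraySym ξ (crossConv V W ξ)‖ₑ ≤
        (576 * 2 ^ (k - m) : ℝ≥0) * lconv A B ξ := by
      filter_upwards [hcol] with ξ hξ hm
      exact enorm_leraySym_crossConv_le hV hW hWs hdiv hU hξ hm
    refine (annNorm_mono_ae hae).trans ?_
    have e : (2 : ℝ≥0∞) ^ ((5 / 2 : ℝ) * k - m) =
        ((2 ^ (k - m) : ℝ≥0) : ℝ≥0∞) * (2 : ℝ≥0∞) ^ ((3 / 2 : ℝ) * k) := by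
      rw [ENNReal.coe_zpow two_ne_zero, ENNReal.coe_ofNat, ← ENNReal.rpow_intCast,
        ← ENNReal.rpow_add _ _ two_ne_zero (by simp)]
      congr 1; push_cast; ring
    calc _ ≤ ((576 * 2 ^ (k - m) : ℝ≥0) : ℝ≥0∞) *
          ((annulusConst * (2 : ℝ≥0∞) ^ ((3 / 2 : ℝ) * k) * (3 * β)) * (3 * α)) := by
          gcongr
          have : lconv A B = lconv B A := funext fun ξ => lconv_comm A B ξ
          rw [this]
          refine (eLpNorm_lconv_le hB hA).trans ?_
          gcongr
          refine (lintegral_le_of_support hB hBs).trans ?_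
          gcongr
      _ = (5184 * annulusConst : ℝ≥0) * (2 : ℝ≥0∞) ^ ((5 / 2 : ℝ) * k - m) * (α * β) := by
          rw [e]; push_cast; ring
      _ ≤ _ := by
          gcongr
          unfold bilinConst
          gcongr
          norm_num
  · refine (annNorm_eq_zero (Eventually.of_forall fun ξ hξ => hzero ξ ?_)).le.trans zero_le
    rw [lconv_comm]
    exact lconv_eq_zero hBs hAs fun ζ h5 h6 => h4 (abs_sub_le_of_low h3 hξ h5 h6)
  -- Comparable frequencies: the output may be of much lower frequency, so Bernstein is applied to
  -- it. The convolution is bounded by Cauchy–Schwarz and integrated over the annulus $m$.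
  · calc _ ≤ annulusConst * (2 : ℝ≥0∞) ^ ((3 / 2 : ℝ) * m) *
          (((8 : ℝ≥0) : ℝ≥0∞) * ((3 * α) * (3 * β))) := by
          refine eLpNorm_indicator_le_of_bound (Eventually.of_forall fun ξ _ => (hsym ξ).trans ?_)
          gcongr
          refine (lconv_le hA hB ξ).trans ?_
          gcongr
      _ = (72 * annulusConst : ℝ≥0) * (2 : ℝ≥0∞) ^ ((3 / 2 : ℝ) * m) * (α * β) := by
          push_cast; ring
      _ ≤ _ := by
          gcongr
          unfold bilinConst
          gcongr
          norm_num
  · refine (annNorm_eq_zero (Eventually.of_forall fun ξ hξ => hzero ξ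
      (lconv_eq_zero hAs hBs fun ζ h6 h7 => h5 ?_))).le.trans zero_le
    exact le_max_add_three hξ h6 h7

theorem annNorm_congr_ae {m : ℤ} {Z Z' : E3 → Fin 3 → ℂ} (h : Z =ᵐ[volume] Z') :
    annNorm m Z = annNorm m Z' := by
  refine eLpNorm_congr_ae ?_
  filter_upwards [h] with ξ hξ
  simp [Set.indicator, hξ]

/-! ### The bilinear estimate for Littlewood–Paley blocks -/

namespace LittlewoodPaley

variable {L : LittlewoodPaley}

theorem memLp_freqVec_cross_blockFT {k : ℤ} {u : VecDist} (h : spaceNorm 2 (L.block k u) < ∞)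
    (i : Fin 3) : MemLp (fun ζ => (freqVec ζ ⨯₃ L.blockFT k u ζ) i) 2 := by
  have hrep := spectralRep_block h
  have h1 : ∀ a b : Fin 3, MemLp (fun ζ : E3 => freqVec ζ a * L.blockFT k u ζ b) 2 := by
    intro a b
    refine MemLp.of_le_mul (c := 2 ^ (k + 1)) (hrep.memLp b) ?_ (Eventually.of_forall fun ξ => ?_)
    · refine AEStronglyMeasurable.mul ?_ (hrep.memLp b).1
      unfold freqVec
      fun_prop
    · by_cases hξ : ξ ∈ dyadicAnnulus k
      · rw [norm_mul]
        gcongr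
        have h0 : ‖freqVec ξ a‖ ≤ ‖ξ‖ := (norm_le_pi_norm _ a).trans (norm_freqVec_le ξ)
        have h2 := hξ.2
        have h3 := Real.pi_gt_three
        nlinarith [norm_nonneg ξ]
      · rw [hrep.supp ξ hξ]; simp
  fin_cases i
  · exact (h1 1 2).sub (h1 2 1)
  · exact (h1 2 0).sub (h1 0 2)
  · exact (h1 0 1).sub (h1 1 0)

theorem fourierVec_cross_block {F G : VecDist} {j k : ℤ} (hF : spaceNorm 2 (L.block j F) < ∞)
    (hG : spaceNorm 2 (L.block k G) < ∞) :
    fourierVec (fun x => L.block j F x ⨯₃ L.block k G x) =ᵐ[volume]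
      crossConv (L.blockFT j F) (L.blockFT k G) :=
  fourierVec_cross (spectralRep_block hF).memLp (spectralRep_block hF).integrable
    (spectralRep_block hG).memLp (spectralRep_block hG).integrable
    (fun i x => (spectralRep_block hF).apply x i) (fun i x => (spectralRep_block hG).apply x i)

/-- Colinearity makes $\operatorname{curl}\Delta_jF\times\Delta_kG$ vanish at every point $x$; the
convolution is, up to a constant, its Fourier transform. -/
theorem crossConv_curl_block {F G : VecDist} (hcol : RadiallyColinear F G) {j k : ℤ}
    (hF : spaceNorm 2 (L.block j F) < ∞) (hG : spaceNorm 2 (L.block k G) < ∞) :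
    crossConv (fun ζ => freqVec ζ ⨯₃ L.blockFT j F ζ) (L.blockFT k G) =ᵐ[volume] 0 := by
  have hU := memLp_freqVec_cross_blockFT hF
  have hU1 : ∀ i, Integrable fun ζ => (freqVec ζ ⨯₃ L.blockFT j F ζ) i := fun i =>
    integrable_of_memLp_of_support (hU i) fun ξ hξ => by
      rw [(spectralRep_block hF).supp ξ hξ]; simp
  have hcurl : ∀ i x, conv (L.ker j) (curl F) x i =
      2 * Real.pi * Complex.I * 𝓕⁻ (fun ζ => (freqVec ζ ⨯₃ L.blockFT j F ζ) i) x := by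
    intro i x
    rw [conv_ker_curl hF, Real.fourierInv_eq, Real.fourierInv_eq, ← integral_const_mul]
    congr 1
    ext ζ
    simp only [Circle.smul_def, smul_eq_mul]
    ring
  refine (fourierVec_cross (v := fun x i => 𝓕⁻ (fun ζ => (freqVec ζ ⨯₃ L.blockFT j F ζ) i) x)
    (w := L.block k G) hU hU1 (spectralRep_block hG).memLp (spectralRep_block hG).integrable
    (fun _ _ => rfl) (fun i x => (spectralRep_block hG).apply x i)).symm.trans ?_
  have hz : ∀ x, (fun i => 𝓕⁻ (fun ζ => (freqVec ζ ⨯₃ L.blockFT j F ζ) i) x) ⨯₃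
      L.block k G x = 0 := by
    intro x
    have h := cross_eq_zero_of_radiallyColinear (L := L) hcol j k x
    have e : conv (L.ker j) (curl F) x = (2 * Real.pi * Complex.I : ℂ) •
        fun i => 𝓕⁻ (fun ζ => (freqVec ζ ⨯₃ L.blockFT j F ζ) i) x := funext fun i => hcurl i x
    rw [e, map_smul, LinearMap.smul_apply] at h
    exact (smul_eq_zero.mp h).resolve_left (by simp [Real.pi_ne_zero])
  have h0 : fourierL2 (fun _ => 0) =ᵐ[volume] 0 :=
    (ae_eq_fourierL2 MemLp.zero' (integrable_zero E3 ℂ volume).locallyIntegrable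
      fun φ => by simp).symm
  filter_upwards [h0] with ξ hξ
  funext i
  simpa [fourierVec, hz] using hξ

/-- The bilinear estimate for the Leray projection of the cross product of two
Littlewood--Paley blocks. -/
theorem annNorm_lerayFT_block_le {F G : VecDist} (hdiv : DivFree F) (hcol : RadiallyColinear F G)
    {j k : ℤ} (hF : spaceNorm 2 (L.block j F) < ∞) (hG : spaceNorm 2 (L.block k G) < ∞) (m : ℤ) :
    annNorm m (lerayFT fun x => L.block j F x ⨯₃ L.block k G x) ≤
      bilinConst * paraKer m j k * (spaceNorm 2 (L.block j F) * spaceNorm 2 (L.block k G)) := by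
  have h1 : lerayFT (fun x => L.block j F x ⨯₃ L.block k G x) =ᵐ[volume]
      fun ξ => leraySym ξ (crossConv (L.blockFT j F) (L.blockFT k G) ξ) := by
    filter_upwards [fourierVec_cross_block hF hG] with ξ hξ
    rw [lerayFT, hξ]
  rw [annNorm_congr_ae h1]
  exact annNorm_leraySym_crossConv_le (spectralRep_block hF).memLp (spectralRep_block hF).supp
    (spectralRep_block hG).memLp (spectralRep_block hG).supp (spectralRep_block hF).norm_le
    (spectralRep_block hG).norm_le (blockFT_orthogonal hF hdiv) (memLp_freqVec_cross_blockFT hF)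
    (crossConv_curl_block hcol hF hG) m

end LittlewoodPaley


/-! ### The product with a bounded field -/

theorem leraySym_sum {ι : Type*} (s : Finset ι) (ξ : E3) (X : ι → Fin 3 → ℂ) :
    leraySym ξ (∑ j ∈ s, X j) = ∑ j ∈ s, leraySym ξ (X j) := by
  simp only [leraySym, map_sum, Finset.smul_sum, Finset.sum_neg_distrib]

theorem aemeasurable_cross {X Y : E3 → Fin 3 → ℂ} (hX : AEMeasurable X) (hY : AEMeasurable Y) :
    AEMeasurable fun ξ => X ξ ⨯₃ Y ξ := by
  have h : ∀ p q r s : Fin 3, AEMeasurable fun ξ => X ξ p * Y ξ q - X ξ r * Y ξ s := fun p q r s =>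
    ((aemeasurable_pi_iff.mp hX p).mul (aemeasurable_pi_iff.mp hY q)).sub
      ((aemeasurable_pi_iff.mp hX r).mul (aemeasurable_pi_iff.mp hY s))
  refine aemeasurable_pi_iff.mpr fun i => ?_
  fin_cases i <;> exact h _ _ _ _

theorem continuous_freqVec : Continuous freqVec := by
  unfold freqVec
  fun_prop

theorem aemeasurable_leraySym {X : E3 → Fin 3 → ℂ} (hX : AEMeasurable X) :
    AEMeasurable fun ξ => leraySym ξ (X ξ) := by
  have h1 := continuous_freqVec.aemeasurable (μ := volume)
  have h2 : AEMeasurable (fun ξ : E3 => (((‖ξ‖ ^ 2)⁻¹ : ℝ) : ℂ)) volume := by fun_prop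
  exact (h2.smul (aemeasurable_cross h1 (aemeasurable_cross h1 hX))).neg

theorem aemeasurable_fourierVec (y : E3 → Fin 3 → ℂ) : AEMeasurable (fourierVec y) :=
  aemeasurable_pi_iff.mpr fun _ => (memLp_fourierL2 _).1.aemeasurable

theorem aemeasurable_lerayFT (y : E3 → Fin 3 → ℂ) : AEMeasurable (lerayFT y) :=
  aemeasurable_leraySym (aemeasurable_fourierVec y)

theorem annNorm_sum_le {ι : Type*} (s : Finset ι) (m : ℤ) {Z : ι → E3 → Fin 3 → ℂ}
    (hZ : ∀ j, AEMeasurable (Z j)) :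
    annNorm m (fun ξ => ∑ j ∈ s, Z j ξ) ≤ ∑ j ∈ s, annNorm m (Z j) := by
  have h := eLpNorm_sum_le (s := s) (f := fun j => (dyadicAnnulus m).indicator (Z j))
    (μ := volume) (p := 2)
    (fun j _ => ((hZ j).indicator (measurableSet_dyadicAnnulus m)).aestronglyMeasurable)
    one_le_two
  refine le_trans (le_of_eq ?_) h
  unfold annNorm
  congr 1
  ext ξ : 1
  by_cases hm : ξ ∈ dyadicAnnulus m <;> simp [hm]

theorem annNorm_lerayFT_le {y : E3 → Fin 3 → ℂ} (hy : ∀ i, MemLp (fun x => y x i) 2) {c : ℝ≥0∞}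
    (hc : ∀ i, eLpNorm (fun x => y x i) 2 ≤ c) (m : ℤ) : annNorm m (lerayFT y) ≤ 12 * c := by
  have h1 : annNorm m (lerayFT y) ≤ (4 : ℝ≥0) * eLpNorm (fun ξ => ‖fourierVec y ξ‖ₑ) 2 volume := by
    refine annNorm_mono_ae (Eventually.of_forall fun ξ _ => ?_)
    simp only [enorm_eq_nnnorm]
    exact_mod_cast norm_leraySym_le ξ (fourierVec y ξ)
  refine h1.trans ?_
  have h2 := eLpNorm_enorm_pi_le (V := fourierVec y) (c := c) (fun i => memLp_fourierL2 _)
    fun i => (eLpNorm_fourierL2 (hy i)).trans_le (hc i)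
  calc _ ≤ ((4 : ℝ≥0) : ℝ≥0∞) * (3 * c) := by gcongr
    _ = _ := by rw [← mul_assoc]; norm_num

/-- The kernel of the estimate for the product with a bounded field: the bound for the annulus
`m` and the block `k`. -/
def bddKer (m k : ℤ) : ℝ≥0∞ :=
  if |m - k| ≤ 7 then 1 else if k ≤ m then (2 : ℝ≥0∞) ^ ((5 / 2 : ℝ) * (k - m))
    else (2 : ℝ≥0∞) ^ ((3 / 2 : ℝ) * (m - k))

/-- The open neighbourhood `2^{m-2} < 2π|ξ| < 2^{m+2}` of a dyadic annulus. -/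
def fatAnnulus (m : ℤ) : Set E3 :=
  {ξ | (2 : ℝ) ^ (m - 2) < 2 * Real.pi * ‖ξ‖ ∧ 2 * Real.pi * ‖ξ‖ < (2 : ℝ) ^ (m + 2)}

theorem isOpen_fatAnnulus (m : ℤ) : IsOpen (fatAnnulus m) :=
  (isOpen_lt (f := fun _ : E3 => (2 : ℝ) ^ (m - 2)) (g := fun ξ => 2 * Real.pi * ‖ξ‖)
    (by fun_prop) (by fun_prop)).inter
  (isOpen_lt (f := fun ξ : E3 => 2 * Real.pi * ‖ξ‖) (g := fun _ => (2 : ℝ) ^ (m + 2))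
    (by fun_prop) (by fun_prop))

theorem dyadicAnnulus_subset_fatAnnulus (m : ℤ) : dyadicAnnulus m ⊆ fatAnnulus m := fun ξ h =>
  ⟨lt_of_lt_of_le (zpow_lt_zpow_right₀ one_lt_two (by omega)) h.1,
    lt_of_le_of_lt h.2 (zpow_lt_zpow_right₀ one_lt_two (by omega))⟩

/-- When `m` and `k` are at least eight octaves apart, the larger frequency dominates the
difference. This locates the frequencies of the bounded field that can send annulus `k` to annulus
`m`. -/
theorem bounds_of_separated {m k : ℤ} (hmk : 8 ≤ |m - k|) {η σ : E3} (hη : η ∈ dyadicAnnulus k)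
    (hσ : σ ∈ fatAnnulus m) : (2 : ℝ) ^ (max m k - 3) ≤ 2 * Real.pi * ‖η - σ‖ ∧
      2 * Real.pi * ‖η - σ‖ ≤ (2 : ℝ) ^ (max m k + 3) := by
  have hpi := Real.pi_pos
  have t1 : ‖η - σ‖ ≤ ‖η‖ + ‖σ‖ := norm_sub_le _ _
  have t2 : ‖η‖ ≤ ‖η - σ‖ + ‖σ‖ := by simpa using norm_add_le (η - σ) σ
  have t3 : ‖σ‖ ≤ ‖η‖ + ‖η - σ‖ := by simpa using norm_sub_le η (η - σ)
  have e : ∀ n i : ℤ, (2 : ℝ) ^ (n + i) = 2 ^ n * 2 ^ i := fun n i => zpow_add₀ two_ne_zero n i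
  obtain ⟨h1, h2⟩ := hη
  obtain ⟨h3, h4⟩ := hσ
  rcases le_total m k with h | h
  · rw [max_eq_right h]
    rw [abs_of_nonpos (by omega)] at hmk
    have h5 : (2 : ℝ) ^ (m + 2) ≤ 2 ^ (k - 3) := zpow_le_zpow_right₀ one_le_two (by omega)
    have hp : (0 : ℝ) < 2 ^ k := by positivity
    simp only [sub_eq_add_neg, e] at *
    norm_num at *
    constructor <;> nlinarith
  · rw [max_eq_left h]
    rw [abs_of_nonneg (by omega)] at hmk
    have h5 : (2 : ℝ) ^ (k + 1) ≤ 2 ^ (m - 7) := zpow_le_zpow_right₀ one_le_two (by omega)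
    have hp : (0 : ℝ) < 2 ^ m := by positivity
    simp only [sub_eq_add_neg, e] at *
    norm_num at *
    constructor <;> nlinarith

namespace LittlewoodPaley

variable {L : LittlewoodPaley}

theorem ker_sub_comm (k : ℤ) (x y : E3) : L.ker k (x - y) = L.ker k (y - x) :=
  L.isRadial_ker k _ _ (norm_sub_rev x y)

theorem block_eq_integral {f : E3 → Fin 3 → ℂ} {F : VecDist} (h : Represents f F) (k : ℤ) (x : E3)
    (i : Fin 3) : L.block k F x i = ∫ y, f y i * L.ker k (y - x) := by
  rw [block_apply, h i _ (L.isS0_reflectAt_ker k x)]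
  simp only [reflectAt_apply, ker_sub_comm k x]

/-- Fubini's theorem, justified by the boundedness of `f` and the integrability of `θ` and of the
kernel. The localization is moved to `θ`, since `f` has no Fourier transform as a function. -/
theorem integral_block_mul {f : E3 → Fin 3 → ℂ} {F : VecDist} (h : Represents f F) {a : Fin 3}
    (hf : AEStronglyMeasurable (fun x => f x a)) {M : ℝ} (hM : ∀ᵐ x, ‖f x a‖ ≤ M) (k : ℤ)
    {θ : E3 → ℂ} (hθ : Integrable θ) :
    ∫ x, L.block k F x a * θ x = ∫ y, f y a * ∫ x, L.ker k (y - x) * θ x := by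
  have hint : Integrable (fun p : E3 × E3 => f p.1 a * (L.ker k (p.1 - p.2) * θ p.2))
      (volume.prod volume) := by
    have h1 := hθ.convolution_integrand (ContinuousLinearMap.mul ℂ ℂ)
      ((L.ker k).integrable (μ := volume))
    refine Integrable.bdd_mul (c := M) ?_ ?_ ?_
    · refine h1.congr (Eventually.of_forall fun p => ?_)
      simp [mul_comm]
    · exact hf.comp_quasiMeasurePreserving Measure.quasiMeasurePreserving_fst
    · exact Measure.quasiMeasurePreserving_fst.ae hM
  have h2 := integral_integral_swap
    (f := fun y x => f y a * (L.ker k (y - x) * θ x)) hint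
  simp only [integral_const_mul] at h2
  rw [h2]
  congr 1
  ext x
  rw [block_eq_integral h, ← integral_mul_const]
  simp only [mul_assoc]

/-- A field with frequencies where finitely many Littlewood--Paley multipliers sum up to one
is reproduced by the sum of the kernels. -/
theorem sum_integral_ker_mul_fourierInv {J : Finset ℤ} {S : E3 → ℂ} (hS : Integrable S)
    (hJ : ∀ τ, S τ ≠ 0 → ∑ j ∈ J, 𝓕 (L.ker j) τ = 1) (y : E3) :
    ∑ j ∈ J, ∫ x, L.ker j (y - x) * 𝓕⁻ S x = 𝓕⁻ S y := by
  have h1 : ∀ j, ∫ x, L.ker j (y - x) * 𝓕⁻ S x =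
      ∫ τ, S τ * ((Real.fourierChar (inner ℝ y τ) : ℂ) * 𝓕 (L.ker j) τ) := by
    intro j
    have h := integral_fourierInv_mul hS ((reflectAt (L.ker j) y).integrable (μ := volume))
    simp only [← SchwartzMap.fourierInv_coe, fourierInv_reflectAt, reflectAt_apply] at h
    rw [← h]
    simp only [mul_comm]
  have h2 : ∀ j ∈ J, Integrable fun τ =>
      S τ * ((Real.fourierChar (inner ℝ y τ) : ℂ) * 𝓕 (L.ker j) τ) := by
    intro j _
    refine hS.mul_bdd (c := L.multBound) ?_ (Eventually.of_forall fun τ => ?_)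
    · refine Continuous.aestronglyMeasurable ?_
      have : Continuous (Real.fourierChar : ℝ → Circle) := Real.continuous_fourierChar
      have h3 := (𝓕 (L.ker j) : 𝓢(E3, ℂ)).continuous
      fun_prop
    · rw [norm_mul, Circle.norm_coe, one_mul]
      exact L.norm_fourier_ker_le j τ
  simp only [h1]
  rw [← integral_finsetSum _ h2, Real.fourierInv_eq]
  congr 1
  ext τ
  rw [← Finset.mul_sum, ← Finset.mul_sum, Circle.smul_def, smul_eq_mul, real_inner_comm]
  by_cases hτ : S τ = 0
  · simp [hτ]
  · rw [hJ τ hτ]; ring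

/-- On annulus `m`, the product with a field of frequencies in annulus `k` only sees those
frequencies of `f` that are, up to sign, differences $\eta-\sigma$. The proof is by duality: tested
against `g` supported near annulus `m`, the product becomes the integral of `f` against the inverse
transform of $S=W*g(-\,\cdot)$, and the multipliers in `J` sum to one wherever `S` is nonzero. -/
theorem fourierL2_mul_eq_sum {f : E3 → Fin 3 → ℂ} {F : VecDist} (h : Represents f F) {a : Fin 3}
    (hf : AEStronglyMeasurable (fun x => f x a)) {M : ℝ} (hM : ∀ᵐ x, ‖f x a‖ ≤ M)
    {W : E3 → ℂ} {k : ℤ} (hW : MemLp W 2) (hW1 : Integrable W)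
    (hWs : ∀ ξ, ξ ∉ dyadicAnnulus k → W ξ = 0) {J : Finset ℤ}
    (hF : ∀ j ∈ J, MemLp (fun x => L.block j F x a * 𝓕⁻ W x) 2) {m : ℤ}
    (hJ : ∀ η σ, η ∈ dyadicAnnulus k → σ ∈ fatAnnulus m →
      ∑ j ∈ J, 𝓕 (L.ker j) (η - σ) = 1) :
    ∀ᵐ ξ, ξ ∈ dyadicAnnulus m → fourierL2 (fun x => f x a * 𝓕⁻ W x) ξ =
      ∑ j ∈ J, fourierL2 (fun x => L.block j F x a * 𝓕⁻ W x) ξ := by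
  have hfW : MemLp (fun x => f x a * 𝓕⁻ W x) 2 :=
    MemLp.of_le_mul (c := M) (memLp_fourierInv hW hW1)
      (hf.mul (continuous_fourierInv_of_integrable hW1).aestronglyMeasurable) (by
        filter_upwards [hM] with x hx
        rw [norm_mul]
        gcongr)
  have hsum : LocallyIntegrable fun ξ => ∑ j ∈ J, fourierL2 (fun x => L.block j F x a * 𝓕⁻ W x) ξ :=
    (memLp_finsetSum J fun j _ => memLp_fourierL2 fun x =>
      L.block j F x a * 𝓕⁻ W x).locallyIntegrable_two
  refine (ae_eq_on_of_integral_mul_schwartz (isOpen_fatAnnulus m)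
    (memLp_fourierL2 _).locallyIntegrable_two hsum fun g hg _ => ?_).mono fun ξ h hξ =>
      h (dyadicAnnulus_subset_fatAnnulus m hξ)
  set b : E3 → ℂ := fun σ => g (-σ)
  have hb : Integrable b := g.integrable.comp_neg
  set S := convolution W b (ContinuousLinearMap.mul ℂ ℂ) volume
  have hS : Integrable S := hW1.integrable_convolution (ContinuousLinearMap.mul ℂ ℂ) hb
  have hSinv : ∀ x, 𝓕⁻ S x = 𝓕⁻ W x * (𝓕 g : 𝓢(E3, ℂ)) x := fun x => by
    rw [fourierInv_convolution hW1 hb, SchwartzMap.fourier_coe,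
      Real.fourierInv_eq_fourier_comp_neg b]
    simp only [b, neg_neg]
  have hSs : ∀ τ, S τ ≠ 0 → ∑ j ∈ J, 𝓕 (L.ker j) τ = 1 := by
    intro τ hτ
    by_contra hne
    apply hτ
    have : ∀ η, W η * b (τ - η) = 0 := by
      intro η
      by_cases h1 : η ∈ dyadicAnnulus k
      · by_cases h2 : η - τ ∈ fatAnnulus m
        · exact absurd (by simpa using hJ η (η - τ) h1 h2) hne
        · have : g (η - τ) = 0 := by
            by_contra h3
            exact h2 (hg (subset_tsupport _ h3))
          simp [b, this]
      · rw [hWs _ h1, zero_mul]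
    simp [S, convolution, this]
  have hθ : Integrable (𝓕⁻ S) := by
    have : 𝓕⁻ S = fun x => 𝓕⁻ W x * (𝓕 g : 𝓢(E3, ℂ)) x := funext hSinv
    rw [this]
    exact (memLp_fourierInv hW hW1).integrable_mul ((𝓕 g).memLp 2 volume)
  have hterm : ∀ j ∈ J, ∫ x, fourierL2 (fun x => L.block j F x a * 𝓕⁻ W x) x * g x =
      ∫ y, f y a * ∫ x, L.ker j (y - x) * 𝓕⁻ S x := by
    intro j hj
    rw [integral_fourierL2_mul_schwartz (hF j hj), ← integral_block_mul h hf hM j hθ]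
    simp only [hSinv, mul_assoc]
  have hint : ∀ j ∈ J, Integrable fun x =>
      fourierL2 (fun x => L.block j F x a * 𝓕⁻ W x) x * g x := fun j _ =>
    (memLp_fourierL2 _).integrable_mul (g.memLp 2 volume)
  have hint2 : ∀ j ∈ J, Integrable fun y => f y a * ∫ x, L.ker j (y - x) * 𝓕⁻ S x := by
    intro j _
    have h1 := hθ.integrable_convolution (ContinuousLinearMap.mul ℂ ℂ)
      ((L.ker j).integrable (μ := volume))
    refine Integrable.bdd_mul (c := M) (h1.congr (Eventually.of_forall fun y => ?_)) hf hM
    simp [convolution, mul_comm]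
  simp only [Finset.sum_mul]
  rw [integral_finsetSum _ hint, Finset.sum_congr rfl hterm, ← integral_finsetSum _ hint2,
    integral_fourierL2_mul_schwartz hfW]
  congr 1
  ext y
  rw [← Finset.mul_sum, sum_integral_ker_mul_fourierInv hS hSs, hSinv, mul_assoc]

theorem sum_fourier_ker_sub_eq_one {m k : ℤ} (hmk : 8 ≤ |m - k|) {η σ : E3}
    (hη : η ∈ dyadicAnnulus k) (hσ : σ ∈ fatAnnulus m) :
    ∑ j ∈ Finset.Icc (max m k - 4) (max m k + 4), 𝓕 (L.ker j) (η - σ) = 1 := by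
  obtain ⟨h1, h2⟩ := bounds_of_separated hmk hη hσ
  have := L.sum_fourier_ker_eq_one h1 h2
  rwa [show max m k - 3 - 1 = max m k - 4 by ring, show max m k + 3 + 1 = max m k + 4 by ring] at this

theorem fourierVec_cross_eq_sum {f : E3 → Fin 3 → ℂ} {F G : VecDist} (h : Represents f F)
    (hf : ∀ a, AEStronglyMeasurable (fun x => f x a)) {M : ℝ} (hM : ∀ a, ∀ᵐ x, ‖f x a‖ ≤ M)
    (hF : ∀ j, spaceNorm 2 (L.block j F) < ∞) {k : ℤ} (hG : spaceNorm 2 (L.block k G) < ∞)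
    {m : ℤ} (hmk : 8 ≤ |m - k|) :
    ∀ᵐ ξ, ξ ∈ dyadicAnnulus m → fourierVec (fun x => f x ⨯₃ L.block k G x) ξ =
      ∑ j ∈ Finset.Icc (max m k - 4) (max m k + 4),
        fourierVec (fun x => L.block j F x ⨯₃ L.block k G x) ξ := by
  have hW := spectralRep_block hG
  have hmul : ∀ j a b, MemLp (fun x => L.block j F x a * L.block k G x b) 2 := by
    intro j a b
    simp only [(spectralRep_block (hF j)).apply, hW.apply]
    exact memLp_fourierInv_mul ((spectralRep_block (hF j)).integrable a) (hW.memLp b)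
      (hW.integrable b)
  have hfmul : ∀ a b, MemLp (fun x => f x a * L.block k G x b) 2 := fun a b =>
    MemLp.of_le_mul (c := M) (hW.memLp_left b) ((hf a).mul (hW.memLp_left b).1) (by
      filter_upwards [hM a] with x hx
      rw [norm_mul]
      gcongr)
  have hscal : ∀ a b, ∀ᵐ ξ, ξ ∈ dyadicAnnulus m →
      fourierL2 (fun x => f x a * L.block k G x b) ξ =
        ∑ j ∈ Finset.Icc (max m k - 4) (max m k + 4),
          fourierL2 (fun x => L.block j F x a * L.block k G x b) ξ := by
    intro a b
    have := fourierL2_mul_eq_sum (L := L) h (hf a) (hM a) (hW.memLp b) (hW.integrable b)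
      (fun ξ hξ => by rw [hW.supp ξ hξ]; rfl)
      (J := Finset.Icc (max m k - 4) (max m k + 4)) (fun j _ => ?_)
      fun η σ hη hσ => sum_fourier_ker_sub_eq_one (L := L) hmk hη hσ
    · simpa only [← hW.eq] using this
    · simpa only [← hW.apply] using hmul j a b
  have hkey : ∀ a b c d, ∀ᵐ ξ, ξ ∈ dyadicAnnulus m →
      fourierL2 (fun x => f x a * L.block k G x b - f x c * L.block k G x d) ξ =
        ∑ j ∈ Finset.Icc (max m k - 4) (max m k + 4),
          fourierL2 (fun x => L.block j F x a * L.block k G x b -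
            L.block j F x c * L.block k G x d) ξ := by
    intro a b c d
    have h1 : ∀ᵐ ξ, ∀ j, fourierL2 (fun x => L.block j F x a * L.block k G x b -
        L.block j F x c * L.block k G x d) ξ =
        fourierL2 (fun x => L.block j F x a * L.block k G x b) ξ -
        fourierL2 (fun x => L.block j F x c * L.block k G x d) ξ :=
      ae_all_iff.mpr fun j => fourierL2_sub (hmul j a b) (hmul j c d)
    filter_upwards [h1, hscal a b, hscal c d, fourierL2_sub (hfmul a b) (hfmul c d)]
      with ξ h1 h2 h3 h4 hm
    rw [h4, h2 hm, h3 hm, ← Finset.sum_sub_distrib]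
    exact Finset.sum_congr rfl fun j _ => (h1 j).symm
  filter_upwards [hkey 1 2 2 1, hkey 2 0 0 2, hkey 0 1 1 0] with ξ h0 h1 h2 hm
  funext i
  rw [Finset.sum_apply]
  fin_cases i
  · exact h0 hm
  · exact h1 hm
  · exact h2 hm

/-- If $k\le m-8$ then $j\ge m-4\ge k+4$, so only the regime with cancellation occurs. If $m\le
k-8$, the two separated regimes contribute nothing and only the resonant one is left. Replacing
$2^{-3j/2}$ by $2^{-3\max(m,k)/2}$ costs at most $2^{4\cdot3/2}=64$. -/
theorem paraKer_mul_le {m j k : ℤ} (hmk : 8 ≤ |m - k|)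
    (hj : j ∈ Finset.Icc (max m k - 4) (max m k + 4)) {x α : ℝ≥0∞}
    (hx : (2 : ℝ≥0∞) ^ ((j : ℝ) * (3 / 2)) * x ≤ α) :
    paraKer m j k * x ≤ 64 * bddKer m k * α := by
  rw [Finset.mem_Icc] at hj
  have hx' : x ≤ (2 : ℝ≥0∞) ^ (-((j : ℝ) * (3 / 2))) * α := by
    calc x = (2 : ℝ≥0∞) ^ (-((j : ℝ) * (3 / 2))) * ((2 : ℝ≥0∞) ^ ((j : ℝ) * (3 / 2)) * x) := by
          rw [← mul_assoc, ← ENNReal.rpow_add _ _ two_ne_zero (by simp)]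
          simp
      _ ≤ _ := by gcongr
  have key : ∀ p q : ℝ, p - (j : ℝ) * (3 / 2) ≤ 6 + q →
      (2 : ℝ≥0∞) ^ p * x ≤ 64 * (2 : ℝ≥0∞) ^ q * α := by
    intro p q hpq
    calc (2 : ℝ≥0∞) ^ p * x ≤ (2 : ℝ≥0∞) ^ p * ((2 : ℝ≥0∞) ^ (-((j : ℝ) * (3 / 2))) * α) := by
          gcongr
      _ = (2 : ℝ≥0∞) ^ (p - (j : ℝ) * (3 / 2)) * α := by
          rw [← mul_assoc, ← ENNReal.rpow_add _ _ two_ne_zero (by simp), sub_eq_add_neg]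
      _ ≤ (2 : ℝ≥0∞) ^ (6 + q) * α := by
          gcongr
          norm_num
      _ = _ := by
          rw [ENNReal.rpow_add _ _ two_ne_zero (by simp)]
          norm_num
  have h7 : ¬ |m - k| ≤ 7 := by omega
  rcases le_total k m with h | h
  · rw [max_eq_left h] at hj
    rw [abs_of_nonneg (by omega)] at hmk
    have e1 : ¬ j + 4 ≤ k := by omega
    have e2 : k + 4 ≤ j := by omega
    rw [paraKer, if_neg e1, if_pos e2, bddKer, if_neg h7, if_pos h]
    split_ifs
    · apply key
      have : (m : ℝ) - 4 ≤ j := by exact_mod_cast hj.1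
      linarith
    · simp
  · rw [max_eq_right h] at hj
    rw [abs_of_nonpos (by omega)] at hmk
    have e3 : ¬ k ≤ m := by omega
    have e4 : ¬ |m - k| ≤ 3 := by omega
    rw [paraKer, bddKer, if_neg h7, if_neg e3, if_neg e4]
    split_ifs with h1 h2 h3
    · simp
    · rw [abs_le] at h3; omega
    · simp
    · apply key
      have : (k : ℝ) - 4 ≤ j := by exact_mod_cast hj.1
      linarith
    · simp

/-- The constant in the estimate for the product with a bounded field. -/
def bddConst : ℝ≥0 := 24 + 576 * bilinConst

/-- The estimate for the Leray projection of the cross product of a bounded field and of a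
Littlewood--Paley block. -/
theorem annNorm_lerayFT_bdd_le {f : E3 → Fin 3 → ℂ} {F G : VecDist} (hdiv : DivFree F)
    (hcol : RadiallyColinear F G) (h : Represents f F) (hf : AEStronglyMeasurable f)
    (hM : spaceNorm ∞ f < ∞) (hF : ∀ j, spaceNorm 2 (L.block j F) < ∞)
    {k : ℤ} (hG : spaceNorm 2 (L.block k G) < ∞) (m : ℤ) {α : ℝ≥0∞}
    (hα : ∀ j ∈ Finset.Icc (max m k - 4) (max m k + 4),
      (2 : ℝ≥0∞) ^ ((j : ℝ) * (3 / 2)) * spaceNorm 2 (L.block j F) ≤ α) :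
    annNorm m (lerayFT fun x => f x ⨯₃ L.block k G x) ≤
      bddConst * bddKer m k * ((spaceNorm ∞ f + α) * spaceNorm 2 (L.block k G)) := by
  have hfa : ∀ a, AEStronglyMeasurable (fun x => f x a) := fun a =>
    (continuous_apply a).comp_aestronglyMeasurable hf
  have hW := spectralRep_block hG
  by_cases hmk : |m - k| ≤ 7
  -- Near the diagonal Hölder's inequality and the boundedness of the Leray symbol suffice; the
  -- constant is $24=12\cdot2$.
  · have hmul : ∀ a b, eLpNorm (fun x => f x a * L.block k G x b) 2 ≤
        spaceNorm ∞ f * spaceNorm 2 (L.block k G) := fun a b =>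
      (eLpNorm_smul_le_eLpNorm_top_mul_eLpNorm 2 (hW.memLp_left b).1 fun x => f x a).trans
        (mul_le_mul' (eLpNorm_apply_le_spaceNorm ∞ f a) (eLpNorm_apply_le_spaceNorm 2 _ b))
    have hmem : ∀ a b, MemLp (fun x => f x a * L.block k G x b) 2 := fun a b =>
      ⟨(hfa a).mul (hW.memLp_left b).1, (hmul a b).trans_lt (ENNReal.mul_lt_top hM hG)⟩
    have hsub : ∀ a b c d, eLpNorm (fun x => f x a * L.block k G x b - f x c * L.block k G x d) 2 ≤
        2 * (spaceNorm ∞ f * spaceNorm 2 (L.block k G)) := fun a b c d => by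
      refine (eLpNorm_sub_le (hmem a b).1 (hmem c d).1 one_le_two).trans ?_
      rw [two_mul]
      exact add_le_add (hmul a b) (hmul c d)
    refine (annNorm_lerayFT_le (memLp_cross hmem)
      (c := 2 * (spaceNorm ∞ f * spaceNorm 2 (L.block k G))) (fun i => ?_) m).trans ?_
    · fin_cases i <;> exact hsub _ _ _ _
    · rw [bddKer, if_pos hmk, mul_one, ← mul_assoc]
      gcongr
      · unfold bddConst
        push_cast
        norm_num
      · exact le_self_add
  · have hmk' : 8 ≤ |m - k| := by omega
    have hMa : ∀ a, ∀ᵐ x, ‖f x a‖ ≤ (spaceNorm ∞ f).toReal := by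
      intro a
      have h1 := eLpNorm_apply_le_spaceNorm ∞ f a
      rw [eLpNorm_exponent_top] at h1
      filter_upwards [ae_le_eLpNormEssSup (f := fun x => f x a) (μ := volume)] with x hx
      have h2 := hx.trans h1
      rw [← toReal_enorm]
      exact ENNReal.toReal_mono hM.ne h2
    have hsum : annNorm m (lerayFT fun x => f x ⨯₃ L.block k G x) ≤
        annNorm m (fun ξ => ∑ j ∈ Finset.Icc (max m k - 4) (max m k + 4),
          lerayFT (fun x => L.block j F x ⨯₃ L.block k G x) ξ) := by
      refine le_of_eq (eLpNorm_congr_ae ?_)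
      filter_upwards [fourierVec_cross_eq_sum h hfa hMa hF hG hmk'] with ξ hξ
      by_cases hm : ξ ∈ dyadicAnnulus m
      · simp only [hm, Set.indicator_of_mem, lerayFT]
        rw [hξ hm, leraySym_sum]
      · simp [hm]
    refine hsum.trans ((annNorm_sum_le _ m fun j => aemeasurable_lerayFT _).trans ?_)
    -- Nine blocks of `F`, each with the factor 64, give $576$.
    calc _ ≤ ∑ j ∈ Finset.Icc (max m k - 4) (max m k + 4),
          bilinConst * (64 * bddKer m k * α) * spaceNorm 2 (L.block k G) := by
          refine Finset.sum_le_sum fun j hj => ?_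
          refine (annNorm_lerayFT_block_le hdiv hcol (hF j) hG m).trans ?_
          rw [← mul_assoc, mul_assoc (bilinConst : ℝ≥0∞)]
          exact mul_le_mul_left (mul_le_mul_right (paraKer_mul_le hmk' hj (hα j hj)) _) _
      _ = ((576 * bilinConst : ℝ≥0) : ℝ≥0∞) * bddKer m k * (α * spaceNorm 2 (L.block k G)) := by
          rw [Finset.sum_const, Int.card_Icc,
            show max m k + 4 + 1 - (max m k - 4) = 9 by ring]
          push_cast
          norm_num
          ring
      _ ≤ _ := by
          gcongr
          · exact le_add_self
          · exact le_add_self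

end LittlewoodPaley


/-! ### Minkowski's inequality for series -/

/-- Finite sums obey Minkowski's inequality, and monotone convergence along the directed family of
finite sets passes to the series. The exponent ∞ is treated pointwise. -/
theorem eLpNorm_enorm_tsum_le {α ι : Type*} [MeasurableSpace α] [Countable ι] {μ : Measure α}
    {g : ι → α → ℝ≥0∞} (hg : ∀ n, AEMeasurable (g n) μ) {p : ℝ≥0∞} (hp : 1 ≤ p) :
    eLpNorm (fun x => ∑' n, g n x) p μ ≤ ∑' n, eLpNorm (g n) p μ := by
  have hfin : ∀ s : Finset ι, eLpNorm (fun x => ∑ n ∈ s, g n x) p μ ≤ ∑' n, eLpNorm (g n) p μ := by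
    intro s
    have h := eLpNorm_sum_le (s := s) (f := g) (μ := μ) (fun n _ => (hg n).aestronglyMeasurable) hp
    have e : (fun x => ∑ n ∈ s, g n x) = ∑ n ∈ s, g n := by ext x; simp
    rw [e]
    exact h.trans (ENNReal.sum_le_tsum s)
  by_cases hp' : p = ∞
  · subst hp'
    simp only [eLpNorm_exponent_top]
    refine essSup_le_of_ae_le _ ?_
    filter_upwards [ae_all_iff.mpr fun n => ae_le_eLpNormEssSup (f := g n) (μ := μ)] with x hx
    simp only [enorm_eq_self] at hx ⊢
    exact ENNReal.tsum_le_tsum hx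
  · have hp0 : p ≠ 0 := (zero_lt_one.trans_le hp).ne'
    have hr : 0 < p.toReal := ENNReal.toReal_pos hp0 hp'
    have hpow : ∀ x, (∑' n, g n x) ^ p.toReal = ⨆ s : Finset ι, (∑ n ∈ s, g n x) ^ p.toReal := by
      intro x
      rw [ENNReal.tsum_eq_iSup_sum]
      exact (ENNReal.orderIsoRpow p.toReal hr).map_iSup _
    rw [eLpNorm_eq_lintegral_rpow_enorm_toReal hp0 hp']
    simp only [enorm_eq_self, hpow]
    rw [lintegral_iSup_directed]
    · have e : (⨆ s : Finset ι, ∫⁻ x, (∑ n ∈ s, g n x) ^ p.toReal ∂μ) ^ (1 / p.toReal) =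
          ⨆ s : Finset ι, (∫⁻ x, (∑ n ∈ s, g n x) ^ p.toReal ∂μ) ^ (1 / p.toReal) :=
        (ENNReal.orderIsoRpow (1 / p.toReal) (by positivity)).map_iSup _
      rw [e]
      refine iSup_le fun s => ?_
      have := hfin s
      rw [eLpNorm_eq_lintegral_rpow_enorm_toReal hp0 hp'] at this
      simpa only [enorm_eq_self] using this
    · exact fun s => (Finset.aemeasurable_fun_sum s fun n _ => hg n).pow_const _
    · refine Monotone.directed_le fun s t hst x => ?_
      dsimp only
      gcongr

/-! ### Synthesis of a distribution from its Fourier transform -/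

/-- The pairing norm with weights `2^{-N|m|}`. -/
def synthNorm (N : ℕ) (Z : E3 → Fin 3 → ℂ) : ℝ≥0∞ :=
  ∑' m : ℤ, (2 : ℝ≥0∞) ^ (-(N * |(m : ℝ)|)) * annNorm m Z

theorem exists_mem_dyadicAnnulus {ξ : E3} (h : ξ ≠ 0) : ∃ m, ξ ∈ dyadicAnnulus m := by
  have hp : 0 < 2 * Real.pi * ‖ξ‖ := by have := norm_pos_iff.mpr h; have := Real.pi_pos; positivity
  obtain ⟨n, h1, h2⟩ := exists_mem_Ico_zpow hp one_lt_two
  refine ⟨n, (zpow_le_zpow_right₀ one_le_two (by omega)).trans h1, h2.le⟩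

theorem lintegral_le_tsum_annulus (g : E3 → ℝ≥0∞) :
    ∫⁻ ξ, g ξ ≤ ∑' m : ℤ, ∫⁻ ξ in dyadicAnnulus m, g ξ := by
  refine le_trans (le_of_eq ?_) (lintegral_iUnion_le dyadicAnnulus g)
  rw [← setLIntegral_univ]
  refine setLIntegral_congr ?_
  have : (⋃ m, dyadicAnnulus m)ᶜ ⊆ {0} := by
    intro ξ hξ
    by_contra h
    exact hξ (Set.mem_iUnion.mpr (exists_mem_dyadicAnnulus h))
  refine (ae_eq_univ.mpr (measure_mono_null this ?_)).symm
  exact measure_singleton 0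

theorem norm_bounds_of_mem_dyadicAnnulus {m : ℤ} {ξ : E3} (h : ξ ∈ dyadicAnnulus m) :
    ‖ξ‖ ≤ 2 ^ m ∧ (2 : ℝ) ^ (m - 4) ≤ ‖ξ‖ := by
  obtain ⟨h1, h2⟩ := h
  have hp3 := Real.pi_gt_three
  have hp4 := Real.pi_le_four
  have hm : (0 : ℝ) < 2 ^ m := by positivity
  have e : ∀ i : ℤ, (2 : ℝ) ^ (m + i) = 2 ^ m * 2 ^ i := fun i => zpow_add₀ two_ne_zero m i
  simp only [sub_eq_add_neg, e] at *
  norm_num at *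
  constructor <;> nlinarith [norm_nonneg ξ]

/-- For $m\ge0$ the decay at infinity is used, for $m\le0$ the flatness at the origin. The factor
$16^N$ pays for the lower bound $2^{m-4}\le|\xi|$. -/
theorem norm_fourierInv_le_on_annulus {N : ℕ} {z : ℂ} {c : ℝ} (hc : 0 ≤ c) {m : ℤ} {ξ : E3}
    (hξ : ξ ∈ dyadicAnnulus m) (h1 : ‖z‖ ≤ c * ‖ξ‖ ^ N) (h2 : ‖ξ‖ ^ N * ‖z‖ ≤ c) :
    ‖z‖ ≤ c * 16 ^ N * (2 : ℝ) ^ (-(N * |m|)) := by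
  obtain ⟨h3, h4⟩ := norm_bounds_of_mem_dyadicAnnulus hξ
  rcases le_total 0 m with hm | hm
  · rw [abs_of_nonneg hm]
    have h5 : ((2 : ℝ) ^ (m - 4)) ^ N * ‖z‖ ≤ c := le_trans (by gcongr) h2
    have e : (2 : ℝ) ^ (-(N * m)) * 16 ^ N = (((2 : ℝ) ^ (m - 4)) ^ N)⁻¹ := by
      rw [zpow_sub₀ two_ne_zero, div_pow, inv_div, zpow_neg, mul_comm (N : ℤ), zpow_mul,
        zpow_natCast]
      norm_num
      field_simp
    rw [mul_assoc, mul_comm (16 ^ N : ℝ), e, ← div_eq_mul_inv, le_div_iff₀ (by positivity)]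
    linarith
  · rw [abs_of_nonpos hm]
    have e : (2 : ℝ) ^ (-(N * -m)) = ((2 : ℝ) ^ m) ^ N := by
      rw [mul_neg, neg_neg, mul_comm, zpow_mul, zpow_natCast]
    rw [e]
    calc ‖z‖ ≤ c * ‖ξ‖ ^ N := h1
      _ ≤ c * 1 * ((2 : ℝ) ^ m) ^ N := by rw [mul_one]; gcongr
      _ ≤ _ := by gcongr; exact one_le_pow₀ (by norm_num)

theorem setLIntegral_enorm_le {Z : E3 → Fin 3 → ℂ} (hZ : AEMeasurable Z) (m : ℤ) :
    ∫⁻ ξ in dyadicAnnulus m, ‖Z ξ‖ₑ ≤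
      annulusConst * (2 : ℝ≥0∞) ^ ((3 / 2 : ℝ) * m) * annNorm m Z := by
  rw [← lintegral_indicator (measurableSet_dyadicAnnulus m)]
  have h := lintegral_le_of_support (k := m)
    (A := (dyadicAnnulus m).indicator fun ξ => ‖Z ξ‖ₑ)
    (hZ.enorm.indicator (measurableSet_dyadicAnnulus m)) fun ξ hξ => by simp [hξ]
  refine h.trans_eq ?_
  congr 1
  refine eLpNorm_congr_enorm_ae (Eventually.of_forall fun ξ => ?_)
  by_cases hm : ξ ∈ dyadicAnnulus m <;> simp [hm]

theorem exists_seminorm_pairing_le (N : ℕ) : ∃ q : Seminorm ℂ 𝓢(E3, ℂ), Continuous q ∧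
    ∀ φ, IsS0 φ → ∀ Z : E3 → Fin 3 → ℂ, AEMeasurable Z →
      ∫⁻ ξ, ‖Z ξ‖ₑ * ‖𝓕⁻ φ ξ‖ₑ ≤ ENNReal.ofReal (q φ) * synthNorm N Z := by
  -- Two additional powers beat the factor $2^{3m/2}$ that Cauchy–Schwarz costs on the annulus.
  obtain ⟨q, hq, h⟩ := exists_seminorm_fourierInv_le (N + 2)
  set c : ℝ≥0 := annulusConst * 16 ^ (N + 2)
  refine ⟨c • q, ?_, fun φ hφ Z hZ => ?_⟩
  · exact hq.const_smul c
  refine (lintegral_le_tsum_annulus _).trans ?_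
  rw [synthNorm, ← ENNReal.tsum_mul_left]
  refine ENNReal.tsum_le_tsum fun m => ?_
  have hq0 : 0 ≤ q φ := apply_nonneg q φ
  calc ∫⁻ ξ in dyadicAnnulus m, ‖Z ξ‖ₑ * ‖𝓕⁻ φ ξ‖ₑ
      ≤ ∫⁻ ξ in dyadicAnnulus m,
        ‖Z ξ‖ₑ * ENNReal.ofReal (q φ * 16 ^ (N + 2) * (2 : ℝ) ^ (-((N + 2 : ℕ) * |m|))) := by
        refine setLIntegral_mono' (measurableSet_dyadicAnnulus m) fun ξ hξ => ?_
        gcongr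
        rw [← ofReal_norm]
        exact ENNReal.ofReal_le_ofReal
          (norm_fourierInv_le_on_annulus hq0 hξ (h φ hφ ξ).1 (h φ hφ ξ).2)
    _ ≤ (annulusConst * (2 : ℝ≥0∞) ^ ((3 / 2 : ℝ) * m) * annNorm m Z) *
        ENNReal.ofReal (q φ * 16 ^ (N + 2) * (2 : ℝ) ^ (-((N + 2 : ℕ) * |m|))) := by
        rw [lintegral_mul_const' _ _ ENNReal.ofReal_ne_top]
        gcongr
        exact setLIntegral_enorm_le hZ m
    _ = (annulusConst * 16 ^ (N + 2) * ENNReal.ofReal (q φ)) *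
        (((2 : ℝ≥0∞) ^ ((3 / 2 : ℝ) * m) * (2 : ℝ≥0∞) ^ (-((N + 2) * |(m : ℝ)|))) *
          annNorm m Z) := by
        rw [ENNReal.ofReal_mul (by positivity), ENNReal.ofReal_mul hq0, ← two_rpow_intCast,
          ENNReal.ofReal_pow (by norm_num)]
        push_cast
        norm_num
        ring
    _ ≤ (annulusConst * 16 ^ (N + 2) * ENNReal.ofReal (q φ)) *
        ((2 : ℝ≥0∞) ^ (-(N * |(m : ℝ)|)) * annNorm m Z) := by
        gcongr
        rw [← ENNReal.rpow_add _ _ two_ne_zero (by simp)]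
        gcongr
        · norm_num
        · have := le_abs_self (m : ℝ)
          have := abs_nonneg (m : ℝ)
          linarith
    _ = _ := by
        congr 1
        have : (c • q) φ = (c : ℝ) * q φ := rfl
        rw [this, ENNReal.ofReal_mul (by positivity), ENNReal.ofReal_coe_nnreal]
        push_cast [c]
        rfl

/-- The subspace `𝓢₀`. -/
def schwartzZero : Submodule ℂ 𝓢(E3, ℂ) where
  carrier := {φ | IsS0 φ}
  add_mem' := IsS0.add
  zero_mem' := isS0_zero
  smul_mem' c _ h := IsS0.smul h c

/-- A summable family of square integrable functions is the Fourier transform of a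
distribution modulo polynomials. -/
theorem exists_hasSum_fourierInv {ι : Type*} {Z : ι → E3 → Fin 3 → ℂ}
    (hZ : ∀ n i, MemLp (fun ξ => Z n ξ i) 2) {N : ℕ} (h : ∑' n, synthNorm N (Z n) < ∞) :
    ∃ H : VecDist, ∀ i φ, IsS0 φ → HasSum (fun n => ∫ ξ, Z n ξ i * 𝓕⁻ φ ξ) (H i φ) := by
  obtain ⟨q, hq, hle⟩ := exists_seminorm_pairing_le N
  have hmeas : ∀ n, AEMeasurable (Z n) := fun n =>
    aemeasurable_pi_iff.mpr fun i => (hZ n i).1.aemeasurable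
  have hfin : ∀ n, synthNorm N (Z n) ≠ ∞ := fun n => ne_top_of_le_ne_top h.ne (ENNReal.le_tsum n)
  have hpair : ∀ n i φ, IsS0 φ → ‖∫ ξ, Z n ξ i * 𝓕⁻ φ ξ‖ ≤ q φ * (synthNorm N (Z n)).toReal := by
    intro n i φ hφ
    have h1 : ‖∫ ξ, Z n ξ i * 𝓕⁻ φ ξ‖ₑ ≤ ENNReal.ofReal (q φ) * synthNorm N (Z n) := by
      refine (enorm_integral_le_lintegral_enorm _).trans
        ((lintegral_mono fun ξ => ?_).trans (hle φ hφ (Z n) (hmeas n)))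
      rw [enorm_mul]
      gcongr
      rw [enorm_le_iff_norm_le]
      exact norm_le_pi_norm _ i
    rw [← toReal_enorm]
    refine (ENNReal.toReal_mono (ENNReal.mul_ne_top ENNReal.ofReal_ne_top (hfin n)) h1).trans_eq ?_
    rw [ENNReal.toReal_mul, ENNReal.toReal_ofReal (apply_nonneg q φ)]
  have hsumQ : Summable fun n => (synthNorm N (Z n)).toReal := ENNReal.summable_toReal h.ne
  have hsum : ∀ i φ, IsS0 φ → Summable fun n => ∫ ξ, Z n ξ i * 𝓕⁻ φ ξ := fun i φ hφ =>
    Summable.of_norm_bounded (hsumQ.mul_left (q φ)) fun n => hpair n i φ hφ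
  have hint : ∀ n i (φ : 𝓢(E3, ℂ)), Integrable fun ξ => Z n ξ i * 𝓕⁻ φ ξ := fun n i φ =>
    (hZ n i).integrable_mul ((𝓕⁻ φ).memLp 2 volume)
  let Λ : Fin 3 → Module.Dual ℂ schwartzZero := fun i =>
    { toFun := fun φ => ∑' n, ∫ ξ, Z n ξ i * 𝓕⁻ (φ : 𝓢(E3, ℂ)) ξ
      map_add' := fun φ ψ => by
        rw [← (hsum i φ φ.2).tsum_add (hsum i ψ ψ.2)]
        refine tsum_congr fun n => ?_
        rw [← integral_add (hint n i φ) (hint n i ψ), Submodule.coe_add,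
          FourierTransform.fourierInv_add]
        simp only [add_apply, mul_add]
      map_smul' := fun c φ => by
        rw [RingHom.id_apply, smul_eq_mul, ← tsum_mul_left]
        refine tsum_congr fun n => ?_
        rw [← integral_const_mul, Submodule.coe_smul, FourierTransform.fourierInv_smul]
        simp only [smul_apply, smul_eq_mul, mul_left_comm] }
  set c : ℝ≥0 := ⟨∑' n, (synthNorm N (Z n)).toReal, tsum_nonneg fun n => ENNReal.toReal_nonneg⟩
  have hΛ : ∀ i (φ : schwartzZero), ‖Λ i φ‖ ≤ (c • q) φ := by
    intro i φ
    change ‖∑' n, ∫ ξ, Z n ξ i * 𝓕⁻ (φ : 𝓢(E3, ℂ)) ξ‖ ≤ (c : ℝ) * q φ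
    refine (tsum_of_norm_bounded (hsumQ.mul_left (q φ)).hasSum
      fun n => hpair n i φ φ.2).trans_eq ?_
    rw [tsum_mul_left, mul_comm]
    rfl
  have : PolynormableSpace ℂ 𝓢(E3, ℂ) := (schwartz_withSeminorms ℂ E3 ℂ).toPolynormableSpace
  -- Hahn–Banach: the sum of the pairings is a functional on $\mathcal S_0$ only, and any continuous
  -- extension represents the same class modulo polynomials.
  choose g hg _ using fun i => Module.Dual.exists_continuous_extension_of_le_seminorm
    schwartzZero (Λ i) (hq.const_smul c) (hΛ i)
  refine ⟨fun i => ContinuousLinearMap.toPointwiseConvergenceCLM _ _ _ _ (g i), fun i φ hφ => ?_⟩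
  have e : ContinuousLinearMap.toPointwiseConvergenceCLM ℂ (RingHom.id ℂ) 𝓢(E3, ℂ) ℂ (g i) φ =
      ∑' n, ∫ ξ, Z n ξ i * 𝓕⁻ φ ξ := hg i ⟨φ, hφ⟩
  rw [e]
  exact (hsum i φ hφ).hasSum


/-! ### The Leray projection of a series of fields -/

theorem memLp_lerayFT (y : E3 → Fin 3 → ℂ) (i : Fin 3) : MemLp (fun ξ => lerayFT y ξ i) 2 := by
  have h : MemLp (fun ξ => ∑ j, ‖fourierVec y ξ j‖) 2 :=
    memLp_finsetSum _ fun j _ => (memLp_fourierL2 fun x => y x j).norm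
  refine MemLp.of_le_mul (c := 4) h
    (aemeasurable_pi_iff.mp (aemeasurable_lerayFT y) i).aestronglyMeasurable
    (Eventually.of_forall fun ξ => ?_)
  calc ‖lerayFT y ξ i‖ ≤ ‖lerayFT y ξ‖ := norm_le_pi_norm _ i
    _ ≤ 4 * ‖fourierVec y ξ‖ := norm_leraySym_le ξ _
    _ ≤ 4 * ∑ j, ‖fourierVec y ξ j‖ := by
      gcongr
      exact (pi_norm_le_iff_of_nonneg (Finset.sum_nonneg fun _ _ => norm_nonneg _)).mpr fun i =>
        Finset.single_le_sum (f := fun j => ‖fourierVec y ξ j‖) (fun _ _ => norm_nonneg _)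
          (Finset.mem_univ i)
    _ = _ := by rw [Real.norm_of_nonneg (Finset.sum_nonneg fun _ _ => norm_nonneg _)]

/-- Tested on a translated kernel, each pairing is the inverse transform of `Z n` times the
multiplier of $\Delta_m$, which lives on annulus `m`. Plancherel and Minkowski conclude; the factor
3 counts components. -/
theorem spaceNorm_block_le_tsum (L : LittlewoodPaley) {ι : Type*} [Countable ι]
    {Z : ι → E3 → Fin 3 → ℂ} (hZ : ∀ n i, MemLp (fun ξ => Z n ξ i) 2) {H : VecDist}
    (hH : ∀ i φ, IsS0 φ → HasSum (fun n => ∫ ξ, Z n ξ i * 𝓕⁻ φ ξ) (H i φ)) (m : ℤ) :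
    spaceNorm 2 (L.block m H) ≤ 3 * L.multBound * ∑' n, annNorm m (Z n) := by
  have hmeas : ∀ i, AEStronglyMeasurable (fun x => L.block m H x i) := fun i =>
    ((continuous_apply i).comp (continuous_conv (L.ker m) H)).aestronglyMeasurable
  refine (spaceNorm_le_sum hmeas one_le_two).trans ?_
  have hmul : ∀ n i, MemLp (fun ξ => Z n ξ i * 𝓕 (L.ker m) ξ) 2 := fun n i =>
    MemLp.of_le_mul (c := L.multBound) (hZ n i)
      ((hZ n i).1.mul (𝓕 (L.ker m) : 𝓢(E3, ℂ)).continuous.aestronglyMeasurable)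
      (Eventually.of_forall fun ξ => by
        rw [norm_mul, mul_comm]
        gcongr
        exact L.norm_fourier_ker_le m ξ)
  have hmul1 : ∀ n i, Integrable fun ξ => Z n ξ i * 𝓕 (L.ker m) ξ := fun n i =>
    (hZ n i).integrable_mul ((𝓕 (L.ker m)).memLp 2 volume)
  have hnorm : ∀ n i, eLpNorm (𝓕⁻ fun ξ => Z n ξ i * 𝓕 (L.ker m) ξ) 2 ≤
      L.multBound * annNorm m (Z n) := by
    intro n i
    rw [eLpNorm_fourierInv (hmul n i) (hmul1 n i)]
    have h := eLpNorm_le_nnreal_smul_eLpNorm_of_ae_le_mul (μ := volume)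
      (f := fun ξ => Z n ξ i * 𝓕 (L.ker m) ξ) (g := (dyadicAnnulus m).indicator (Z n))
      (c := L.multBound) (Eventually.of_forall fun ξ => ?_) 2
    · exact h
    · by_cases hm : ξ ∈ dyadicAnnulus m
      · simp only [hm, Set.indicator_of_mem]
        rw [nnnorm_mul, mul_comm]
        gcongr
        · exact L.norm_fourier_ker_le m ξ
        · exact nnnorm_le_pi_nnnorm _ i
      · simp [L.fourier_ker_eq_zero hm]
  have hcomp : ∀ i, eLpNorm (fun x => L.block m H x i) 2 ≤
      L.multBound * ∑' n, annNorm m (Z n) := by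
    intro i
    have hs : ∀ x, HasSum (fun n => 𝓕⁻ (fun ξ => Z n ξ i * 𝓕 (L.ker m) ξ) x)
        (L.block m H x i) := by
      intro x
      have e : ∀ n, ∫ ξ, Z n ξ i * 𝓕⁻ (reflectAt (L.ker m) x) ξ =
          𝓕⁻ (fun ξ => Z n ξ i * 𝓕 (L.ker m) ξ) x := by
        intro n
        rw [Real.fourierInv_eq]
        congr 1
        ext ξ
        rw [fourierInv_reflectAt, Circle.smul_def, smul_eq_mul, real_inner_comm]
        ring
      have h := hH i _ (L.isS0_reflectAt_ker m x)
      simp only [e] at h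
      exact h
    set u : ι → E3 → ℝ≥0∞ := fun n x => ‖𝓕⁻ (fun ξ => Z n ξ i * 𝓕 (L.ker m) ξ) x‖ₑ
    have hu : ∀ n, AEMeasurable (u n) volume := fun n =>
      (continuous_fourierInv_of_integrable (hmul1 n i)).aestronglyMeasurable.enorm
    have hun : ∀ n, eLpNorm (u n) 2 volume ≤ L.multBound * annNorm m (Z n) := fun n => by
      refine le_trans (le_of_eq ?_) (hnorm n i)
      exact eLpNorm_congr_enorm_ae (Eventually.of_forall fun x => by simp [u])
    have h1 : eLpNorm (fun x => L.block m H x i) 2 ≤ eLpNorm (fun x => ∑' n, u n x) 2 volume := by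
      refine eLpNorm_mono_enorm fun x => ?_
      rw [← (hs x).tsum_eq, enorm_eq_self]
      exact enorm_tsum_le_tsum_enorm
    refine h1.trans ((eLpNorm_enorm_tsum_le hu one_le_two).trans ?_)
    rw [← ENNReal.tsum_mul_left]
    exact ENNReal.tsum_le_tsum hun
  calc _ ≤ ∑ _i : Fin 3, L.multBound * ∑' n, annNorm m (Z n) := by gcongr; exact hcomp _
    _ = _ := by simp [mul_assoc]

theorem fourierInv_laplacian_apply (φ : 𝓢(E3, ℂ)) (ξ : E3) :
    𝓕⁻ (Δ φ) ξ = -(4 * Real.pi ^ 2 * (‖ξ‖ ^ 2 : ℝ)) * 𝓕⁻ φ ξ := by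
  rw [SchwartzMap.laplacian_eq_sum (EuclideanSpace.basisFun (Fin 3) ℝ),
    FourierTransform.fourierInv_sum, sum_apply]
  simp only [fourierInv_lineDeriv_apply]
  rw [EuclideanSpace.norm_sq_eq]
  simp [Fin.sum_univ_three, EuclideanSpace.inner_single_right]
  ring_nf
  simp
  ring

theorem fourierInv_curl_apply (Φ : VecSchwartz) (ξ : E3) :
    (fun i => 𝓕⁻ (curl Φ i) ξ) =
      (-(2 * Real.pi * Complex.I) : ℂ) • (freqVec ξ ⨯₃ fun i => 𝓕⁻ (Φ i) ξ) := by
  have h : ∀ a b c d : Fin 3, 𝓕⁻ (∂_{stdVec a} (Φ b) - ∂_{stdVec c} (Φ d)) ξ =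
      -(2 * Real.pi * Complex.I) * (freqVec ξ a * 𝓕⁻ (Φ b) ξ - freqVec ξ c * 𝓕⁻ (Φ d) ξ) := by
    intro a b c d
    rw [sub_eq_add_neg, FourierTransform.fourierInv_add, FourierTransform.fourierInv_neg,
      add_apply, neg_apply, fourierInv_lineDeriv_apply,
      fourierInv_lineDeriv_apply, inner_stdVec, inner_stdVec]
    simp only [freqVec]
    ring
  funext i
  fin_cases i <;> exact h _ _ _ _

theorem fourierInv_curl_curl_apply (Φ : VecSchwartz) (ξ : E3) :
    (fun i => 𝓕⁻ (curl (curl Φ) i) ξ) =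
      (-(4 * Real.pi ^ 2) : ℂ) • (freqVec ξ ⨯₃ (freqVec ξ ⨯₃ fun i => 𝓕⁻ (Φ i) ξ)) := by
  rw [fourierInv_curl_apply, fourierInv_curl_apply, map_smul, smul_smul]
  congr 1
  ring_nf
  simp

theorem cross_cross_dotProduct (a X Y : Fin 3 → ℂ) :
    (a ⨯₃ (a ⨯₃ X)) ⬝ᵥ Y = X ⬝ᵥ (a ⨯₃ (a ⨯₃ Y)) := by
  simp [cross_apply, dotProduct, Fin.sum_univ_three]
  ring

/-- The symbol of the double curl is symmetric for the dot product, and the factor $|\xi|^{-2}$ of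
the Leray symbol cancels against that of $-\Delta$. -/
theorem leraySym_dotProduct {ξ : E3} (hξ : ξ ≠ 0) (X : Fin 3 → ℂ) (Φ : VecSchwartz) :
    ∑ i, leraySym ξ X i * 𝓕⁻ (-Δ (Φ i)) ξ = ∑ i, X i * 𝓕⁻ (curl (curl Φ) i) ξ := by
  have h1 : ∀ i, 𝓕⁻ (-Δ (Φ i)) ξ = (4 * Real.pi ^ 2 * (‖ξ‖ ^ 2 : ℝ)) * 𝓕⁻ (Φ i) ξ := fun i => by
    rw [FourierTransform.fourierInv_neg, neg_apply, fourierInv_laplacian_apply]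
    ring
  have h2 := congrArg (fun Y => X ⬝ᵥ Y) (fourierInv_curl_curl_apply Φ ξ)
  have hn : (‖ξ‖ : ℂ) ≠ 0 := by exact_mod_cast norm_ne_zero_iff.mpr hξ
  change X ⬝ᵥ (fun i => 𝓕⁻ (curl (curl Φ) i) ξ) = _ at h2
  change _ = X ⬝ᵥ (fun i => 𝓕⁻ (curl (curl Φ) i) ξ)
  rw [h2]
  rw [dotProduct_smul, ← cross_cross_dotProduct, dotProduct, smul_eq_mul, Finset.mul_sum]
  refine Finset.sum_congr rfl fun i _ => ?_
  rw [h1, leraySym]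
  simp only [Pi.neg_apply, Pi.smul_apply, smul_eq_mul]
  push_cast
  field_simp

/-- The pairing of the Leray projection of a square integrable field with `-Δ Φ`. -/
theorem sum_integral_lerayFT {y : E3 → Fin 3 → ℂ} (hy : ∀ i, MemLp (fun x => y x i) 2)
    (Φ : VecSchwartz) :
    ∑ i, ∫ ξ, lerayFT y ξ i * 𝓕⁻ (-Δ (Φ i)) ξ = ∫ x, y x ⬝ᵥ fun i => curl (curl Φ) i x := by
  have h1 : ∀ i, Integrable fun ξ => lerayFT y ξ i * 𝓕⁻ (-Δ (Φ i)) ξ := fun i =>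
    (memLp_lerayFT y i).integrable_mul ((𝓕⁻ (-Δ (Φ i))).memLp 2 volume)
  have h2 : ∀ i, Integrable fun ξ => fourierVec y ξ i * 𝓕⁻ (curl (curl Φ) i) ξ := fun i =>
    (memLp_fourierL2 fun x => y x i).integrable_mul ((𝓕⁻ (curl (curl Φ) i)).memLp 2 volume)
  have h3 : ∀ i, Integrable fun x => y x i * curl (curl Φ) i x := fun i =>
    (hy i).integrable_mul ((curl (curl Φ) i).memLp 2 volume)
  rw [← integral_finsetSum _ fun i _ => h1 i]
  have e1 : ∫ ξ, ∑ i, lerayFT y ξ i * 𝓕⁻ (-Δ (Φ i)) ξ =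
      ∫ ξ, ∑ i, fourierVec y ξ i * 𝓕⁻ (curl (curl Φ) i) ξ := by
    refine integral_congr_ae ?_
    have : ∀ᵐ ξ : E3, ξ ≠ 0 := by
      rw [ae_iff]; simp
    filter_upwards [this] with ξ hξ
    exact leraySym_dotProduct hξ _ Φ
  rw [e1, integral_finsetSum _ fun i _ => h2 i]
  simp only [dotProduct]
  rw [integral_finsetSum _ fun i _ => h3 i]
  refine Finset.sum_congr rfl fun i _ => ?_
  have h := integral_fourierL2_mul_schwartz (hy i) (𝓕⁻ (curl (curl Φ) i))
  rw [FourierTransform.fourier_fourierInv_eq] at h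
  exact h

theorem negLaplacePair_eq (H : VecDist) (Φ : VecSchwartz) :
    negLaplacePair H Φ = ∑ i, H i (-Δ (Φ i)) := by
  refine Finset.sum_congr rfl fun i _ => ?_
  rw [neg_apply, TemperedDistribution.laplacian_apply_apply, map_neg]

theorem hasSum_negLaplacePair {ι : Type*} {y : ι → E3 → Fin 3 → ℂ}
    (hy : ∀ n i, MemLp (fun x => y n x i) 2) {H : VecDist}
    (hH : ∀ i φ, IsS0 φ → HasSum (fun n => ∫ ξ, lerayFT (y n) ξ i * 𝓕⁻ φ ξ) (H i φ))
    {Φ : VecSchwartz} (hΦ : ∀ i, IsS0 (Φ i)) :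
    HasSum (fun n => ∫ x, y n x ⬝ᵥ fun i => curl (curl Φ) i x) (negLaplacePair H Φ) := by
  rw [negLaplacePair_eq]
  have h := hasSum_sum (s := Finset.univ) fun i _ => hH i (-Δ (Φ i)) (hΦ i).laplacian.neg
  simpa only [sum_integral_lerayFT (hy _)] using h


/-! ### Square integrable fields -/

theorem tendsto_integral_mul_of_tendsto_eLpNorm {u v : ℕ → E3 → ℂ} {f g : E3 → ℂ}
    (hu : ∀ n, MemLp (u n) 2) (hv : ∀ n, MemLp (v n) 2) (hf : MemLp f 2) (hg : MemLp g 2)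
    (huf : Tendsto (fun n => eLpNorm (fun x => u n x - f x) 2 volume) atTop (𝓝 0))
    (hvg : Tendsto (fun n => eLpNorm (fun x => v n x - g x) 2 volume) atTop (𝓝 0)) :
    Tendsto (fun n => ∫ x, u n x * v n x) atTop (𝓝 (∫ x, f x * g x)) := by
  have h1 : Tendsto (fun n => (hu n).toLp (u n)) atTop (𝓝 (hf.toLp f)) :=
    (Lp.tendsto_Lp_iff_tendsto_eLpNorm'' u hu f hf).mpr huf
  have h2 : Tendsto (fun n => (hv n).toLp (v n)) atTop (𝓝 (hg.toLp g)) :=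
    (Lp.tendsto_Lp_iff_tendsto_eLpNorm'' v hv g hg).mpr hvg
  have h3 := (((ContinuousLinearMap.mul ℂ ℂ).lpPairing (volume : Measure E3) 2 2).continuous₂.tendsto
    (hf.toLp f, hg.toLp g)).comp (h1.prodMk_nhds h2)
  have e : ∀ (f g : E3 → ℂ) (hf : MemLp f 2) (hg : MemLp g 2),
      (ContinuousLinearMap.mul ℂ ℂ).lpPairing (volume : Measure E3) 2 2 (hf.toLp f) (hg.toLp g) =
        ∫ x, f x * g x := by
    intro f g hf hg
    rw [ContinuousLinearMap.lpPairing_eq_integral]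
    refine integral_congr_ae ?_
    filter_upwards [hf.coeFn_toLp, hg.coeFn_toLp] with x hx hy
    simp [hx, hy]
  rw [← e f g hf hg]
  refine h3.congr fun n => ?_
  exact e _ _ (hu n) (hv n)

theorem integrable_dotProduct_schwartz {y : E3 → Fin 3 → ℂ} (hy : ∀ i, MemLp (fun x => y x i) 2)
    (Ψ : VecSchwartz) : Integrable fun x => y x ⬝ᵥ fun i => Ψ i x :=
  integrable_finsetSum _ fun i _ => (hy i).integrable_mul ((Ψ i).memLp 2 volume)

/-- The six scalar integrals in `curlCurlCross`. -/
theorem curlCurlCross_eq {f g : E3 → Fin 3 → ℂ} (Φ : VecSchwartz)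
    (h : ∀ a b i, Integrable fun x => f x a * curl (curl Φ) i x * g x b) :
    curlCurlCross f g Φ =
      (∫ x, f x 1 * curl (curl Φ) 0 x * g x 2) - (∫ x, f x 2 * curl (curl Φ) 0 x * g x 1) +
      ((∫ x, f x 2 * curl (curl Φ) 1 x * g x 0) - ∫ x, f x 0 * curl (curl Φ) 1 x * g x 2) +
      ((∫ x, f x 0 * curl (curl Φ) 2 x * g x 1) - ∫ x, f x 1 * curl (curl Φ) 2 x * g x 0) := by
  have hs : ∀ a b c d i, Integrable fun x =>
      f x a * curl (curl Φ) i x * g x b - f x c * curl (curl Φ) i x * g x d :=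
    fun a b c d i => (h a b i).sub (h c d i)
  have hs2 : Integrable fun x =>
      f x 1 * curl (curl Φ) 0 x * g x 2 - f x 2 * curl (curl Φ) 0 x * g x 1 +
        (f x 2 * curl (curl Φ) 1 x * g x 0 - f x 0 * curl (curl Φ) 1 x * g x 2) :=
    (hs _ _ _ _ _).add (hs _ _ _ _ _)
  rw [← integral_sub (h _ _ _) (h _ _ _), ← integral_sub (h _ _ _) (h _ _ _),
    ← integral_sub (h _ _ _) (h _ _ _), ← integral_add (hs _ _ _ _ _) (hs _ _ _ _ _),
    ← integral_add hs2 (hs _ _ _ _ _), curlCurlCross]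
  congr 1
  ext x
  simp only [cross_apply, dotProduct, Fin.sum_univ_three, Matrix.cons_val_zero,
    Matrix.cons_val_one, Matrix.cons_val]
  ring

/-- Continuity of the $L^2$ pairing. The test field is attached to the left factor, so that a
bounded left factor is admitted as well as a square integrable one. -/
theorem tendsto_curlCurlCross {u v : ℕ → E3 → Fin 3 → ℂ} {f g : E3 → Fin 3 → ℂ} (Φ : VecSchwartz)
    (hu : ∀ n a i, MemLp (fun x => u n x a * curl (curl Φ) i x) 2)
    (hv : ∀ n b, MemLp (fun x => v n x b) 2)
    (hf : ∀ a i, MemLp (fun x => f x a * curl (curl Φ) i x) 2)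
    (hg : ∀ b, MemLp (fun x => g x b) 2)
    (huf : ∀ a i, Tendsto (fun n => eLpNorm (fun x => u n x a * curl (curl Φ) i x -
      f x a * curl (curl Φ) i x) 2 volume) atTop (𝓝 0))
    (hvg : ∀ b, Tendsto (fun n => eLpNorm (fun x => v n x b - g x b) 2 volume) atTop (𝓝 0)) :
    Tendsto (fun n => curlCurlCross (u n) (v n) Φ) atTop (𝓝 (curlCurlCross f g Φ)) := by
  have hT : ∀ a b i, Tendsto (fun n => ∫ x, u n x a * curl (curl Φ) i x * v n x b) atTop
      (𝓝 (∫ x, f x a * curl (curl Φ) i x * g x b)) := fun a b i =>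
    tendsto_integral_mul_of_tendsto_eLpNorm (fun n => hu n a i) (fun n => hv n b) (hf a i) (hg b)
      (huf a i) (hvg b)
  rw [curlCurlCross_eq Φ fun a b i => (hf a i).integrable_mul (hg b)]
  have e := fun n => curlCurlCross_eq (f := u n) (g := v n) Φ fun a b i =>
    (hu n a i).integrable_mul (hv n b)
  simp only [e]
  exact (((hT _ _ _).sub (hT _ _ _)).add ((hT _ _ _).sub (hT _ _ _))).add
    ((hT _ _ _).sub (hT _ _ _))

theorem curlCurlCross_sum_right {ι : Type*} (s : Finset ι) {f : E3 → Fin 3 → ℂ}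
    {g : ι → E3 → Fin 3 → ℂ} (Φ : VecSchwartz)
    (h : ∀ k ∈ s, ∀ i, MemLp (fun x => (f x ⨯₃ g k x) i) 2) :
    curlCurlCross f (fun x => ∑ k ∈ s, g k x) Φ = ∑ k ∈ s, curlCurlCross f (g k) Φ := by
  unfold curlCurlCross
  rw [← integral_finsetSum _ fun k hk => integrable_dotProduct_schwartz (h k hk) (curl (curl Φ))]
  simp only [map_sum, sum_dotProduct]

theorem curlCurlCross_sum_left {ι : Type*} (s : Finset ι) {f : ι → E3 → Fin 3 → ℂ}
    {g : E3 → Fin 3 → ℂ} (Φ : VecSchwartz)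
    (h : ∀ k ∈ s, ∀ i, MemLp (fun x => (f k x ⨯₃ g x) i) 2) :
    curlCurlCross (fun x => ∑ k ∈ s, f k x) g Φ = ∑ k ∈ s, curlCurlCross (f k) g Φ := by
  unfold curlCurlCross
  rw [← integral_finsetSum _ fun k hk => integrable_dotProduct_schwartz (h k hk) (curl (curl Φ))]
  simp only [map_sum, LinearMap.sum_apply, sum_dotProduct]

theorem MeasureTheory.MemLp.component {f : E3 → Fin 3 → ℂ} (hf : MemLp f 2) (i : Fin 3) :
    MemLp (fun x => f x i) 2 :=
  hf.of_le ((continuous_apply i).comp_aestronglyMeasurable hf.1)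
    (Eventually.of_forall fun _ => norm_le_pi_norm _ i)

namespace LittlewoodPaley

variable (L : LittlewoodPaley)

/-- The partial sums of the Littlewood--Paley decomposition. -/
def partialSum (N : ℕ) (u : VecDist) (x : E3) : Fin 3 → ℂ :=
  ∑ j ∈ Finset.Icc (-(N : ℤ)) N, L.block j u x

variable {L}

/-- At most five multipliers are nonzero at a given frequency. The bound does not depend on the set
of indices and provides the majorant for dominated convergence. -/
theorem sum_norm_fourier_ker_le (s : Finset ℤ) {ξ : E3} (hξ : ξ ≠ 0) :
    ∑ j ∈ s, ‖𝓕 (L.ker j) ξ‖ ≤ 5 * L.multBound := by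
  obtain ⟨k, hk⟩ := exists_mem_dyadicAnnulus hξ
  have h0 : ∀ j ∈ s, j ∉ s ∩ Finset.Icc (k - 2) (k + 2) → ‖𝓕 (L.ker j) ξ‖ = 0 := by
    intro j hj hj'
    rw [norm_eq_zero]
    by_contra hne
    have hm := L.mem_dyadicAnnulus_of_fourier_ker_ne_zero hne
    have e1 := (zpow_le_zpow_iff_right₀ (one_lt_two (α := ℝ))).mp (hk.1.trans hm.2)
    have e2 := (zpow_le_zpow_iff_right₀ (one_lt_two (α := ℝ))).mp (hm.1.trans hk.2)
    refine hj' (Finset.mem_inter.mpr ⟨hj, Finset.mem_Icc.mpr ⟨?_, ?_⟩⟩) <;> omega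
  rw [← Finset.sum_subset Finset.inter_subset_left h0]
  calc _ ≤ ∑ j ∈ s ∩ Finset.Icc (k - 2) (k + 2), (L.multBound : ℝ) := by
        gcongr with j; exact L.norm_fourier_ker_le j ξ
    _ ≤ ∑ j ∈ Finset.Icc (k - 2) (k + 2), (L.multBound : ℝ) :=
        Finset.sum_le_sum_of_subset_of_nonneg Finset.inter_subset_right fun _ _ _ => by positivity
    _ = _ := by
        rw [Finset.sum_const, Int.card_Icc, show k + 2 + 1 - (k - 2) = 5 by ring]
        simp

section

variable {f : E3 → Fin 3 → ℂ} {F : VecDist}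

theorem block_eq_fourierInv_of_represents (hf : MemLp f 2) (h : Represents f F) (j : ℤ) (i : Fin 3)
    (x : E3) : L.block j F x i =
      𝓕⁻ (fun ξ => fourierL2 (fun x => f x i) ξ * 𝓕 (L.ker j) ξ) x := by
  have h1 := integral_fourierL2_mul_schwartz (hf.component i) (𝓕⁻ (reflectAt (L.ker j) x))
  rw [FourierTransform.fourier_fourierInv_eq] at h1
  rw [block_apply, h i _ (L.isS0_reflectAt_ker j x), ← h1, Real.fourierInv_eq]
  congr 1
  ext ξ
  rw [fourierInv_reflectAt, Circle.smul_def, smul_eq_mul, real_inner_comm]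
  ring

theorem memLp_fourierL2_mul_ker (u : E3 → ℂ) (j : ℤ) :
    MemLp (fun ξ => fourierL2 u ξ * 𝓕 (L.ker j) ξ) 2 :=
  MemLp.of_le_mul (c := L.multBound) (memLp_fourierL2 u)
    ((memLp_fourierL2 u).1.mul (𝓕 (L.ker j) : 𝓢(E3, ℂ)).continuous.aestronglyMeasurable)
    (Eventually.of_forall fun ξ => by
      rw [norm_mul, mul_comm]
      gcongr
      exact L.norm_fourier_ker_le j ξ)

theorem integrable_fourierL2_mul_ker (u : E3 → ℂ) (j : ℤ) :
    Integrable (fun ξ => fourierL2 u ξ * 𝓕 (L.ker j) ξ) :=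
  (memLp_fourierL2 u).integrable_mul ((𝓕 (L.ker j)).memLp 2 volume)

theorem memLp_block_of_represents (hf : MemLp f 2) (h : Represents f F) (j : ℤ) (i : Fin 3) :
    MemLp (fun x => L.block j F x i) 2 := by
  simp only [block_eq_fourierInv_of_represents hf h]
  exact memLp_fourierInv (memLp_fourierL2_mul_ker _ j) (integrable_fourierL2_mul_ker _ j)

theorem fourierL2_partialSum (hf : MemLp f 2) (h : Represents f F) (N : ℕ) (i : Fin 3) :
    fourierL2 (fun x => L.partialSum N F x i) =ᵐ[volume] fun ξ =>
      fourierL2 (fun x => f x i) ξ * ∑ j ∈ Finset.Icc (-(N : ℤ)) N, 𝓕 (L.ker j) ξ := by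
  have h1 : ∀ x, L.partialSum N F x i = 𝓕⁻ (fun ξ => ∑ j ∈ Finset.Icc (-(N : ℤ)) N,
      fourierL2 (fun x => f x i) ξ * 𝓕 (L.ker j) ξ) x := by
    intro x
    rw [partialSum, Finset.sum_apply]
    simp only [block_eq_fourierInv_of_represents hf h, Real.fourierInv_eq, Finset.smul_sum]
    rw [integral_finsetSum _ fun j _ => ?_]
    have := (Real.fourierIntegral_convergent_iff (-x)).mpr
      (integrable_fourierL2_mul_ker (L := L) (fun x => f x i) j)
    simpa using this
  have hm : MemLp (fun ξ => ∑ j ∈ Finset.Icc (-(N : ℤ)) N,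
      fourierL2 (fun x => f x i) ξ * 𝓕 (L.ker j) ξ) 2 :=
    memLp_finsetSum _ fun j _ => memLp_fourierL2_mul_ker _ j
  simp only [h1]
  refine (fourierL2_fourierInv hm
    (integrable_finsetSum _ fun j _ => integrable_fourierL2_mul_ker _ j)).symm.trans ?_
  simp only [Finset.mul_sum]
  rfl

theorem memLp_partialSum (hf : MemLp f 2) (h : Represents f F) (N : ℕ) (i : Fin 3) :
    MemLp (fun x => L.partialSum N F x i) 2 := by
  simp only [partialSum, Finset.sum_apply]
  exact memLp_finsetSum _ fun j _ => memLp_block_of_represents hf h j i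

/-- By Plancherel the error is the norm of $\hat f_i$ times (partial sum of the multipliers minus
one), which tends to zero off the origin and is dominated. -/
theorem tendsto_partialSum (hf : MemLp f 2) (h : Represents f F) (i : Fin 3) :
    Tendsto (fun N => eLpNorm (fun x => L.partialSum N F x i - f x i) 2 volume) atTop (𝓝 0) := by
  set u := fourierL2 fun x => f x i
  have hu : MemLp u 2 := memLp_fourierL2 _
  set mN : ℕ → E3 → ℂ := fun N ξ => ∑ j ∈ Finset.Icc (-(N : ℤ)) N, 𝓕 (L.ker j) ξ
  have hmc : ∀ N, Continuous (mN N) := fun N =>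
    continuous_finsetSum _ fun j _ => (𝓕 (L.ker j) : 𝓢(E3, ℂ)).continuous
  have e1 : ∀ N, eLpNorm (fun x => L.partialSum N F x i - f x i) 2 volume =
      (∫⁻ ξ, ‖u ξ * (mN N ξ - 1)‖ₑ ^ (2 : ℝ)) ^ (1 / 2 : ℝ) := by
    intro N
    have hs : MemLp (fun x => L.partialSum N F x i - f x i) 2 :=
      (memLp_partialSum hf h N i).sub (hf.component i)
    rw [← eLpNorm_fourierL2 hs]
    have h2 : fourierL2 (fun x => L.partialSum N F x i - f x i) =ᵐ[volume]
        fun ξ => u ξ * (mN N ξ - 1) := by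
      filter_upwards [fourierL2_sub (memLp_partialSum hf h N i) (hf.component i),
        fourierL2_partialSum hf h N i] with ξ h3 h4
      rw [h3, h4]
      ring
    rw [eLpNorm_congr_ae h2, eLpNorm_eq_lintegral_rpow_enorm_toReal (by simp) (by simp)]
    simp only [ENNReal.toReal_ofNat]
  have hne : ∀ᵐ ξ : E3, ξ ≠ 0 := by
    rw [ae_iff]; simp
  have hdom : Tendsto (fun N => ∫⁻ ξ, ‖u ξ * (mN N ξ - 1)‖ₑ ^ (2 : ℝ)) atTop
      (𝓝 (∫⁻ _ : E3, 0)) := by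
    refine tendsto_lintegral_of_dominated_convergence'
      (fun ξ => (‖u ξ‖ₑ * (5 * L.multBound + 1 : ℝ≥0)) ^ (2 : ℝ)) (fun N => ?_) (fun N => ?_) ?_ ?_
    · exact ((hu.1.mul ((hmc N).sub continuous_const).aestronglyMeasurable).enorm).pow_const _
    · filter_upwards [hne] with ξ hξ
      rw [enorm_mul]
      gcongr
      rw [enorm_eq_nnnorm, ENNReal.coe_le_coe, ← NNReal.coe_le_coe]
      push_cast
      refine (norm_sub_le _ _).trans ?_
      rw [norm_one]
      gcongr
      exact (norm_sum_le _ _).trans (sum_norm_fourier_ker_le _ hξ)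
    · simp only [ENNReal.mul_rpow_of_nonneg _ _ zero_le_two]
      have hc : ((5 * L.multBound + 1 : ℝ≥0) : ℝ≥0∞) ^ (2 : ℝ) ≠ ∞ :=
        ENNReal.rpow_ne_top_of_nonneg zero_le_two ENNReal.coe_ne_top
      rw [lintegral_mul_const' _ _ hc]
      refine ENNReal.mul_ne_top ?_ hc
      have := hu.2
      rw [eLpNorm_eq_lintegral_rpow_enorm_toReal (by simp) (by simp)] at this
      simp only [ENNReal.toReal_ofNat] at this
      intro htop
      rw [htop] at this
      norm_num at this
    · filter_upwards [hne] with ξ hξ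
      have h1 := (L.hasSum_fourier_ker hξ)
      have h2 : Tendsto (fun N : ℕ => Finset.Icc (-(N : ℤ)) N) atTop atTop := by
        refine tendsto_atTop_finset_of_monotone (fun a b hab => ?_) fun j => ⟨j.natAbs, ?_⟩
        · exact Finset.Icc_subset_Icc (by simpa using hab) (by simpa using hab)
        · rw [Finset.mem_Icc]; omega
      have h3 : Tendsto (fun N => mN N ξ) atTop (𝓝 1) := h1.comp h2
      have h4 : Tendsto (fun N => ‖u ξ * (mN N ξ - 1)‖ₑ) atTop (𝓝 ‖u ξ * (1 - 1)‖ₑ) :=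
        ((h3.sub_const 1).const_mul (u ξ)).enorm
      have h5 := h4.ennrpow_const 2
      simpa using h5
  simp only [e1]
  have := hdom.ennrpow_const (1 / 2)
  simpa using this

theorem eLpNorm_mul_schwartz_le (p : E3 → ℂ) (ψ : 𝓢(E3, ℂ)) :
    eLpNorm (fun x => p x * ψ x) 2 volume ≤
      ‖ψ.toBoundedContinuousFunction‖₊ * eLpNorm p 2 := by
  refine eLpNorm_le_nnreal_smul_eLpNorm_of_ae_le_mul (Eventually.of_forall fun x => ?_) 2
  rw [nnnorm_mul, mul_comm]
  gcongr
  exact ψ.toBoundedContinuousFunction.norm_coe_le_norm x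

theorem memLp_mul_schwartz {p : E3 → ℂ} (hp : MemLp p 2) (ψ : 𝓢(E3, ℂ)) :
    MemLp (fun x => p x * ψ x) 2 :=
  ⟨hp.1.mul ψ.continuous.aestronglyMeasurable, (eLpNorm_mul_schwartz_le p ψ).trans_lt
    (ENNReal.mul_lt_top ENNReal.coe_lt_top hp.2)⟩

theorem tendsto_Icc_neg_atTop : Tendsto (fun N : ℕ => Finset.Icc (-(N : ℤ)) N) atTop atTop := by
  refine tendsto_atTop_finset_of_monotone (fun a b hab => ?_) fun j => ⟨j.natAbs, ?_⟩
  · exact Finset.Icc_subset_Icc (by simpa using hab) (by simpa using hab)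
  · rw [Finset.mem_Icc]; omega

theorem tendsto_Icc_neg_product_atTop :
    Tendsto (fun N : ℕ => Finset.Icc (-(N : ℤ)) N ×ˢ Finset.Icc (-(N : ℤ)) N) atTop atTop := by
  refine tendsto_atTop_finset_of_monotone (fun a b hab => ?_) fun j =>
    ⟨max j.1.natAbs j.2.natAbs, ?_⟩
  · have := Finset.Icc_subset_Icc (show -(b : ℤ) ≤ -a by simpa using hab)
      (show (a : ℤ) ≤ b by simpa using hab)
    exact Finset.product_subset_product this this
  · rw [Finset.mem_product, Finset.mem_Icc, Finset.mem_Icc]; omega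

theorem memLp_block_mul_of_represents {g : E3 → Fin 3 → ℂ} {G : VecDist} (hf : MemLp f 2)
    (h : Represents f F) (hg : MemLp g 2) (h' : Represents g G) (j k : ℤ) (a b : Fin 3) :
    MemLp (fun x => L.block j F x a * L.block k G x b) 2 := by
  simp only [block_eq_fourierInv_of_represents hf h, block_eq_fourierInv_of_represents hg h']
  exact memLp_fourierInv_mul (integrable_fourierL2_mul_ker _ j) (memLp_fourierL2_mul_ker _ k)
    (integrable_fourierL2_mul_ker _ k)

/-- For square integrable fields, the product given by the Littlewood--Paley decomposition is the
pointwise product. -/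
theorem isLerayCrossFun_of_hasSum {g : E3 → Fin 3 → ℂ} {G H : VecDist} (hf : MemLp f 2)
    (hg : MemLp g 2) (h : Represents f F) (h' : Represents g G)
    (hs : ∀ Φ : VecSchwartz, (∀ i, IsS0 (Φ i)) →
      HasSum (fun jk : ℤ × ℤ => curlCurlCross (L.block jk.1 F) (L.block jk.2 G) Φ)
        (negLaplacePair H Φ)) : IsLerayCrossFun f g H := by
  intro Φ hΦ
  -- Unconditional convergence allows summation along the squares $[-N,N]^2$, where the double sum
  -- is the product of the two partial sums.
  refine tendsto_nhds_unique ((hs Φ hΦ).comp tendsto_Icc_neg_product_atTop) ?_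
  have hlim := tendsto_curlCurlCross (u := fun N => L.partialSum N F)
    (v := fun N => L.partialSum N G) (f := f) (g := g) Φ
    (fun N a i => memLp_mul_schwartz (memLp_partialSum hf h N a) _)
    (fun N b => memLp_partialSum hg h' N b)
    (fun a i => memLp_mul_schwartz (hf.component a) _) (fun b => hg.component b)
    (fun a i => ?_) (fun b => tendsto_partialSum hg h' b)
  · refine hlim.congr fun N => ?_
    have hmem := memLp_block_mul_of_represents (L := L) hf h hg h'
    have h1 : ∀ j, ∀ i, MemLp (fun x => (L.block j F x ⨯₃ L.partialSum N G x) i) 2 := by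
      intro j
      refine memLp_cross fun a b => ?_
      simp only [partialSum, Finset.sum_apply, Finset.mul_sum]
      exact memLp_finsetSum _ fun k _ => hmem j k a b
    simp only [Function.comp_apply, Finset.sum_product]
    rw [show L.partialSum N F = fun x => ∑ j ∈ Finset.Icc (-(N : ℤ)) N, L.block j F x from rfl,
      curlCurlCross_sum_left _ Φ fun j _ => h1 j]
    refine Finset.sum_congr rfl fun j _ => ?_
    exact curlCurlCross_sum_right _ Φ fun k _ => memLp_cross (hmem j k)
  · have h1 := (tendsto_partialSum (L := L) hf h a)
    have h2 := ENNReal.Tendsto.const_mul (a := (‖(curl (curl Φ) i).toBoundedContinuousFunction‖₊ :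
      ℝ≥0∞)) h1 (Or.inr ENNReal.coe_ne_top)
    rw [mul_zero] at h2
    refine tendsto_of_tendsto_of_tendsto_of_le_of_le tendsto_const_nhds h2
      (fun _ => zero_le) fun N => ?_
    have h3 := eLpNorm_mul_schwartz_le (fun x => L.partialSum N F x a - f x a) (curl (curl Φ) i)
    simp only [sub_mul] at h3
    exact h3

theorem memLp_bounded_mul (hf : AEStronglyMeasurable f) (hM : spaceNorm ∞ f < ∞) {p : E3 → ℂ}
    (hp : MemLp p 2) (a : Fin 3) : MemLp (fun x => f x a * p x) 2 :=
  ⟨((continuous_apply a).comp_aestronglyMeasurable hf).mul hp.1,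
    (eLpNorm_smul_le_eLpNorm_top_mul_eLpNorm 2 hp.1 fun x => f x a).trans_lt
      (ENNReal.mul_lt_top ((eLpNorm_apply_le_spaceNorm ∞ f a).trans_lt hM) hp.2)⟩

/-- For a bounded and a square integrable field, the product given by the Littlewood--Paley
decomposition is the pointwise product. -/
theorem isLerayCrossFun_of_hasSum_bdd {g : E3 → Fin 3 → ℂ} {G H : VecDist}
    (hf : AEStronglyMeasurable f) (hM : spaceNorm ∞ f < ∞)
    (hg : MemLp g 2) (h' : Represents g G)
    (hs : ∀ Φ : VecSchwartz, (∀ i, IsS0 (Φ i)) →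
      HasSum (fun k : ℤ => curlCurlCross f (L.block k G) Φ) (negLaplacePair H Φ)) :
    IsLerayCrossFun f g H := by
  have hmul := fun a (p : E3 → ℂ) (hp : MemLp p 2) => memLp_bounded_mul hf hM hp a
  intro Φ hΦ
  refine tendsto_nhds_unique ((hs Φ hΦ).comp tendsto_Icc_neg_atTop) ?_
  have hlim := tendsto_curlCurlCross (u := fun _ => f)
    (v := fun N => L.partialSum N G) (f := f) (g := g) Φ
    (fun N a i => hmul a _ ((curl (curl Φ) i).memLp 2 volume))
    (fun N b => memLp_partialSum hg h' N b)
    (fun a i => hmul a _ ((curl (curl Φ) i).memLp 2 volume)) (fun b => hg.component b)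
    (fun a i => by simp) (fun b => tendsto_partialSum hg h' b)
  refine hlim.congr fun N => ?_
  exact curlCurlCross_sum_right _ Φ fun k _ => memLp_cross fun a b =>
    hmul a _ (memLp_block_of_represents hg h' k b)

end

end LittlewoodPaley


/-! ### Measurability in time -/

/-- A field continuous in $x$ is determined by a countable dense set of points. Discarding one null
set of times makes it measurable in $t$ there, hence everywhere by limits, and jointly measurable by
Carathéodory's argument. -/
theorem exists_measurable_uncurry {μ : Measure ℝ} {u : ℝ → E3 → ℂ} (hc : ∀ t, Continuous (u t))
    (hm : ∀ x, AEMeasurable (fun t => u t x) μ) :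
    ∃ u' : ℝ → E3 → ℂ, Measurable (Function.uncurry u') ∧ ∀ᵐ t ∂μ, u t = u' t := by
  let d := TopologicalSpace.denseSeq E3
  have hae : ∀ᵐ t ∂μ, ∀ n, u t (d n) = (hm (d n)).mk _ t :=
    ae_all_iff.mpr fun n => (hm (d n)).ae_eq_mk
  obtain ⟨s, hs, hsm, hsμ⟩ := exists_measurable_superset_of_null (ae_iff.mp hae)
  have hgood : ∀ t, t ∉ s → ∀ n, u t (d n) = (hm (d n)).mk _ t := fun t ht => by
    by_contra h
    exact ht (hs h)
  classical
  let u' : ℝ → E3 → ℂ := fun t => if t ∈ s then 0 else u t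
  have hc' : ∀ t, Continuous (u' t) := fun t => by
    by_cases h : t ∈ s
    · simp only [u', h, if_true]
      exact continuous_zero
    · simpa [u', h] using hc t
  have hd : ∀ n, Measurable fun t => u' t (d n) := fun n => by
    have : (fun t => u' t (d n)) = fun t => if t ∈ s then 0 else (hm (d n)).mk _ t := by
      ext t
      by_cases h : t ∈ s
      · simp [u', h]
      · simp [u', h, hgood t h n]
    rw [this]
    exact Measurable.ite hsm measurable_const (hm (d n)).measurable_mk
  have hx : ∀ x, Measurable fun t => u' t x := by
    intro x
    obtain ⟨a, ha, hlim⟩ := mem_closure_iff_seq_limit.mp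
      ((TopologicalSpace.denseRange_denseSeq E3) x)
    choose n hn using ha
    refine measurable_of_tendsto_metrizable (f := fun j t => u' t (a j)) (fun j => ?_)
      (tendsto_pi_nhds.mpr fun t => ((hc' t).tendsto x).comp hlim)
    rw [← hn j]
    exact hd (n j)
  refine ⟨u', ?_, ?_⟩
  · have := measurable_uncurry_of_continuous_of_measurable (u := fun x t => u' t x) hc' hx
    exact this.comp measurable_swap
  · filter_upwards [measure_eq_zero_iff_ae_notMem.mp hsμ] with t ht
    simp [u', ht]

theorem aestronglyMeasurable_uncurry_of_continuous {μ : Measure ℝ} {u : ℝ → E3 → ℂ}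
    (hc : ∀ t, Continuous (u t)) (hm : ∀ x, AEMeasurable (fun t => u t x) μ) :
    AEStronglyMeasurable (Function.uncurry u) (μ.prod (volume : Measure E3)) := by
  obtain ⟨u', h1, h2⟩ := exists_measurable_uncurry hc hm
  refine ⟨_, h1.stronglyMeasurable, ?_⟩
  filter_upwards [Measure.quasiMeasurePreserving_fst.ae h2] with p hp
  simp [Function.uncurry, hp]

variable {μ : Measure ℝ}

theorem aestronglyMeasurable_block (L : LittlewoodPaley) {u : ℝ → VecDist}
    (hu : ∀ i (φ : 𝓢(E3, ℂ)), IsS0 φ → AEMeasurable (fun t => u t i φ) μ) (k : ℤ) (i : Fin 3) :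
    AEStronglyMeasurable (Function.uncurry fun t x => L.block k (u t) x i)
      (μ.prod (volume : Measure E3)) :=
  aestronglyMeasurable_uncurry_of_continuous
    (fun t => (continuous_apply i).comp (continuous_conv (L.ker k) (u t)))
    fun x => hu i _ (L.isS0_reflectAt_ker k x)

theorem aestronglyMeasurable_toLp {v : ℝ → E3 → Fin 3 → ℂ} [SFinite μ]
    (hv : ∀ i, AEStronglyMeasurable (Function.uncurry fun t x => v t x i)
      (μ.prod (volume : Measure E3))) :
    AEStronglyMeasurable (fun p : ℝ × E3 => (WithLp.toLp 2 (v p.1 p.2) : EuclideanSpace ℂ (Fin 3)))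
      (μ.prod (volume : Measure E3)) :=
  (PiLp.continuous_toLp 2 _).comp_aestronglyMeasurable
    (aemeasurable_pi_iff.mpr fun i => (hv i).aemeasurable).aestronglyMeasurable

theorem aemeasurable_spaceNorm_two {v : ℝ → E3 → Fin 3 → ℂ} [SFinite μ]
    (hv : ∀ i, AEStronglyMeasurable (Function.uncurry fun t x => v t x i)
      (μ.prod (volume : Measure E3))) : AEMeasurable (fun t => spaceNorm 2 (v t)) μ := by
  unfold spaceNorm
  simp only [eLpNorm_eq_lintegral_rpow_enorm_toReal (p := 2) (by simp) (by simp)]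
  exact (((aestronglyMeasurable_toLp hv).enorm.pow_const _).lintegral_prod_right').pow_const _

/-- The essential supremum of a slice exceeds `c` exactly when the slice of a superlevel set has
positive measure, and that measure is measurable in $t$. -/
theorem aemeasurable_essSup_prod [SFinite μ] {g : ℝ × E3 → ℝ≥0∞}
    (hg : AEMeasurable g (μ.prod (volume : Measure E3))) :
    AEMeasurable (fun t => essSup (fun x => g (t, x)) (volume : Measure E3)) μ := by
  refine ⟨fun t => essSup (fun x => hg.mk g (t, x)) (volume : Measure E3), ?_, ?_⟩
  · refine measurable_of_Ioi fun c => ?_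
    have : (fun t => essSup (fun x => hg.mk g (t, x)) (volume : Measure E3)) ⁻¹' Set.Ioi c =
        {t | volume (Prod.mk t ⁻¹' (hg.mk g ⁻¹' Set.Ioi c)) ≠ 0} := by
      ext t
      simp only [Set.mem_preimage, Set.mem_Ioi, Set.mem_ofPred_eq]
      constructor
      · intro h h0
        refine h.not_ge (essSup_le_of_ae_le c ?_)
        filter_upwards [measure_eq_zero_iff_ae_notMem.mp h0] with x hx
        simpa using hx
      · intro h
        by_contra! hle
        apply h
        rw [measure_eq_zero_iff_ae_notMem]
        filter_upwards [ENNReal.ae_le_essSup fun x => hg.mk g (t, x)] with x hx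
        simpa using hx.trans hle
    rw [this]
    exact (measurable_measure_prodMk_left (hg.measurable_mk measurableSet_Ioi))
      (measurableSet_singleton 0).compl
  · filter_upwards [Measure.ae_ae_of_ae_prod hg.ae_eq_mk] with t ht
    exact essSup_congr_ae ht

theorem aemeasurable_spaceNorm_top {v : ℝ → E3 → Fin 3 → ℂ} [SFinite μ]
    (hv : ∀ i, AEStronglyMeasurable (Function.uncurry fun t x => v t x i)
      (μ.prod (volume : Measure E3))) : AEMeasurable (fun t => spaceNorm ∞ (v t)) μ := by
  unfold spaceNorm
  simp only [eLpNorm_exponent_top, eLpNormEssSup]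
  have h := (aestronglyMeasurable_toLp hv).enorm
  exact aemeasurable_essSup_prod
    (g := fun p => ‖(WithLp.toLp 2 (v p.1 p.2) : EuclideanSpace ℂ (Fin 3))‖ₑ) h

theorem leraySym_apply_eq_sum (ξ : E3) (X : Fin 3 → ℂ) (i : Fin 3) :
    leraySym ξ X i = ∑ b, leraySym ξ (Pi.single b 1) i * X b := by
  have h : X = ∑ b, X b • (Pi.single b 1 : Fin 3 → ℂ) := by
    funext j
    simp [Finset.sum_apply, Pi.single_apply]
  have hs : ∀ (c : ℂ) (Y : Fin 3 → ℂ), leraySym ξ (c • Y) = c • leraySym ξ Y := fun c Y => by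
    simp only [leraySym, map_smul, smul_neg, smul_comm c]
  conv_lhs => rw [h, leraySym_sum, Finset.sum_apply]
  simp only [hs, Pi.smul_apply, smul_eq_mul, mul_comm]

/-- The transform is chosen separately at each time, with no joint measurability in $(t,\xi)$.
Duality moves it to the fixed functions `g b`, which leaves an integral of `y` with a parameter. -/
theorem aemeasurable_integral_lerayFT [SFinite μ] {y : ℝ → E3 → Fin 3 → ℂ}
    (hy : ∀ i, AEStronglyMeasurable (Function.uncurry fun t x => y t x i)
      (μ.prod (volume : Measure E3)))
    (hy2 : ∀ᵐ t ∂μ, ∀ i, MemLp (fun x => y t x i) 2) (i : Fin 3) (φ : 𝓢(E3, ℂ)) :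
    AEMeasurable (fun t => ∫ ξ, lerayFT (y t) ξ i * 𝓕⁻ φ ξ) μ := by
  set g : Fin 3 → E3 → ℂ := fun b ξ => leraySym ξ (Pi.single b 1) i * 𝓕⁻ φ ξ
  have hsm : ∀ b, AEStronglyMeasurable fun ξ => leraySym ξ (Pi.single b (1 : ℂ) : Fin 3 → ℂ) i :=
    fun b => (aemeasurable_pi_iff.mp (aemeasurable_leraySym
      (X := fun _ => (Pi.single b (1 : ℂ) : Fin 3 → ℂ)) aemeasurable_const) i).aestronglyMeasurable
  have hsb : ∀ b (ξ : E3), ‖leraySym ξ (Pi.single b (1 : ℂ) : Fin 3 → ℂ) i‖ ≤ 4 := fun b ξ => by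
    refine (norm_le_pi_norm _ i).trans ((norm_leraySym_le ξ _).trans ?_)
    have : ‖(Pi.single b (1 : ℂ) : Fin 3 → ℂ)‖ ≤ 1 := by
      refine (pi_norm_le_iff_of_nonneg zero_le_one).mpr fun j => ?_
      rw [Pi.single_apply]
      split_ifs <;> simp
    linarith
  have hg1 : ∀ b, Integrable (g b) := fun b =>
    ((𝓕⁻ φ).integrable (μ := volume)).bdd_mul (c := 4) (hsm b) (Eventually.of_forall (hsb b))
  have hg2 : ∀ b, MemLp (g b) 2 := fun b =>
    MemLp.of_le_mul (c := 4) ((𝓕⁻ φ).memLp 2 volume) (hg1 b).1 (Eventually.of_forall fun ξ => by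
      rw [norm_mul]
      gcongr
      exact hsb b ξ)
  have key : ∀ᵐ t ∂μ, ∑ b, ∫ x, y t x b * 𝓕 (g b) x = ∫ ξ, lerayFT (y t) ξ i * 𝓕⁻ φ ξ := by
    filter_upwards [hy2] with t ht
    have h1 : ∀ b, Integrable fun ξ => fourierVec (y t) ξ b * g b ξ := fun b =>
      (memLp_fourierL2 fun x => y t x b).integrable_mul (hg2 b)
    have h2 : ∀ b, ∫ x, y t x b * 𝓕 (g b) x = ∫ ξ, fourierVec (y t) ξ b * g b ξ := fun b =>
      (integral_fourierL2_mul (ht b) (hg2 b) (hg1 b)).symm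
    simp only [h2]
    rw [← integral_finsetSum _ fun b _ => h1 b]
    congr 1
    ext ξ
    rw [lerayFT, leraySym_apply_eq_sum, Finset.sum_mul]
    refine Finset.sum_congr rfl fun b _ => ?_
    simp only [g]
    ring
  refine AEMeasurable.congr ?_ key
  refine Finset.aemeasurable_fun_sum _ fun b _ => ?_
  have h3 : AEStronglyMeasurable (fun p : ℝ × E3 => y p.1 p.2 b * 𝓕 (g b) p.2)
      (μ.prod (volume : Measure E3)) :=
    (hy b).mul ((continuous_fourier_of_integrable (hg1 b)).comp continuous_snd).aestronglyMeasurable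
  exact h3.integral_prod_right'.aemeasurable

/-- The Leray projection of a series of time-dependent fields. -/
theorem exists_leray_of_series [SFinite μ] (L : LittlewoodPaley) {ι : Type*} [Countable ι]
    {y : ι → ℝ → E3 → Fin 3 → ℂ}
    (hy : ∀ n i, AEStronglyMeasurable (Function.uncurry fun t x => y n t x i)
      (μ.prod (volume : Measure E3)))
    (hy2 : ∀ᵐ t ∂μ, ∀ n i, MemLp (fun x => y n t x i) 2) {b : ι → ℤ → ℝ → ℝ≥0∞}
    (hb : ∀ᵐ t ∂μ, ∀ n m, annNorm m (lerayFT (y n t)) ≤ b n m t) {N : ℕ}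
    (hfin : ∀ᵐ t ∂μ, ∑' m : ℤ, (2 : ℝ≥0∞) ^ (-(N * |(m : ℝ)|)) * ∑' n, b n m t < ∞) :
    ∃ H : ℝ → VecDist, (∀ i (φ : 𝓢(E3, ℂ)), IsS0 φ → AEMeasurable (fun t => H t i φ) μ) ∧
      ∀ᵐ t ∂μ, (∀ Φ : VecSchwartz, (∀ i, IsS0 (Φ i)) →
        HasSum (fun n => ∫ x, y n t x ⬝ᵥ fun i => curl (curl Φ) i x) (negLaplacePair (H t) Φ)) ∧
        ∀ m, spaceNorm 2 (L.block m (H t)) ≤ 3 * L.multBound * ∑' n, b n m t := by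
  -- The value at times where the series is not controlled is arbitrary; these times form a null
  -- set.
  have hex : ∀ t, ∃ H : VecDist, (∑' n, synthNorm N (lerayFT (y n t)) < ∞) →
      ∀ i φ, IsS0 φ → HasSum (fun n => ∫ ξ, lerayFT (y n t) ξ i * 𝓕⁻ φ ξ) (H i φ) := by
    intro t
    by_cases h : ∑' n, synthNorm N (lerayFT (y n t)) < ∞
    · obtain ⟨H, hH⟩ := exists_hasSum_fourierInv (fun n i => memLp_lerayFT (y n t) i) h
      exact ⟨H, fun _ => hH⟩
    · exact ⟨0, fun h' => absurd h' h⟩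
  choose H hH using hex
  have hgood : ∀ᵐ t ∂μ, ∀ i φ, IsS0 φ →
      HasSum (fun n => ∫ ξ, lerayFT (y n t) ξ i * 𝓕⁻ φ ξ) (H t i φ) := by
    filter_upwards [hb, hfin] with t h1 h2
    refine hH t (lt_of_le_of_lt ?_ h2)
    unfold synthNorm
    rw [ENNReal.tsum_comm]
    refine ENNReal.tsum_le_tsum fun m => ?_
    rw [ENNReal.tsum_mul_left]
    gcongr with n
    exact h1 n m
  refine ⟨H, fun i φ hφ => ?_, ?_⟩
  · have hmeas : ∀ n, AEMeasurable (fun t => ∫ ξ, lerayFT (y n t) ξ i * 𝓕⁻ φ ξ) μ := fun n =>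
      aemeasurable_integral_lerayFT (hy n) (hy2.mono fun t ht => ht n) i φ
    refine aemeasurable_of_tendsto_metrizable_ae (atTop : Filter (Finset ι))
      (f := fun s t => ∑ n ∈ s, ∫ ξ, lerayFT (y n t) ξ i * 𝓕⁻ φ ξ)
      (fun s => Finset.aemeasurable_fun_sum s fun n _ => hmeas n) ?_
    filter_upwards [hgood] with t ht
    exact ht i φ hφ
  · filter_upwards [hgood, hb, hy2] with t h1 h2 h3
    refine ⟨fun Φ hΦ => hasSum_negLaplacePair h3 h1 hΦ, fun m => ?_⟩
    refine (spaceNorm_block_le_tsum L (fun n i => memLp_lerayFT (y n t) i) h1 m).trans ?_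
    gcongr with n
    exact h2 n m


/-! ### Sequences and Lebesgue norms of functions with values in `[0, ∞]` -/

section Lebesgue

variable {α : Type*} [MeasurableSpace α] {μ : Measure α} {f g : α → ℝ≥0∞} {p : ℝ≥0∞}

theorem eLpNorm_const_mul_le (c : ℝ≥0∞) (hf : AEMeasurable f μ) :
    eLpNorm (fun x => c * f x) p μ ≤ c * eLpNorm f p μ :=
  eLpNorm_le_mul_eLpNorm_of_ae_le_mul'' p hf.aestronglyMeasurable (ae_of_all _ fun x => by simp)

theorem ae_lt_top_of_eLpNorm (hf : AEMeasurable f μ) (hp : 1 ≤ p) (h : eLpNorm f p μ < ∞) :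
    ∀ᵐ x ∂μ, f x < ∞ := by
  rcases eq_or_ne p ∞ with rfl | hp'
  · rw [eLpNorm_exponent_top] at h
    filter_upwards [ae_le_eLpNormEssSup (f := f) (μ := μ)] with x hx
    exact lt_of_le_of_lt hx h
  · have hp0 : p ≠ 0 := (zero_lt_one.trans_le hp).ne'
    have h1 := lintegral_rpow_enorm_lt_top_of_eLpNorm_lt_top hp0 hp' h
    simp only [enorm_eq_self] at h1
    filter_upwards [ae_lt_top' (hf.pow_const _) h1.ne] with x hx
    exact (ENNReal.rpow_lt_top_iff_of_pos (ENNReal.toReal_pos hp0 hp')).mp hx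

/-- Finite norms make both factors finite almost everywhere, so that Hölder's inequality for real
functions applies to `toReal`. -/
theorem eLpNorm_mul_le {q r : ℝ≥0∞} (hf : AEMeasurable f μ) (hg : AEMeasurable g μ)
    (hp : 1 ≤ p) (hq : 1 ≤ q) (hr : r⁻¹ = p⁻¹ + q⁻¹) (hfp : eLpNorm f p μ < ∞)
    (hgq : eLpNorm g q μ < ∞) :
    eLpNorm (fun x => f x * g x) r μ ≤ eLpNorm f p μ * eLpNorm g q μ := by
  have : ENNReal.HolderTriple p q r := ⟨hr.symm⟩
  have key : ∀ {h : α → ℝ≥0∞} {p' : ℝ≥0∞}, (∀ᵐ x ∂μ, h x < ∞) →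
      eLpNorm (fun x => (h x).toReal) p' μ = eLpNorm h p' μ := fun hh =>
    eLpNorm_congr_enorm_ae (hh.mono fun x hx => by
      simp [Real.enorm_eq_ofReal, ENNReal.ofReal_toReal hx.ne])
  have hf' := ae_lt_top_of_eLpNorm hf hp hfp
  have hg' := ae_lt_top_of_eLpNorm hg hq hgq
  rw [← key hf', ← key hg', ← key (h := fun x => f x * g x)]
  · have h := eLpNorm_smul_le_mul_eLpNorm (p := p) (q := q) (r := r) (μ := μ)
      hg.ennreal_toReal.aestronglyMeasurable hf.ennreal_toReal.aestronglyMeasurable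
    refine le_trans (le_of_eq ?_) h
    congr 1 with x
    simp
  · filter_upwards [hf', hg'] with x h1 h2
    exact ENNReal.mul_lt_top h1 h2

end Lebesgue

theorem eLpNorm_shift (f : ℤ → ℝ≥0∞) (n : ℤ) (c : ℝ≥0∞) :
    eLpNorm (fun m => f (m + n)) c Measure.count = eLpNorm f c Measure.count := by
  have h : MeasurePreserving (fun m : ℤ => m + n) Measure.count Measure.count := by
    exact measurePreserving_add_right _ n
  exact eLpNorm_comp_measurePreserving (f := fun m : ℤ => m + n)
    (measurable_of_countable f).aestronglyMeasurable h

theorem eLpNorm_convolution_le {ρ f : ℤ → ℝ≥0∞} {c : ℝ≥0∞} (hc : 1 ≤ c) :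
    eLpNorm (fun m => ∑' q, ρ q * f (m + q)) c Measure.count ≤
      (∑' q, ρ q) * eLpNorm f c Measure.count := by
  refine (eLpNorm_enorm_tsum_le (fun q => (measurable_of_countable _).aemeasurable) hc).trans ?_
  rw [← ENNReal.tsum_mul_right]
  refine ENNReal.tsum_le_tsum fun q => ?_
  refine (eLpNorm_const_mul_le _ (measurable_of_countable _).aemeasurable).trans ?_
  rw [eLpNorm_shift f q]

/-- Minkowski over the shifts `n`, then Hölder in `m` for each shift, the norms being invariant
under translation. -/
theorem eLpNorm_convolution_mul_le {κ : ℤ × ℤ → ℝ≥0∞} {f g : ℤ → ℝ≥0∞} {c c₁ c₂ : ℝ≥0∞}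
    (hc : 1 ≤ c) (h1 : 1 ≤ c₁) (h2 : 1 ≤ c₂) (hr : c⁻¹ = c₁⁻¹ + c₂⁻¹)
    (hf : eLpNorm f c₁ Measure.count < ∞) (hg : eLpNorm g c₂ Measure.count < ∞) :
    eLpNorm (fun m => ∑' n : ℤ × ℤ, κ n * (f (m + n.1) * g (m + n.2))) c Measure.count ≤
      (∑' n, κ n) * (eLpNorm f c₁ Measure.count * eLpNorm g c₂ Measure.count) := by
  refine (eLpNorm_enorm_tsum_le (fun q => (measurable_of_countable _).aemeasurable) hc).trans ?_
  rw [← ENNReal.tsum_mul_right]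
  refine ENNReal.tsum_le_tsum fun n => ?_
  refine (eLpNorm_const_mul_le _ (measurable_of_countable _).aemeasurable).trans ?_
  gcongr
  rw [← eLpNorm_shift f n.1, ← eLpNorm_shift g n.2]
  exact eLpNorm_mul_le (measurable_of_countable _).aemeasurable
    (measurable_of_countable _).aemeasurable h1 h2 hr (by rwa [eLpNorm_shift])
    (by rwa [eLpNorm_shift])

theorem tsum_shift (g : ℤ → ℝ≥0∞) (m : ℤ) :
    ∑' q, g (m + q) = eLpNorm g 1 Measure.count := by
  rw [eLpNorm_one_eq_lintegral_enorm, lintegral_count]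
  simpa using (Equiv.addLeft m).tsum_eq g

/-- With a kernel bounded in terms of the first index alone, the sum over the second is the full
$\ell^1$ norm of `g`, independent of `m`. A scalar convolution remains. -/
theorem eLpNorm_convolution_left_le {κ : ℤ × ℤ → ℝ≥0∞} {ρ f g : ℤ → ℝ≥0∞} {c : ℝ≥0∞} (hc : 1 ≤ c)
    (hκ : ∀ p q, κ (p, q) ≤ ρ p) :
    eLpNorm (fun m => ∑' n : ℤ × ℤ, κ n * (f (m + n.1) * g (m + n.2))) c Measure.count ≤
      (∑' p, ρ p) * (eLpNorm f c Measure.count * eLpNorm g 1 Measure.count) := by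
  rw [← mul_assoc, mul_comm]
  refine le_trans ?_ (mul_le_mul_right (eLpNorm_convolution_le hc) _)
  refine le_trans ?_ (eLpNorm_const_mul_le _ (measurable_of_countable _).aemeasurable)
  refine eLpNorm_mono_enorm fun m => ?_
  simp only [enorm_eq_self]
  rw [ENNReal.tsum_prod', ← ENNReal.tsum_mul_left]
  refine ENNReal.tsum_le_tsum fun p => ?_
  calc ∑' q, κ (p, q) * (f (m + p) * g (m + q)) ≤ ∑' q, ρ p * f (m + p) * g (m + q) :=
        ENNReal.tsum_le_tsum fun q => by
          rw [← mul_assoc]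
          gcongr
          exact hκ p q
    _ = eLpNorm g 1 Measure.count * (ρ p * f (m + p)) := by
        rw [ENNReal.tsum_mul_left, tsum_shift, mul_comm]

theorem eLpNorm_convolution_one_le {κ : ℤ × ℤ → ℝ≥0∞} {ρ ρ' f g : ℤ → ℝ≥0∞}
    (hκ : ∀ p q, κ (p, q) ≤ ρ p + ρ' q) :
    eLpNorm (fun m => ∑' n : ℤ × ℤ, κ n * (f (m + n.1) * g (m + n.2))) 1 Measure.count ≤
      ((∑' p, ρ p) + ∑' q, ρ' q) * (eLpNorm f 1 Measure.count * eLpNorm g 1 Measure.count) := by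
  have h1 := eLpNorm_convolution_left_le (κ := fun n => ρ n.1) (ρ := ρ) (f := f) (g := g) le_rfl
    fun _ _ => le_rfl
  have h2 := eLpNorm_convolution_left_le (κ := fun n => ρ' n.1) (ρ := ρ') (f := g) (g := f) le_rfl
    fun _ _ => le_rfl
  rw [add_mul]
  refine le_trans ?_ (add_le_add h1 (h2.trans_eq (by rw [mul_comm (eLpNorm g 1 _)])))
  refine le_trans (eLpNorm_mono_enorm fun m => ?_) (eLpNorm_add_le
    (measurable_of_countable _).aestronglyMeasurable
    (measurable_of_countable _).aestronglyMeasurable le_rfl)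
  simp only [enorm_eq_self, Pi.add_apply]
  rw [← (Equiv.prodComm ℤ ℤ).tsum_eq fun n : ℤ × ℤ => ρ' n.1 * (g (m + n.1) * f (m + n.2)),
    ← ENNReal.tsum_add]
  refine ENNReal.tsum_le_tsum fun n => ?_
  simp only [Equiv.prodComm_apply, Prod.fst_swap, Prod.snd_swap]
  rw [mul_comm (g _), ← add_mul]
  gcongr
  exact hκ n.1 n.2


/-! ### Summability of the kernels -/

/-- A two-sided geometric sequence. -/
def geomKer (θ : ℝ) (p : ℤ) : ℝ≥0∞ := (2 : ℝ≥0∞) ^ (-(θ * |(p : ℝ)|))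

theorem tsum_geomKer_lt_top {θ : ℝ} (h : 0 < θ) : ∑' p, geomKer θ p < ∞ := by
  have h1 : ∀ p : ℤ, geomKer θ p = ENNReal.ofReal (((2 : ℝ) ^ (-θ)) ^ p.natAbs) := by
    intro p
    rw [← Real.rpow_natCast, ← Real.rpow_mul two_pos.le, ← ENNReal.ofReal_rpow_of_pos two_pos,
      geomKer, Nat.cast_natAbs, Int.cast_abs, neg_mul]
    simp
  have h2 : Summable fun n : ℕ => ((2 : ℝ) ^ (-θ)) ^ n :=
    summable_geometric_of_lt_one (by positivity)
      (Real.rpow_lt_one_of_one_lt_of_neg one_lt_two (by linarith))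
  simp only [h1]
  exact (Summable.tsum_ofReal_ne_top (summable_int_iff_summable_nat_and_neg.mpr
    ⟨by simpa using h2, by simpa using h2⟩)).lt_top

theorem two_rpow_le {x y : ℝ} (h : x ≤ y) : (2 : ℝ≥0∞) ^ x ≤ 2 ^ y :=
  ENNReal.rpow_le_rpow_of_exponent_le one_le_two h

theorem two_rpow_add (x y : ℝ) : (2 : ℝ≥0∞) ^ (x + y) = 2 ^ x * 2 ^ y :=
  ENNReal.rpow_add _ _ two_ne_zero ENNReal.ofNat_ne_top

/-- Scaling: a common shift of the three indices is a dilation of space. It turns the sums over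
blocks into convolutions. -/
theorem paraKer_add (m p q : ℤ) :
    paraKer m (m + p) (m + q) = 2 ^ ((3 / 2 : ℝ) * m) * paraKer 0 p q := by
  have e1 : (m + p + 4 ≤ m + q) = (p + 4 ≤ q) := by simp only [eq_iff_iff]; omega
  have e2 : (m + q + 4 ≤ m + p) = (q + 4 ≤ p) := by simp only [eq_iff_iff]; omega
  have e3 : ∀ x : ℤ, |m - (m + x)| = |0 - x| := fun x => by congr 1; ring
  have e4 : (m ≤ max (m + p) (m + q) + 3) = (0 ≤ max p q + 3) := by
    simp only [eq_iff_iff]; omega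
  simp only [paraKer, e1, e2, e3, e4]
  split_ifs <;> simp only [mul_zero, ← two_rpow_add] <;> push_cast <;> congr 1 <;> ring

theorem bddKer_add (m q : ℤ) : bddKer m (m + q) = bddKer 0 q := by
  have e3 : |m - (m + q)| = |0 - q| := by congr 1; ring
  have e4 : (m + q ≤ m) = (q ≤ 0) := by simp only [eq_iff_iff]; omega
  simp only [bddKer, e3, e4]
  split_ifs <;> push_cast <;> congr 1 <;> ring

/-- The kernel of the bilinear estimate, weighted by the regularity exponents. -/
def weightKer (s η : ℝ) (n : ℤ × ℤ) : ℝ≥0∞ :=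
  paraKer 0 n.1 n.2 * 2 ^ (-(n.1 * s + n.2 * η) : ℝ)

/-- A weighted kernel is dominated by a power of two if all its exponents are. -/
theorem weightKer_le {s η x : ℝ} {p q : ℤ}
    (h1 : (p : ℝ) ≤ -1 → |(q : ℝ)| ≤ 3 → (3 / 2 - s) * p - η * q ≤ x)
    (h2 : (q : ℝ) ≤ -1 → |(p : ℝ)| ≤ 3 → (5 / 2 - η) * q - s * p ≤ x)
    (h3 : |(p : ℝ) - q| ≤ 3 → -6 ≤ (p : ℝ) → -6 ≤ (q : ℝ) → -(s * p) - η * q ≤ x) :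
    weightKer s η (p, q) ≤ 2 ^ x := by
  have hc : ∀ {z : ℤ} {n : ℤ}, |z| ≤ n → |(z : ℝ)| ≤ n := fun h => by exact_mod_cast h
  simp only [weightKer, paraKer]
  split_ifs with a b a' b' b'
  · rw [← two_rpow_add]
    rw [abs_le] at b
    have hp : (p : ℝ) ≤ -1 := by exact_mod_cast (by omega : p ≤ -1)
    have hq : |(q : ℝ)| ≤ 3 := by exact_mod_cast (abs_le.mpr (by omega) : |q| ≤ 3)
    refine two_rpow_le (le_trans (le_of_eq ?_) (h1 hp hq))
    ring
  · simp
  · rw [← two_rpow_add]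
    rw [abs_le] at b'
    have hp : (q : ℝ) ≤ -1 := by exact_mod_cast (by omega : q ≤ -1)
    have hq : |(p : ℝ)| ≤ 3 := by exact_mod_cast (abs_le.mpr (by omega) : |p| ≤ 3)
    refine two_rpow_le (le_trans (le_of_eq ?_) (h2 hp hq))
    push_cast
    ring
  · simp
  · rw [← two_rpow_add]
    have hp : -6 ≤ (p : ℝ) := by exact_mod_cast (by omega : -6 ≤ p)
    have hp' : -6 ≤ (q : ℝ) := by exact_mod_cast (by omega : -6 ≤ q)
    have hq : |(p : ℝ) - q| ≤ 3 := by exact_mod_cast (abs_le.mpr (by omega) : |p - q| ≤ 3)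
    refine two_rpow_le (le_trans (le_of_eq ?_) (h3 hq hp hp'))
    push_cast
    ring
  · simp

theorem tsum_weightKer_lt_top {s η : ℝ} (hs : s < 3 / 2) (hη : η < 5 / 2) (h : 0 < s + η) :
    ∑' n, weightKer s η n < ∞ := by
  -- The three gaps are the decay rates of the three regimes. The last one is halved because `p` and
  -- `q` grow together in the resonant regime and both factors need decay.
  obtain ⟨θ, h0, h1, h2, h3⟩ : ∃ θ : ℝ, 0 < θ ∧ θ ≤ 3 / 2 - s ∧ θ ≤ 5 / 2 - η ∧ 2 * θ ≤ s + η :=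
    ⟨min (3 / 2 - s) (min (5 / 2 - η) ((s + η) / 2)),
      lt_min (by linarith) (lt_min (by linarith) (by linarith)),
      min_le_left _ _, (min_le_right _ _).trans (min_le_left _ _), by
        have := (min_le_right (3 / 2 - s) _).trans (min_le_right (5 / 2 - η) ((s + η) / 2))
        linarith⟩
  set K : ℝ := 3 * |η| + 3 * |s| + 20 * θ + 6 * (s + η)
  have hle : ∀ p q : ℤ, weightKer s η (p, q) ≤ 2 ^ K * (geomKer θ p * geomKer θ q) := by
    intro p q
    rw [geomKer, geomKer, ← two_rpow_add, ← two_rpow_add]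
    have bd : ∀ x y : ℝ, |x| ≤ 3 → -(y * x) ≤ 3 * |y| := fun x y hx => by
      calc -(y * x) ≤ |y * x| := neg_le_abs _
        _ = |x| * |y| := by rw [abs_mul, mul_comm]
        _ ≤ 3 * |y| := by gcongr
    have a1 := abs_nonneg s
    have a2 := abs_nonneg η
    refine weightKer_le (fun hp hq => ?_) (fun hq hp => ?_) fun hpq hp hq => ?_
    · rw [abs_of_nonpos (by linarith : (p : ℝ) ≤ 0)]
      nlinarith [bd _ η hq]
    · rw [abs_of_nonpos (by linarith : (q : ℝ) ≤ 0)]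
      nlinarith [bd _ s hp]
    · have e1 := bd _ (-η) hpq
      rw [abs_neg] at e1
      have e2 : |(q : ℝ)| ≤ |(p : ℝ)| + 3 := by
        have := abs_sub_abs_le_abs_sub (q : ℝ) p
        rw [abs_sub_comm] at this
        linarith
      rcases le_or_gt 0 (p : ℝ) with hp0 | hp0
      · rw [abs_of_nonneg hp0] at e2 ⊢
        nlinarith
      · rw [abs_of_neg hp0] at e2 ⊢
        nlinarith
  calc ∑' n, weightKer s η n ≤ ∑' n : ℤ × ℤ, 2 ^ K * (geomKer θ n.1 * geomKer θ n.2) :=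
        ENNReal.tsum_le_tsum fun n => hle n.1 n.2
    _ = 2 ^ K * ((∑' p, geomKer θ p) * ∑' q, geomKer θ q) := by
        rw [ENNReal.tsum_mul_left, ENNReal.tsum_prod']
        simp only [ENNReal.tsum_mul_left, ENNReal.tsum_mul_right]
    _ < ∞ := ENNReal.mul_lt_top (two_rpow_ne_top _).lt_top
        (ENNReal.mul_lt_top (tsum_geomKer_lt_top h0) (tsum_geomKer_lt_top h0))

/-- At $\eta=5/2$ the regime of low `q` does not decay in `q`, but `p` is confined to $|p|\le3$
there. The other two regimes decay in `p` at the rates $3/2-s$ and $s+5/2$. -/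
theorem exists_weightKer_le_left {s : ℝ} (hs : s < 3 / 2) (hs' : -(5 / 2) < s) :
    ∃ ρ : ℤ → ℝ≥0∞, ∑' p, ρ p < ∞ ∧ ∀ p q, weightKer s (5 / 2) (p, q) ≤ ρ p := by
  obtain ⟨θ, h0, h1, h2⟩ : ∃ θ : ℝ, 0 < θ ∧ θ ≤ 3 / 2 - s ∧ θ ≤ s + 5 / 2 :=
    ⟨min (3 / 2 - s) (s + 5 / 2), lt_min (by linarith) (by linarith),
      min_le_left _ _, min_le_right _ _⟩
  set K : ℝ := 100 + 20 * θ + 20 * |s|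
  refine ⟨fun p => 2 ^ K * geomKer θ p, ?_, fun p q => ?_⟩
  · rw [ENNReal.tsum_mul_left]
    exact ENNReal.mul_lt_top (two_rpow_ne_top _).lt_top (tsum_geomKer_lt_top h0)
  · simp only [geomKer, ← two_rpow_add]
    have a1 := abs_nonneg s
    refine weightKer_le (fun hp hq => ?_) (fun hq hp => ?_) fun hpq hp hq => ?_
    · rw [abs_of_nonpos (by linarith : (p : ℝ) ≤ 0)]
      rw [abs_le] at hq
      nlinarith
    · have : -(s * p) ≤ 3 * |s| := by
        calc -(s * p) ≤ |s * p| := neg_le_abs _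
          _ = |(p : ℝ)| * |s| := by rw [abs_mul, mul_comm]
          _ ≤ 3 * |s| := by gcongr
      nlinarith
    · rw [abs_le] at hpq
      have hs1 := le_abs_self s
      rcases le_or_gt 0 (p : ℝ) with hp0 | hp0
      · rw [abs_of_nonneg hp0]
        nlinarith
      · rw [abs_of_neg hp0]
        nlinarith

/-- Neither low regime decays any more, but in each the other index is confined to $[-3,3]$; the
resonant regime decays in both. The kernel is thus controlled by the index of smaller absolute
value. The exponent 100 is generous. -/
theorem exists_weightKer_le_add :
    ∃ ρ ρ' : ℤ → ℝ≥0∞, ∑' p, ρ p < ∞ ∧ ∑' q, ρ' q < ∞ ∧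
      ∀ p q, weightKer (3 / 2) (5 / 2) (p, q) ≤ ρ p + ρ' q := by
  have hfin : ∑' p, (2 : ℝ≥0∞) ^ (100 : ℝ) * geomKer 1 p < ∞ := by
    rw [ENNReal.tsum_mul_left]
    exact ENNReal.mul_lt_top (two_rpow_ne_top _).lt_top (tsum_geomKer_lt_top one_pos)
  refine ⟨_, _, hfin, hfin, fun p q => ?_⟩
  simp only [geomKer, ← two_rpow_add]
  rcases le_total (100 + -(1 * |(p : ℝ)|)) (100 + -(1 * |(q : ℝ)|)) with h | h
  · refine le_trans ?_ le_add_self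
    refine weightKer_le (fun hp hq => ?_) (fun hq hp => ?_) fun hpq hp hq => ?_
    · rw [abs_le] at hq
      linarith [abs_le.mpr hq]
    · rw [abs_le] at hp
      linarith [abs_le.mpr hp]
    · rw [abs_le] at hpq
      rcases abs_cases (p : ℝ) with h' | h' <;> linarith
  · refine le_trans ?_ le_self_add
    refine weightKer_le (fun hp hq => ?_) (fun hq hp => ?_) fun hpq hp hq => ?_
    · rw [abs_le] at hq
      linarith [abs_le.mpr hq]
    · rw [abs_le] at hp
      linarith [abs_le.mpr hp]
    · rw [abs_le] at hpq
      rcases abs_cases (p : ℝ) with h' | h' <;> linarith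

/-- The two tails decay geometrically at the rates $5/2-\eta$ for negative and $3/2+\eta$ for
positive `q`, which is the range of $\eta$ in the second case. -/
theorem tsum_bddKer_lt_top {η : ℝ} (h : -(3 / 2) < η) (h' : η < 5 / 2) :
    ∑' q : ℤ, bddKer 0 q * 2 ^ (-(q * η) : ℝ) < ∞ := by
  obtain ⟨θ, h0, h1, h2⟩ : ∃ θ : ℝ, 0 < θ ∧ θ ≤ 3 / 2 + η ∧ θ ≤ 5 / 2 - η :=
    ⟨min (3 / 2 + η) (5 / 2 - η), lt_min (by linarith) (by linarith),
      min_le_left _ _, min_le_right _ _⟩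
  set K : ℝ := 7 * θ + 7 * |η|
  have hle : ∀ q : ℤ, bddKer 0 q * 2 ^ (-(q * η) : ℝ) ≤ 2 ^ K * geomKer θ q := by
    intro q
    have a1 := abs_nonneg η
    rw [geomKer, ← two_rpow_add, bddKer]
    split_ifs with a b
    · rw [one_mul]
      have hq : |(q : ℝ)| ≤ 7 := by
        rw [zero_sub, abs_neg] at a
        exact_mod_cast a
      have : -(q * η) ≤ 7 * |η| := by
        calc -(q * η) ≤ |q * η| := neg_le_abs _
          _ = |(q : ℝ)| * |η| := abs_mul _ _
          _ ≤ 7 * |η| := by gcongr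
      exact two_rpow_le (by nlinarith)
    · have hq : (q : ℝ) ≤ 0 := by exact_mod_cast b
      rw [← two_rpow_add, abs_of_nonpos hq]
      push_cast
      exact two_rpow_le (by nlinarith)
    · have hq : 0 ≤ (q : ℝ) := by exact_mod_cast (by omega : 0 ≤ q)
      rw [← two_rpow_add, abs_of_nonneg hq]
      push_cast
      exact two_rpow_le (by nlinarith)
  refine (ENNReal.tsum_le_tsum hle).trans_lt ?_
  rw [ENNReal.tsum_mul_left]
  exact ENNReal.mul_lt_top (two_rpow_ne_top _).lt_top (tsum_geomKer_lt_top h0)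


/-! ### Estimates in Chemin--Lerner spaces -/

theorem measurableSet_timeInterval (T : ℝ≥0∞) : MeasurableSet (timeInterval T) :=
  measurableSet_Ici.inter (measurableSet_lt ENNReal.measurable_ofReal measurable_const)

theorem one_le_of_inv_eq_add {a b c : ℝ≥0∞} (ha : 1 ≤ a) (h : a⁻¹ = b⁻¹ + c⁻¹) :
    1 ≤ b ∧ 1 ≤ c := by
  have h1 : a⁻¹ ≤ 1 := ENNReal.inv_le_one.mpr ha
  rw [h] at h1
  exact ⟨ENNReal.inv_le_one.mp (le_self_add.trans h1), ENNReal.inv_le_one.mp (le_add_self.trans h1)⟩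

theorem aestronglyMeasurable_cross {α : Type*} [MeasurableSpace α] {μ : Measure α}
    {v w : α → Fin 3 → ℂ} (hv : ∀ i, AEStronglyMeasurable (fun x => v x i) μ)
    (hw : ∀ i, AEStronglyMeasurable (fun x => w x i) μ) (i : Fin 3) :
    AEStronglyMeasurable (fun x => (v x ⨯₃ w x) i) μ := by
  fin_cases i
  · exact ((hv 1).mul (hw 2)).sub ((hv 2).mul (hw 1))
  · exact ((hv 2).mul (hw 0)).sub ((hv 0).mul (hw 2))
  · exact ((hv 0).mul (hw 1)).sub ((hv 1).mul (hw 0))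

theorem two_rpow_neg_mul (x : ℝ) (y : ℝ≥0∞) : (2 : ℝ≥0∞) ^ (-x) * (2 ^ x * y) = y := by
  rw [← mul_assoc, ← two_rpow_add]
  simp

/-- An $\ell^c$ sequence is bounded, and a weight that beats $2^{|\sigma||m|}$ by one power makes it
summable. This converts the regularity of the output into the condition for synthesis. -/
theorem tsum_lt_top_of_eLpNorm {e : ℤ → ℝ≥0∞} {σ : ℝ} {c : ℝ≥0∞} (hc : 1 ≤ c) {N : ℕ}
    (hN : |σ| + 1 ≤ N)
    (h : eLpNorm (fun m : ℤ => (2 : ℝ≥0∞) ^ ((m : ℝ) * σ) * e m) c Measure.count < ∞) :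
    ∑' m : ℤ, (2 : ℝ≥0∞) ^ (-(N * |(m : ℝ)|)) * e m < ∞ := by
  set X := eLpNorm (fun m : ℤ => (2 : ℝ≥0∞) ^ ((m : ℝ) * σ) * e m) c Measure.count
  have h1 : ∀ m : ℤ, (2 : ℝ≥0∞) ^ ((m : ℝ) * σ) * e m ≤ X := fun m =>
    enorm_le_eLpNorm_count (fun m : ℤ => (2 : ℝ≥0∞) ^ ((m : ℝ) * σ) * e m) m
      (zero_lt_one.trans_le hc).ne'
  refine lt_of_le_of_lt (b := ∑' m, geomKer 1 m * X) (ENNReal.tsum_le_tsum fun m => ?_) ?_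
  · refine le_trans ?_ (mul_le_mul_right (h1 m) _)
    rw [geomKer, ← mul_assoc, ← two_rpow_add]
    refine mul_le_mul_left (two_rpow_le ?_) _
    have h2 : -((m : ℝ) * σ) ≤ |(m : ℝ)| * |σ| := (neg_le_abs _).trans (abs_mul _ _).le
    nlinarith [abs_nonneg (m : ℝ)]
  · rw [ENNReal.tsum_mul_right]
    exact ENNReal.mul_lt_top (tsum_geomKer_lt_top one_pos) h

/-- The Leray projection of a series of time-dependent fields, with an estimate in a
Chemin--Lerner space. -/
theorem exists_leray_cheminLernerNorm_le (L : LittlewoodPaley) {T : ℝ≥0∞} {ι : Type*} [Countable ι]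
    {y : ι → ℝ → E3 → Fin 3 → ℂ}
    (hy : ∀ n i, AEStronglyMeasurable (Function.uncurry fun t x => y n t x i)
      ((volume.restrict (timeInterval T)).prod volume))
    (hy2 : ∀ᵐ t ∂volume.restrict (timeInterval T), ∀ n i, MemLp (fun x => y n t x i) 2)
    {b : ι → ℤ → ℝ → ℝ≥0∞} (hbm : ∀ n m, AEMeasurable (b n m) (volume.restrict (timeInterval T)))
    (hb : ∀ᵐ t ∂volume.restrict (timeInterval T), ∀ n m, annNorm m (lerayFT (y n t)) ≤ b n m t)
    {σ : ℝ} {a c X : ℝ≥0∞} (ha : 1 ≤ a) (hc : 1 ≤ c)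
    (hX : eLpNorm (fun m : ℤ => (2 : ℝ≥0∞) ^ ((m : ℝ) * σ) *
      ∑' n, eLpNorm (b n m) a (volume.restrict (timeInterval T))) c Measure.count ≤ X)
    (hX' : X < ∞) :
    ∃ H : ℝ → VecDist, WeaklyMeasurable T H ∧
      (∀ᵐ t ∂volume.restrict (timeInterval T), ∀ Φ : VecSchwartz, (∀ i, IsS0 (Φ i)) →
        HasSum (fun n => ∫ x, y n t x ⬝ᵥ fun i => curl (curl Φ) i x) (negLaplacePair (H t) Φ)) ∧
      cheminLernerNorm L T a σ 2 c H ≤ 3 * L.multBound * X := by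
  set μ := volume.restrict (timeInterval T)
  obtain ⟨N, hN⟩ := exists_nat_ge (|σ| + 1)
  have hS : ∀ m, AEMeasurable (fun t => ∑' n, b n m t) μ := fun m =>
    AEMeasurable.tsum fun n => hbm n m
  have hS2 : ∀ m, eLpNorm (fun t => ∑' n, b n m t) a μ ≤ ∑' n, eLpNorm (b n m) a μ := fun m =>
    eLpNorm_enorm_tsum_le (fun n => hbm n m) ha
  -- The Chemin–Lerner norm takes the time norm of each block before summing. Minkowski bounds the
  -- $L^a$ norm in time of the weighted series, which is therefore finite at almost every time.
  have hfin : ∀ᵐ t ∂μ, ∑' m : ℤ, (2 : ℝ≥0∞) ^ (-(N * |(m : ℝ)|)) * ∑' n, b n m t < ∞ := by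
    refine ae_lt_top_of_eLpNorm (AEMeasurable.tsum fun m => (hS m).const_mul _) ha ?_
    refine lt_of_le_of_lt (eLpNorm_enorm_tsum_le (fun m => (hS m).const_mul _) ha) ?_
    refine lt_of_le_of_lt (ENNReal.tsum_le_tsum fun m => ?_)
      (tsum_lt_top_of_eLpNorm hc hN (hX.trans_lt hX'))
    exact (eLpNorm_const_mul_le _ (hS m)).trans (mul_le_mul_right (hS2 m) _)
  obtain ⟨H, h1, h2⟩ := exists_leray_of_series L hy hy2 hb hfin
  refine ⟨H, h1, h2.mono fun t ht => ht.1, ?_⟩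
  refine le_trans ?_ (mul_le_mul_right hX _)
  refine le_trans (eLpNorm_mono_enorm fun m => ?_)
    (eLpNorm_const_mul_le _ (measurable_of_countable _).aemeasurable)
  simp only [enorm_eq_self]
  rw [mul_left_comm]
  refine mul_le_mul_right ?_ _
  refine le_trans ?_ (mul_le_mul_right (hS2 m) _)
  refine le_trans (eLpNorm_mono_enorm_ae ?_) (eLpNorm_const_mul_le _ (hS m))
  filter_upwards [h2] with t ht
  exact ht.2 m

namespace LittlewoodPaley

variable {L : LittlewoodPaley}

theorem aemeasurable_spaceNorm_block {T : ℝ≥0∞} {u : ℝ → VecDist} (hu : WeaklyMeasurable T u)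
    (k : ℤ) : AEMeasurable (fun t => spaceNorm 2 (L.block k (u t)))
      (volume.restrict (timeInterval T)) :=
  aemeasurable_spaceNorm_two fun i => aestronglyMeasurable_block L hu k i

theorem timeSpaceNorm_block_lt_top {T r q : ℝ≥0∞} {s : ℝ} (hq : 1 ≤ q) {u : ℝ → VecDist}
    (h : cheminLernerNorm L T r s 2 q u < ∞) (k : ℤ) :
    timeSpaceNorm T r 2 (fun t => L.block k (u t)) < ∞ := by
  have h1 := (enorm_le_eLpNorm_count (fun k : ℤ => (2 : ℝ≥0∞) ^ ((k : ℝ) * s) *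
    timeSpaceNorm T r 2 (fun t => L.block k (u t))) k (zero_lt_one.trans_le hq).ne').trans_lt h
  rw [enorm_eq_self] at h1
  rw [← two_rpow_neg_mul ((k : ℝ) * s) (timeSpaceNorm T r 2 fun t => L.block k (u t))]
  exact ENNReal.mul_lt_top (two_rpow_ne_top _).lt_top h1

theorem ae_spaceNorm_block_lt_top {T r q : ℝ≥0∞} {s : ℝ} (hr : 1 ≤ r) (hq : 1 ≤ q)
    {u : ℝ → VecDist} (hu : WeaklyMeasurable T u) (h : cheminLernerNorm L T r s 2 q u < ∞) :
    ∀ᵐ t ∂volume.restrict (timeInterval T), ∀ k, spaceNorm 2 (L.block k (u t)) < ∞ :=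
  ae_all_iff.mpr fun k => ae_lt_top_of_eLpNorm (aemeasurable_spaceNorm_block hu k) hr
    (timeSpaceNorm_block_lt_top hq h k)

theorem memLp_block_mul {F G : VecDist} {j k : ℤ} (hF : spaceNorm 2 (L.block j F) < ∞)
    (hG : spaceNorm 2 (L.block k G) < ∞) (a b : Fin 3) :
    MemLp (fun x => L.block j F x a * L.block k G x b) 2 := by
  simp only [(spectralRep_block hF).apply, (spectralRep_block hG).apply]
  exact memLp_fourierInv_mul ((spectralRep_block hF).integrable a) ((spectralRep_block hG).memLp b)
    ((spectralRep_block hG).integrable b)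

theorem rpow_mul_paraKer_add (s η : ℝ) (m p q : ℤ) (A B : ℝ≥0∞) :
    (2 : ℝ≥0∞) ^ ((m : ℝ) * (s + η - 3 / 2)) * (paraKer m (m + p) (m + q) * (A * B)) =
      weightKer s η (p, q) * ((2 ^ (((m + p : ℤ) : ℝ) * s) * A) *
        (2 ^ (((m + q : ℤ) : ℝ) * η) * B)) := by
  rw [paraKer_add, weightKer]
  have e : (2 : ℝ≥0∞) ^ ((m : ℝ) * (s + η - 3 / 2)) * 2 ^ ((3 / 2 : ℝ) * m) =
      2 ^ (-(p * s + q * η) : ℝ) * (2 ^ (((m + p : ℤ) : ℝ) * s) * 2 ^ (((m + q : ℤ) : ℝ) * η)) := by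
    simp only [← two_rpow_add]
    congr 1
    push_cast
    ring
  calc _ = ((2 : ℝ≥0∞) ^ ((m : ℝ) * (s + η - 3 / 2)) * 2 ^ ((3 / 2 : ℝ) * m)) *
        (paraKer 0 p q * (A * B)) := by ring
    _ = _ := by rw [e]; ring

/-- The Leray projection of the cross product of two fields of distributions, with an estimate
by the convolution of the sequences that define the norms of the factors. -/
theorem exists_isLerayCross {s η : ℝ} {a a₁ a₂ c c₁ c₂ T X : ℝ≥0∞} (ha : 1 ≤ a) (hc : 1 ≤ c)
    (hr : a⁻¹ = a₁⁻¹ + a₂⁻¹) (hc₁ : 1 ≤ c₁) (hc₂ : 1 ≤ c₂) {F G : ℝ → VecDist}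
    (hFG : Admissible T F G) (hF : cheminLernerNorm L T a₁ s 2 c₁ F < ∞)
    (hG : cheminLernerNorm L T a₂ η 2 c₂ G < ∞)
    (hX : eLpNorm (fun m : ℤ => ∑' n : ℤ × ℤ, weightKer s η n *
      (((2 : ℝ≥0∞) ^ (((m + n.1 : ℤ) : ℝ) * s) *
          timeSpaceNorm T a₁ 2 fun t => L.block (m + n.1) (F t)) *
        ((2 : ℝ≥0∞) ^ (((m + n.2 : ℤ) : ℝ) * η) *
          timeSpaceNorm T a₂ 2 fun t => L.block (m + n.2) (G t)))) c Measure.count ≤ X)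
    (hX' : X < ∞) :
    ∃ H : ℝ → VecDist, WeaklyMeasurable T H ∧
      (∀ᵐ t ∂(volume.restrict (timeInterval T)), IsLerayCross L (F t) (G t) (H t)) ∧
      cheminLernerNorm L T a (s + η - 3 / 2) 2 c H ≤ 3 * L.multBound * (bilinConst * X) := by
  obtain ⟨ha₁, ha₂⟩ := one_le_of_inv_eq_add ha hr
  have hFm := fun k => aemeasurable_spaceNorm_block (L := L) hFG.measurable_left k
  have hGm := fun k => aemeasurable_spaceNorm_block (L := L) hFG.measurable_right k
  have hF' := ae_spaceNorm_block_lt_top ha₁ hc₁ hFG.measurable_left hF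
  have hG' := ae_spaceNorm_block_lt_top ha₂ hc₂ hFG.measurable_right hG
  have hmem := ae_restrict_mem (μ := volume) (measurableSet_timeInterval T)
  obtain ⟨H, h1, h2, h3⟩ := exists_leray_cheminLernerNorm_le L (T := T) (ι := ℤ × ℤ)
    (y := fun n t x => L.block n.1 (F t) x ⨯₃ L.block n.2 (G t) x)
    (b := fun n m t => bilinConst * paraKer m n.1 n.2 *
      (spaceNorm 2 (L.block n.1 (F t)) * spaceNorm 2 (L.block n.2 (G t))))
    (σ := s + η - 3 / 2) (a := a) (c := c) (X := bilinConst * X)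
    (fun n i => aestronglyMeasurable_cross
      (fun i => aestronglyMeasurable_block L hFG.measurable_left n.1 i)
      (fun i => aestronglyMeasurable_block L hFG.measurable_right n.2 i) i)
    (by
      filter_upwards [hF', hG'] with t h1 h2 n i
      exact memLp_cross (memLp_block_mul (h1 n.1) (h2 n.2)) i)
    (fun n m => ((hFm n.1).mul (hGm n.2)).const_mul _)
    (by
      filter_upwards [hF', hG', hmem] with t h1 h2 ht n m
      exact annNorm_lerayFT_block_le (hFG.divFree t ht) (hFG.colinear t ht) (h1 n.1) (h2 n.2) m)
    ha hc (by
      refine le_trans (eLpNorm_mono_enorm fun m => ?_) ((eLpNorm_const_mul_le bilinConst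
        (measurable_of_countable _).aemeasurable).trans (mul_le_mul_right hX _))
      simp only [enorm_eq_self]
      -- Blocks are indexed relative to the output frequency, $(j,k)=(m+p,m+q)$, so that the kernel
      -- no longer depends on `m`.
      rw [← ENNReal.tsum_mul_left, ← ENNReal.tsum_mul_left,
        ← (Equiv.addLeft ((m, m) : ℤ × ℤ)).tsum_eq]
      refine ENNReal.tsum_le_tsum fun n => ?_
      rw [← rpow_mul_paraKer_add, mul_left_comm]
      refine mul_le_mul_right ?_ _
      rw [← mul_assoc]
      refine (eLpNorm_const_mul_le _ ((hFm _).mul (hGm _))).trans (mul_le_mul_right ?_ _)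
      exact eLpNorm_mul_le (hFm _) (hGm _) ha₁ ha₂ hr (timeSpaceNorm_block_lt_top hc₁ hF _)
        (timeSpaceNorm_block_lt_top hc₂ hG _))
    (ENNReal.mul_lt_top ENNReal.coe_lt_top hX')
  refine ⟨H, h1, h2.mono fun t ht => ⟨ht, fun f g hf hg hfF hgG => ?_⟩, h3⟩
  exact isLerayCrossFun_of_hasSum hf hg hfF hgG ht

end LittlewoodPaley


/-! ### Products with a bounded field in Chemin–Lerner spaces -/

namespace LittlewoodPaley

variable {L : LittlewoodPaley}

theorem rpow_mul_bddKer_add (η : ℝ) (m q : ℤ) (B : ℝ≥0∞) :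
    (2 : ℝ≥0∞) ^ ((m : ℝ) * η) * (bddKer m (m + q) * B) =
      bddKer 0 q * 2 ^ (-(q * η) : ℝ) * (2 ^ (((m + q : ℤ) : ℝ) * η) * B) := by
  have e : (2 : ℝ≥0∞) ^ ((m : ℝ) * η) = 2 ^ (-(q * η) : ℝ) * 2 ^ (((m + q : ℤ) : ℝ) * η) := by
    rw [← two_rpow_add]
    congr 1
    push_cast
    ring
  rw [bddKer_add, e]
  ring

/-- The sum of the terms with index close to `n` in the norm of `Ḃ^{3/2}_{2,1}`. -/
def localSum (L : LittlewoodPaley) (u : VecDist) (n : ℤ) : ℝ≥0∞ :=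
  ∑ j ∈ Finset.Icc (n - 4) (n + 4), (2 : ℝ≥0∞) ^ ((j : ℝ) * (3 / 2)) * spaceNorm 2 (L.block j u)

theorem aemeasurable_localSum {T : ℝ≥0∞} {u : ℝ → VecDist} (hu : WeaklyMeasurable T u) (n : ℤ) :
    AEMeasurable (fun t => L.localSum (u t) n) (volume.restrict (timeInterval T)) :=
  Finset.aemeasurable_fun_sum _ fun j _ => (aemeasurable_spaceNorm_block hu j).const_mul _

theorem eLpNorm_localSum_le {T r : ℝ≥0∞} (hr : 1 ≤ r) {u : ℝ → VecDist} (hu : WeaklyMeasurable T u)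
    (n : ℤ) : eLpNorm (fun t => L.localSum (u t) n) r (volume.restrict (timeInterval T)) ≤
      9 * cheminLernerNorm L T r (3 / 2) 2 ∞ u := by
  have hm := fun j : ℤ => (aemeasurable_spaceNorm_block (L := L) hu j).const_mul
    ((2 : ℝ≥0∞) ^ ((j : ℝ) * (3 / 2)))
  have h1 := eLpNorm_sum_le (s := Finset.Icc (n - 4) (n + 4))
    (f := fun (j : ℤ) t => (2 : ℝ≥0∞) ^ ((j : ℝ) * (3 / 2)) * spaceNorm 2 (L.block j (u t)))
    (fun j _ => (hm j).aestronglyMeasurable) hr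
  refine le_trans (le_of_eq ?_) (h1.trans ?_)
  · congr 1 with t
    simp [localSum]
  · refine (Finset.sum_le_card_nsmul _ _ (cheminLernerNorm L T r (3 / 2) 2 ∞ u) fun j _ => ?_).trans
      (le_of_eq ?_)
    · refine (eLpNorm_const_mul_le _ (aemeasurable_spaceNorm_block hu j)).trans ?_
      exact enorm_le_eLpNorm_count (fun k : ℤ => (2 : ℝ≥0∞) ^ ((k : ℝ) * (3 / 2)) *
        timeSpaceNorm T r 2 (fun t => L.block k (u t))) j ENNReal.top_ne_zero
    · rw [Int.card_Icc, show n + 4 + 1 - (n - 4) = 9 by ring]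
      simp

/-- The Leray projection of the cross product of a bounded field and of a field of distributions. -/
theorem exists_isLerayCrossBdd {η : ℝ} {a a₁ a₂ c T : ℝ≥0∞} (ha : 1 ≤ a) (hc : 1 ≤ c)
    (hr : a⁻¹ = a₁⁻¹ + a₂⁻¹) {F G : ℝ → VecDist} {f : ℝ → E3 → Fin 3 → ℂ}
    (hFG : Admissible T F G) (hf : AEStronglyMeasurable (Function.uncurry f)
      ((volume.restrict (timeInterval T)).prod volume))
    (hfF : ∀ᵐ t ∂(volume.restrict (timeInterval T)), Represents (f t) (F t))
    (hM : timeSpaceNorm T a₁ ∞ f < ∞) (hF : cheminLernerNorm L T a₁ (3 / 2) 2 ∞ F < ∞)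
    (hG : cheminLernerNorm L T a₂ η 2 c G < ∞)
    (hη : ∑' q : ℤ, bddKer 0 q * (2 : ℝ≥0∞) ^ (-(q * η) : ℝ) < ∞) :
    ∃ H : ℝ → VecDist, WeaklyMeasurable T H ∧
      (∀ᵐ t ∂(volume.restrict (timeInterval T)), IsLerayCrossBdd L (f t) (G t) (H t)) ∧
      cheminLernerNorm L T a η 2 c H ≤ 3 * L.multBound * (bddConst *
        (9 * (timeSpaceNorm T a₁ ∞ f + cheminLernerNorm L T a₁ (3 / 2) 2 ∞ F)) *
        ((∑' q : ℤ, bddKer 0 q * (2 : ℝ≥0∞) ^ (-(q * η) : ℝ)) *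
          cheminLernerNorm L T a₂ η 2 c G)) := by
  obtain ⟨ha₁, ha₂⟩ := one_le_of_inv_eq_add ha hr
  have hGm := fun k => aemeasurable_spaceNorm_block (L := L) hFG.measurable_right k
  have hfi : ∀ i, AEStronglyMeasurable (Function.uncurry fun t x => f t x i)
      ((volume.restrict (timeInterval T)).prod volume) := fun i =>
    (continuous_apply i).comp_aestronglyMeasurable hf
  have hfm : AEMeasurable (fun t => spaceNorm ∞ (f t)) (volume.restrict (timeInterval T)) :=
    aemeasurable_spaceNorm_top hfi
  have hft : ∀ᵐ t ∂volume.restrict (timeInterval T), AEStronglyMeasurable (f t) :=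
    hf.prodMk_left
  have hfM : ∀ᵐ t ∂volume.restrict (timeInterval T), spaceNorm ∞ (f t) < ∞ :=
    ae_lt_top_of_eLpNorm hfm ha₁ hM
  have hF' := ae_spaceNorm_block_lt_top ha₁ le_top hFG.measurable_left hF
  have hG' := ae_spaceNorm_block_lt_top ha₂ hc hFG.measurable_right hG
  have hmem := ae_restrict_mem (μ := volume) (measurableSet_timeInterval T)
  set K := timeSpaceNorm T a₁ ∞ f + cheminLernerNorm L T a₁ (3 / 2) 2 ∞ F
  have hK : 9 * K < ∞ := ENNReal.mul_lt_top (by simp) (ENNReal.add_lt_top.mpr ⟨hM, hF⟩)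
  -- A supremum over all blocks inside the time norm is not controlled by the Chemin–Lerner norm of
  -- $F$. Only nine blocks enter for each pair of frequencies, and their sum is controlled with the
  -- factor 9.
  have hsm := fun n : ℤ => hfm.add (aemeasurable_localSum (L := L) hFG.measurable_left n)
  have hs : ∀ n, eLpNorm (fun t => spaceNorm ∞ (f t) + L.localSum (F t) n) a₁
      (volume.restrict (timeInterval T)) ≤ 9 * K := fun n => by
    refine (eLpNorm_add_le hfm.aestronglyMeasurable
      (aemeasurable_localSum hFG.measurable_left n).aestronglyMeasurable ha₁).trans ?_
    rw [mul_add]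
    refine add_le_add ?_ (eLpNorm_localSum_le ha₁ hFG.measurable_left n)
    exact le_mul_of_one_le_left zero_le (by norm_num)
  obtain ⟨H, h1, h2, h3⟩ := exists_leray_cheminLernerNorm_le L (T := T) (ι := ℤ)
    (y := fun k t x => f t x ⨯₃ L.block k (G t) x)
    (b := fun k m t => bddConst * bddKer m k *
      ((spaceNorm ∞ (f t) + L.localSum (F t) (max m k)) * spaceNorm 2 (L.block k (G t))))
    (σ := η) (a := a) (c := c) (X := bddConst * (9 * K) *
      ((∑' q : ℤ, bddKer 0 q * (2 : ℝ≥0∞) ^ (-(q * η) : ℝ)) * cheminLernerNorm L T a₂ η 2 c G))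
    (fun k i => aestronglyMeasurable_cross hfi
      (fun i => aestronglyMeasurable_block L hFG.measurable_right k i) i)
    (by
      filter_upwards [hft, hfM, hG'] with t h1 h2 h3 k i
      exact memLp_cross (fun a b => memLp_bounded_mul h1 h2 (memLp_block (h3 k) b) a) i)
    (fun k m => ((hsm _).mul (hGm k)).const_mul _)
    (by
      filter_upwards [hft, hfM, hF', hG', hmem, hfF] with t h1 h2 h3 h4 ht h5 k m
      exact annNorm_lerayFT_bdd_le (hFG.divFree t ht) (hFG.colinear t ht) h5 h1 h2 h3 (h4 k) m
        fun j hj => Finset.single_le_sum (f := fun j : ℤ => (2 : ℝ≥0∞) ^ ((j : ℝ) * (3 / 2)) *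
          spaceNorm 2 (L.block j (F t))) (fun _ _ => zero_le) hj)
    ha hc (by
      refine le_trans (eLpNorm_mono_enorm fun m => ?_) ((eLpNorm_const_mul_le (bddConst * (9 * K))
        (measurable_of_countable _).aemeasurable).trans
        (mul_le_mul_right (eLpNorm_convolution_le hc) _))
      simp only [enorm_eq_self]
      rw [← ENNReal.tsum_mul_left, ← ENNReal.tsum_mul_left, ← (Equiv.addLeft m).tsum_eq]
      refine ENNReal.tsum_le_tsum fun q => ?_
      rw [Equiv.coe_addLeft, ← rpow_mul_bddKer_add]
      refine le_trans (mul_le_mul_right (show _ ≤ bddConst * bddKer m (m + q) * (9 * K *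
        timeSpaceNorm T a₂ 2 fun t => L.block (m + q) (G t)) from ?_) _) (le_of_eq (by ring))
      refine (eLpNorm_const_mul_le _ ((hsm _).mul (hGm _))).trans (mul_le_mul_right ?_ _)
      refine (eLpNorm_mul_le (hsm _) (hGm _) ha₁ ha₂ hr ((hs _).trans_lt hK)
        (timeSpaceNorm_block_lt_top hc hG _)).trans ?_
      exact mul_le_mul_left (hs _) _)
    (ENNReal.mul_lt_top (ENNReal.mul_lt_top ENNReal.coe_lt_top hK) (ENNReal.mul_lt_top hη hG))
  refine ⟨H, h1, ?_, h3⟩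
  filter_upwards [h2, hft, hfM] with t ht h4 h5
  exact ⟨ht, fun g hg hgG => isLerayCrossFun_of_hasSum_bdd h4 h5 hg hgG ht⟩

end LittlewoodPaley


namespace LittlewoodPaley

variable {L : LittlewoodPaley}

/-- The Leray projection of the cross product of two fields of distributions, when the weighted
kernel is bounded on the spaces of sequences at hand. -/
theorem exists_isLerayCross_of_kernel {s η : ℝ} {a a₁ a₂ c c₁ c₂ T K : ℝ≥0∞} (ha : 1 ≤ a)
    (hc : 1 ≤ c) (hr : a⁻¹ = a₁⁻¹ + a₂⁻¹) (hc₁ : 1 ≤ c₁) (hc₂ : 1 ≤ c₂) (hK : K < ∞)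
    (hker : ∀ f g : ℤ → ℝ≥0∞, eLpNorm f c₁ Measure.count < ∞ → eLpNorm g c₂ Measure.count < ∞ →
      eLpNorm (fun m => ∑' n : ℤ × ℤ, weightKer s η n * (f (m + n.1) * g (m + n.2))) c
        Measure.count ≤ K * (eLpNorm f c₁ Measure.count * eLpNorm g c₂ Measure.count))
    {F G : ℝ → VecDist} (hFG : Admissible T F G) (hF : cheminLernerNorm L T a₁ s 2 c₁ F < ∞)
    (hG : cheminLernerNorm L T a₂ η 2 c₂ G < ∞) :
    ∃ H : ℝ → VecDist, WeaklyMeasurable T H ∧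
      (∀ᵐ t ∂(volume.restrict (timeInterval T)), IsLerayCross L (F t) (G t) (H t)) ∧
      cheminLernerNorm L T a (s + η - 3 / 2) 2 c H ≤ (3 * L.multBound * bilinConst * K.toNNReal :
        ℝ≥0) * cheminLernerNorm L T a₁ s 2 c₁ F * cheminLernerNorm L T a₂ η 2 c₂ G := by
  obtain ⟨H, h1, h2, h3⟩ := exists_isLerayCross ha hc hr hc₁ hc₂ hFG hF hG
    (hker (fun j : ℤ => (2 : ℝ≥0∞) ^ ((j : ℝ) * s) * timeSpaceNorm T a₁ 2 fun t => L.block j (F t))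
      (fun j : ℤ => (2 : ℝ≥0∞) ^ ((j : ℝ) * η) * timeSpaceNorm T a₂ 2 fun t => L.block j (G t))
      hF hG)
    (ENNReal.mul_lt_top hK (ENNReal.mul_lt_top hF hG))
  refine ⟨H, h1, h2, h3.trans (le_of_eq ?_)⟩
  push_cast
  rw [ENNReal.coe_toNNReal hK.ne]
  simp only [cheminLernerNorm]
  ring

end LittlewoodPaley

end

/-! ### The three cases of the theorem -/

theorem lemma2p3 (L : LittlewoodPaley) :
    -- the range `s < 3/2`, `η < 5/2`, `s + η > 0`
    (∀ s η : ℝ, s < 3 / 2 → η < 5 / 2 → 0 < s + η → ∃ C : ℝ≥0,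
      ∀ (a a₁ a₂ c c₁ c₂ : ℝ≥0∞), 1 ≤ a → 1 ≤ c → a⁻¹ = a₁⁻¹ + a₂⁻¹ → c⁻¹ = c₁⁻¹ + c₂⁻¹ →
      ∀ (T : ℝ≥0∞) (F G : ℝ → VecDist), Admissible T F G →
        cheminLernerNorm L T a₁ s 2 c₁ F < ∞ → cheminLernerNorm L T a₂ η 2 c₂ G < ∞ →
        ∃ H : ℝ → VecDist, WeaklyMeasurable T H ∧
          (∀ᵐ t ∂(volume.restrict (timeInterval T)), IsLerayCross L (F t) (G t) (H t)) ∧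
          cheminLernerNorm L T a (s + η - 3 / 2) 2 c H ≤
            C * cheminLernerNorm L T a₁ s 2 c₁ F * cheminLernerNorm L T a₂ η 2 c₂ G) ∧
    -- the endpoint `s = 3/2`
    (∀ η : ℝ, -(3 / 2) < η → η < 5 / 2 → ∃ C : ℝ≥0,
      ∀ (a a₁ a₂ c : ℝ≥0∞), 1 ≤ a → 1 ≤ c → a⁻¹ = a₁⁻¹ + a₂⁻¹ →
      ∀ (T : ℝ≥0∞) (F G : ℝ → VecDist) (f : ℝ → E3 → Fin 3 → ℂ), Admissible T F G →
        AEStronglyMeasurable (Function.uncurry f)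
          ((volume.restrict (timeInterval T)).prod volume) →
        (∀ᵐ t ∂(volume.restrict (timeInterval T)), Represents (f t) (F t)) →
        timeSpaceNorm T a₁ ∞ f < ∞ → cheminLernerNorm L T a₁ (3 / 2) 2 ∞ F < ∞ →
        cheminLernerNorm L T a₂ η 2 c G < ∞ →
        ∃ H : ℝ → VecDist, WeaklyMeasurable T H ∧
          (∀ᵐ t ∂(volume.restrict (timeInterval T)), IsLerayCrossBdd L (f t) (G t) (H t)) ∧
          cheminLernerNorm L T a η 2 c H ≤
            C * (timeSpaceNorm T a₁ ∞ f + cheminLernerNorm L T a₁ (3 / 2) 2 ∞ F) *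
              cheminLernerNorm L T a₂ η 2 c G) ∧
    -- the endpoint `η = 5/2`; the value `s = 3/2` is allowed if `c = 1`
    (∀ s : ℝ, -(5 / 2) < s → s ≤ 3 / 2 → ∃ C : ℝ≥0,
      ∀ (a a₁ a₂ c : ℝ≥0∞), 1 ≤ a → 1 ≤ c → a⁻¹ = a₁⁻¹ + a₂⁻¹ → (s = 3 / 2 → c = 1) →
      ∀ (T : ℝ≥0∞) (F G : ℝ → VecDist), Admissible T F G →
        cheminLernerNorm L T a₁ s 2 c F < ∞ → cheminLernerNorm L T a₂ (5 / 2) 2 1 G < ∞ →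
        ∃ H : ℝ → VecDist, WeaklyMeasurable T H ∧
          (∀ᵐ t ∂(volume.restrict (timeInterval T)), IsLerayCross L (F t) (G t) (H t)) ∧
          cheminLernerNorm L T a (s + 1) 2 c H ≤
            C * cheminLernerNorm L T a₁ s 2 c F * cheminLernerNorm L T a₂ (5 / 2) 2 1 G) := by
  refine ⟨fun s η hs hη hsη => ?_, fun η hη hη' => ?_, fun s hs hs' => ?_⟩
  · refine ⟨3 * L.multBound * bilinConst * (∑' n, weightKer s η n).toNNReal,
      fun a a₁ a₂ c c₁ c₂ ha hc hr hr' T F G hFG hF hG => ?_⟩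
    obtain ⟨hc₁, hc₂⟩ := one_le_of_inv_eq_add hc hr'
    exact LittlewoodPaley.exists_isLerayCross_of_kernel ha hc hr hc₁ hc₂
      (tsum_weightKer_lt_top hs hη hsη)
      (fun f g hf hg => eLpNorm_convolution_mul_le hc hc₁ hc₂ hr' hf hg) hFG hF hG
  · have hK := tsum_bddKer_lt_top hη hη'
    -- Here $27=3\cdot9$: three components, nine blocks of the bounded field.
    refine ⟨27 * L.multBound * LittlewoodPaley.bddConst *
      (∑' q : ℤ, bddKer 0 q * (2 : ℝ≥0∞) ^ (-(q * η) : ℝ)).toNNReal,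
      fun a a₁ a₂ c ha hc hr T F G f hFG hf hfF hM hF hG => ?_⟩
    obtain ⟨H, h1, h2, h3⟩ :=
      LittlewoodPaley.exists_isLerayCrossBdd ha hc hr hFG hf hfF hM hF hG hK
    refine ⟨H, h1, h2, h3.trans (le_of_eq ?_)⟩
    push_cast
    rw [ENNReal.coe_toNNReal hK.ne]
    generalize ∑' q : ℤ, bddKer 0 q * (2 : ℝ≥0∞) ^ (-(q * η) : ℝ) = K
    ring
  · have e : s + 1 = s + 5 / 2 - 3 / 2 := by ring
    rw [e]
    -- Below the endpoint the kernel decays in the index of $F$ and any $c$ is allowed. At $s=3/2$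
    -- only the bound by a sum is available, which uses $\ell^1$ on both sides.
    rcases hs'.lt_or_eq with h | rfl
    · obtain ⟨ρ, hρ, hle⟩ := exists_weightKer_le_left h hs
      refine ⟨3 * L.multBound * bilinConst * (∑' p, ρ p).toNNReal,
        fun a a₁ a₂ c ha hc hr _ T F G hFG hF hG => ?_⟩
      exact LittlewoodPaley.exists_isLerayCross_of_kernel ha hc hr hc le_rfl hρ
        (fun f g _ _ => eLpNorm_convolution_left_le hc hle) hFG hF hG
    · obtain ⟨ρ, ρ', hρ, hρ', hle⟩ := exists_weightKer_le_add
      refine ⟨3 * L.multBound * bilinConst * ((∑' p, ρ p) + ∑' q, ρ' q).toNNReal,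
        fun a a₁ a₂ c ha hc hr h1 T F G hFG hF hG => ?_⟩
      obtain rfl := h1 rfl
      exact LittlewoodPaley.exists_isLerayCross_of_kernel ha hc hr le_rfl le_rfl
        (ENNReal.add_lt_top.mpr ⟨hρ, hρ'⟩)
        (fun f g _ _ => eLpNorm_convolution_one_le hle) hFG hF hG
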